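/- Let $E\subset\mathbb C$ be a compact connected set with connected complement, for which there is a conformal map $\Phi_E$ of $\mathbb C\setminus E$ onto $\{|w|>1\}$ with $\Phi_E(\infty)=\infty$ and $\Phi_E'(\infty)=\lim_{z\to\infty}\Phi_E(z)/z>0$. For $\rho>1$ put $D_\rho=E\cup\{z\notin E:|\Phi_E(z)|<\rho\}$. Let $\mathcal H(E)$ be the set of functions holomorphic in a neighborhood of $E$. Let $\alpha_{n,k}\in E$ ($1\le k\le n$, $n\ge1$), let $a_n(z)=\prod_{k=1}^n(z-\alpha_{n,k})$, and suppose that for some constant $c>0$ $$\lim_{n\to\infty}\frac{a_n(z)}{c^n\Phi_E(z)^n}=G(z)\ne0$$ uniformly on compact subsets of $\overline{\mathbb C}\setminus E$. Let $\mathbf f=(f_1,\dots,f_d)\in\mathcal H(E)^d$ and let $\mathbf m=(m_1,\dots,m_d)$ be a multi-index of non-negative integers, $|\mathbf m|=m_1+\dots+m_d$. For each $n\ge|\mathbf m|$ let $Q_{n,\mathbf m}$ be any monic polynomial with $\deg Q_{n,\mathbf m}\le|\mathbf m|$ for which there are polynomials $P_{n,\mathbf m,k}$, $\deg P_{n,\mathbf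 m,k}\le n-m_k$, with $(Q_{n,\mathbf m}f_k-P_{n,\mathbf m,k})/a_{n+1}\in\mathcal H(E)$, $k=1,\dots,d$ (a denominator of a multipoint Hermite–Padé approximant of $\mathbf f$). Call $g$ a combination if $g=\sum_{k=1}^dp_kf_k$ with polynomials $p_k$, $\deg p_k<m_k$. For $\xi\in\mathbb C\setminus E$ and $s\ge1$ let $\mathcal G_{\xi,s}$ be the set of combinations that extend to a neighborhood of $\overline{D}_{|\Phi_E(\xi)|}$ analytically except for a pole at $\xi$ of exact order $s$. The point $\xi$ is a system pole of order $\tau$ of $(\mathbf f,\mathbf m)$ if $\tau$ is the largest positive integer such that $\mathcal G_{\xi,s}\neq\emptyset$ for every $s=1,\dots,\tau$. For $g\in\mathcal H(E)$ let $\rho_s(g)\in(1,\infty]$ be the index $\rho$ of the largest $D_\rho$ to which $g$ extends meromorphically with at most $s$ poles, counting multiplicities (where this is possible for some $\rho>1$). For a system pole $\xi$ of order $\tau$ and $1\le s\le\tau$ put $$\rho_{\xi,s}(\mathbf f,\mathbf m)=\sup_{g\in\mathcal G_{\xi,s}}\rho_s(g),\qquad R_{\xi,s}(\mathbf f,\mathbf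 m)=\min_{k=1,\dots,s}\rho_{\xi,k}(\mathbf f,\mathbf m).$$ Suppose that $\mathbf f$ has exactly $|\mathbf m|$ system poles with respect to $\mathbf m$, counted with their orders. Then for every system pole $\xi$, of order $\tau$, and every $l=0,1,\dots,\tau-1$, $$\max_{j=0,\dots,l}\ \limsup_{n\to\infty}\bigl|Q_{n,\mathbf m}^{(j)}(\xi)\bigr|^{1/n}=\frac{|\Phi_E(\xi)|}{R_{\xi,l+1}(\mathbf f,\mathbf m)},$$ where the right-hand side is $0$ if $R_{\xi,l+1}(\mathbf f,\mathbf m)=\infty$. -/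

import Mathlib

open Filter Topology Polynomial
open scoped ENNReal

namespace HermitePade

/-- `Φ` restricted to the complement of `E` is the conformal map of the complement of `E` onto the
exterior of the closed unit disk with `Φ(∞) = ∞` and `Φ'(∞) > 0`, where
`Φ'(∞) = lim_{z → ∞} Φ(z) / z`.  Values of `Φ` on `E` are irrelevant. -/
structure IsExteriorMap (E : Set ℂ) (Φ : ℂ → ℂ) : Prop where
  analytic : AnalyticOnNhd ℂ Φ Eᶜ
  injective : Set.InjOn Φ Eᶜ
  image : Φ '' Eᶜ = {w : ℂ | 1 < ‖w‖}
  at_infinity : ∃ b : ℝ, 0 < b ∧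
    Tendsto (fun z : ℂ => Φ z / z) (Bornology.cobounded ℂ) (𝓝 (b : ℂ))

/-- The canonical domain `D_ρ = E ∪ {z : |Φ(z)| < ρ}`, for `ρ > 1`. -/
def canonicalDomain (E : Set ℂ) (Φ : ℂ → ℂ) (ρ : ℝ) : Set ℂ :=
  E ∪ {z : ℂ | z ∉ E ∧ ‖Φ z‖ < ρ}

/-- The nodal polynomial `a_n(z) = ∏_{k=1}^n (z - α_{n,k})`. -/
noncomputable def nodal (α : ℕ → ℕ → ℂ) (n : ℕ) : ℂ[X] :=
  ∏ k ∈ Finset.Icc 1 n, (X - C (α n k))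

/-- `a_n / (c^n Φ^n) → G`, with `G` zero-free, uniformly on compact subsets of `ℂ̄ \ E`.  The finite
parts of the compact subsets of `ℂ̄ \ E` are exactly the closed subsets of `ℂ` disjoint from
`E`; the value of `G` at `∞` is its limit there. -/
structure NodesAsymptotic (E : Set ℂ) (Φ : ℂ → ℂ) (α : ℕ → ℕ → ℂ) (c : ℝ) (G : ℂ → ℂ) :
    Prop where
  uniform : ∀ K : Set ℂ, IsClosed K → Disjoint K E →
    TendstoUniformlyOn (fun (n : ℕ) (z : ℂ) => (nodal α n).eval z / ((c : ℂ) ^ n * Φ z ^ n))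
      G atTop K
  ne_zero : ∀ z ∉ E, G z ≠ 0
  ne_zero_at_infinity : ∃ L : ℂ, L ≠ 0 ∧ Tendsto G (Bornology.cobounded ℂ) (𝓝 L)

/-- `(P_1, …, P_d) / Q` is an `n`-th multipoint Hermite–Padé approximant of `f` with respect to the
multi-index `m` and the table `α`.  (`degree 0 = ⊥`, so the degree condition on `P k` reads
`P k = 0` when `n < m k`.) -/
structure IsApproximant (E : Set ℂ) (α : ℕ → ℕ → ℂ) {d : ℕ} (f : Fin d → ℂ → ℂ)
    (m : Fin d → ℕ) (n : ℕ) (Q : ℂ[X]) (P : Fin d → ℂ[X]) : Prop where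
  degree_num : ∀ k, (P k).degree + (m k : WithBot ℕ) ≤ (n : WithBot ℕ)
  degree_den : Q.degree ≤ ((∑ k, m k : ℕ) : WithBot ℕ)
  den_ne_zero : Q ≠ 0
  interpolates : ∀ k, ∃ h : ℂ → ℂ, AnalyticOnNhd ℂ h E ∧
    ∀ᶠ z in 𝓝ˢ E, Q.eval z * f k z - (P k).eval z = (nodal α (n + 1)).eval z * h z

/-- The multiplicity of `z` as a pole of `F` (`0` if `z` is not a pole). -/
noncomputable def poleOrder (F : ℂ → ℂ) (z : ℂ) : ℕ :=
  (-(meromorphicOrderAt F z).untop₀).toNat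

/-- The function `g`, given near `E`, extends meromorphically to `D_ρ` with at most `s` poles,
counting multiplicities. -/
def ExtendsWithPoles (E : Set ℂ) (Φ : ℂ → ℂ) (g : ℂ → ℂ) (s : ℕ) (ρ : ℝ) : Prop :=
  ∃ (F : ℂ → ℂ) (S : Finset ℂ), F =ᶠ[𝓝ˢ E] g ∧
    (∀ z ∈ canonicalDomain E Φ ρ, MeromorphicAt F z) ∧
    (S : Set ℂ) ⊆ canonicalDomain E Φ ρ ∧
    (∀ z ∈ canonicalDomain E Φ ρ, z ∉ S → AnalyticAt ℂ F z) ∧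
    ∑ z ∈ S, poleOrder F z ≤ s

/-- `ρ_s(g)`: the index of the largest canonical domain in which `g` has at most `s` poles;
it may be `∞`. -/
noncomputable def poleIndex (E : Set ℂ) (Φ : ℂ → ℂ) (s : ℕ) (g : ℂ → ℂ) : ℝ≥0∞ :=
  ⨆ (ρ : ℝ) (_ : 1 < ρ) (_ : ExtendsWithPoles E Φ g s ρ), ENNReal.ofReal ρ

/-- `g` is a combination `∑ p_k f_k` with polynomials `p_k` such that `deg p_k < m_k`. -/
def IsCombination {d : ℕ} (f : Fin d → ℂ → ℂ) (m : Fin d → ℕ) (g : ℂ → ℂ) : Prop :=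
  ∃ p : Fin d → ℂ[X], (∀ k, (p k).degree < (m k : WithBot ℕ)) ∧
    g = fun z => ∑ k, (p k).eval z * f k z

/-- The function `g`, given near `E`, extends to a neighborhood of the closure of `D_{|Φ(ξ)|}`
analytically except for a pole at `ξ` of exact order `s` (for `s ≥ 1`). -/
def HasOnlyPole (E : Set ℂ) (Φ : ℂ → ℂ) (ξ : ℂ) (s : ℕ) (g : ℂ → ℂ) : Prop :=
  ξ ∉ E ∧ ∃ F : ℂ → ℂ, F =ᶠ[𝓝ˢ E] g ∧
    (∀ z ∈ closure (canonicalDomain E Φ ‖Φ ξ‖), z ≠ ξ → AnalyticAt ℂ F z) ∧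
    MeromorphicAt F ξ ∧ meromorphicOrderAt F ξ = ((-(s : ℤ) : ℤ) : WithTop ℤ)

/-- `ξ` is a system pole of order `τ` of `(f, m)`. -/
def IsSystemPole (E : Set ℂ) (Φ : ℂ → ℂ) {d : ℕ} (f : Fin d → ℂ → ℂ) (m : Fin d → ℕ)
    (ξ : ℂ) (τ : ℕ) : Prop :=
  IsGreatest {t : ℕ | 1 ≤ t ∧ ∀ s, 1 ≤ s → s ≤ t →
    ∃ g, IsCombination f m g ∧ HasOnlyPole E Φ ξ s g} τ

/-- `(f, m)` has exactly `N` system poles, counted with their orders. -/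
def HasExactlySystemPoles (E : Set ℂ) (Φ : ℂ → ℂ) {d : ℕ} (f : Fin d → ℂ → ℂ)
    (m : Fin d → ℕ) (N : ℕ) : Prop :=
  ∃ (S : Finset ℂ) (ord : ℂ → ℕ),
    (∀ ξ τ, IsSystemPole E Φ f m ξ τ ↔ ξ ∈ S ∧ τ = ord ξ) ∧ ∑ ξ ∈ S, ord ξ = N

/-- `ρ_{ξ,s}(f, m)`: the largest `ρ_s(g)` over the combinations `g` with only a pole at `ξ`, of
exact order `s`. -/
noncomputable def systemPoleIndex (E : Set ℂ) (Φ : ℂ → ℂ) {d : ℕ} (f : Fin d → ℂ → ℂ)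
    (m : Fin d → ℕ) (ξ : ℂ) (s : ℕ) : ℝ≥0∞ :=
  ⨆ (g : ℂ → ℂ) (_ : IsCombination f m g) (_ : HasOnlyPole E Φ ξ s g), poleIndex E Φ s g

/-- `R_{ξ,s}(f, m) = min_{k=1,…,s} ρ_{ξ,k}(f, m)`. -/
noncomputable def systemPoleRadius (E : Set ℂ) (Φ : ℂ → ℂ) {d : ℕ} (f : Fin d → ℂ → ℂ)
    (m : Fin d → ℕ) (ξ : ℂ) (s : ℕ) : ℝ≥0∞ :=
  (Finset.Icc 1 s).inf (systemPoleIndex E Φ f m ξ)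

end HermitePade

open HermitePade

/-!
The growth of the derivatives of the denominators `Q n` at a system pole `ξ` is read off from
integrals along the level curves `{‖Φ‖ = r}`, which are parametrized by the inverse `Ψ` of the
exterior map (`levelIntegral`). With the kernel `K n = c ^ (n + 1) / a_{n + 1}`, of size
`‖Φ‖ ^ (-n)` off `E`, the interpolation conditions say that `∮ Q n * g * K n = 0` for every
combination `g` (`IsApproximant.isOrthogonal`). If a combination is `g = F + p`, where `F` is
analytic in `D_ρ` and `p` is a principal part at `ξ`, this becomes `∮ Q n * F * K n =
-∮ Q n * p * K n` (`IsOrthogonal.pairing_eq`). The left side is `O(η ^ n)` for every `η > 1 / ρ`,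
and by Cauchy's formula in the exterior of the level curve the right side is, up to a triangular
change of variables of size `‖Φ ξ‖ ^ (-n)`, made of the Taylor coefficients of `Q n` at `ξ`
(`pairing_inv_pow`).

The upper bound (`growthLE_taylor_of_splitsOn`): if for each order `s ≤ l + 1` there is a
combination with only a pole at `ξ`, of exact order `s`, in `D_ρ`, then the triangular system shows
that the derivatives of `Q n` at `ξ` up to order `l` decay at the rate `‖Φ ξ‖ / ρ`, provided that
the coefficients of `Q n` are bounded. The same bound, applied to suitably normalized denominators
at all system poles, yields this boundedness: a polynomial of degree less than `|m|` is determined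
by its Taylor data at the `|m|` system poles, so `Q n` converges geometrically, at some rate
`1 / σ < 1`, to the polynomial `Z` whose zeros are the system poles
(`PoleSystem.growthLE_coeff_sub_zeroPoly`).

The lower bound: suppose that the derivatives up to order `l` decay at a rate `θ` less than
`‖Φ ξ‖ / R`, put `κ = ‖Φ ξ‖ / θ`, and let `g = F + p` be a combination as above, with `F` analytic in
`D_ρ`. Then `∮ Z * F * K n` decays at the rate `1 / min κ (σ * ρ)`, because `Q n - Z` contributes the
factor `1 / σ`. These integrals are perturbed Laurent coefficients of `Z * F` in the variable `Φ`, so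
their decay continues `Z * F` analytically to `D_{min κ (σ ρ)}` (`exists_extension_of_growthLE`).
Thus `F` acquires poles only at system poles outside `D_ρ`, and subtracting combinations with the
same principal parts there removes them without touching the pole at `ξ`
(`PoleSystem.exists_splitsOn_of_extension`). Iterating, the domain grows by the factor `σ` until its
index is `κ` (`PoleSystem.exists_splitsOn_of_growthLE`). This contradicts the definition of `R`, as
`κ > R`.
-/

namespace HermitePade

/-! ### The exterior map and its inverse -/

/-- `Ψ` is the inverse of the exterior map `Φ` of `E`; this collects all that the rest of the
argument uses about the pair. -/
structure ExteriorPair (E : Set ℂ) (Φ Ψ : ℂ → ℂ) : Prop where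
  compact : IsCompact E
  connected : IsConnected E
  analytic : ∀ z ∉ E, AnalyticAt ℂ Φ z
  one_lt : ∀ z ∉ E, 1 < ‖Φ z‖
  analytic_inv : ∀ w : ℂ, 1 < ‖w‖ → AnalyticAt ℂ Ψ w
  inv_notMem : ∀ w : ℂ, 1 < ‖w‖ → Ψ w ∉ E
  right_inv : ∀ w : ℂ, 1 < ‖w‖ → Φ (Ψ w) = w
  left_inv : ∀ z ∉ E, Ψ (Φ z) = z
  slope : ∃ b : ℂ, b ≠ 0 ∧ Tendsto (fun z : ℂ => Φ z / z) (Bornology.cobounded ℂ) (𝓝 b)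
  tendsto_inv : Tendsto Ψ (Bornology.cobounded ℂ) (Bornology.cobounded ℂ)

lemma tendsto_cobounded_of_slope {Φ : ℂ → ℂ} {b : ℂ} (hb : b ≠ 0)
    (h : Tendsto (fun z : ℂ => Φ z / z) (Bornology.cobounded ℂ) (𝓝 b)) :
    Tendsto Φ (Bornology.cobounded ℂ) (Bornology.cobounded ℂ) := by
  rw [← tendsto_norm_atTop_iff_cobounded]
  have h1 : Tendsto (fun z : ℂ => ‖Φ z / z‖ * ‖z‖) (Bornology.cobounded ℂ) atTop :=
    Tendsto.pos_mul_atTop (norm_pos_iff.mpr hb) h.norm tendsto_norm_cobounded_atTop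
  refine h1.congr' ?_
  filter_upwards [tendsto_norm_cobounded_atTop.eventually_gt_atTop (0 : ℝ)] with z hz
  rw [norm_div, div_mul_cancel₀ _ hz.ne']

/-- A map with a simple pole at infinity covers a neighbourhood of infinity. -/
lemma exists_preimage_near_infinity {Φ : ℂ → ℂ} {b : ℂ} (hb : b ≠ 0)
    (han : ∀ᶠ z in Bornology.cobounded ℂ, AnalyticAt ℂ Φ z)
    (h : Tendsto (fun z : ℂ => Φ z / z) (Bornology.cobounded ℂ) (𝓝 b))
    {p : ℂ → Prop} (hp : ∀ᶠ z in Bornology.cobounded ℂ, p z) :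
    ∀ᶠ w in Bornology.cobounded ℂ, ∃ z, p z ∧ Φ z = w := by
  -- The function `x ↦ 1 / Φ (1 / x)` has a removable singularity at `0`, so it is open there.
  have hinf := tendsto_cobounded_of_slope hb h
  set φ : ℂ → ℂ := fun x => if x = 0 then 0 else (Φ x⁻¹)⁻¹ with hφ
  have hφne : ∀ x ≠ 0, φ x = (Φ x⁻¹)⁻¹ := fun x hx => by simp [hφ, hx]
  have hlim : Tendsto φ (𝓝[≠] 0) (𝓝[≠] 0) := by
    have : Tendsto (fun x : ℂ => (Φ x⁻¹)⁻¹) (𝓝[≠] 0) (𝓝[≠] 0) :=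
      tendsto_inv₀_cobounded'.comp (hinf.comp tendsto_inv₀_nhdsNE_zero)
    refine this.congr' ?_
    filter_upwards [self_mem_nhdsWithin] with x hx
    exact (hφne x hx).symm
  have hcont : ContinuousAt φ 0 := by
    rw [continuousAt_iff_punctured_nhds]
    have h0 : φ 0 = 0 := by simp [hφ]
    rw [h0]
    exact hlim.mono_right nhdsWithin_le_nhds
  have hne := hinf.eventually_ne_cobounded 0
  have hana : AnalyticAt ℂ φ 0 := by
    refine Complex.analyticAt_of_differentiable_on_punctured_nhds_of_continuousAt ?_ hcont
    have h1 := tendsto_inv₀_nhdsNE_zero.eventually (han.and hne)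
    filter_upwards [h1, self_mem_nhdsWithin] with x hx hx0
    have : DifferentiableAt ℂ (fun y : ℂ => (Φ y⁻¹)⁻¹) x :=
      (hx.1.differentiableAt.comp x (differentiableAt_inv hx0)).inv hx.2
    refine this.congr_of_eventuallyEq ?_
    filter_upwards [isOpen_ne.mem_nhds hx0] with y hy
    exact hφne y hy
  have h00 : φ 0 = 0 := by simp [hφ]
  have hopen : 𝓝 (0 : ℂ) ≤ map φ (𝓝 0) := by
    rcases hana.eventually_constant_or_nhds_le_map_nhds with hc | hc
    · exfalso
      rw [h00] at hc
      have h2 := hlim.eventually self_mem_nhdsWithin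
      have h3 := (h2.and (hc.filter_mono nhdsWithin_le_nhds)).exists
      obtain ⟨x, hx1, hx2⟩ := h3
      exact hx1 hx2
    · rwa [h00] at hc
  have hp0 : ∀ᶠ x in 𝓝 (0 : ℂ), x = 0 ∨ p x⁻¹ := by
    have := tendsto_inv₀_nhdsNE_zero.eventually hp
    rw [eventually_nhdsWithin_iff] at this
    filter_upwards [this] with x hx
    by_cases h : x = 0
    · exact Or.inl h
    · exact Or.inr (hx h)
  have himg : ∀ᶠ y in 𝓝 (0 : ℂ), ∃ x, (x = 0 ∨ p x⁻¹) ∧ φ x = y := by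
    have h5 : φ '' {x | x = 0 ∨ p x⁻¹} ∈ map φ (𝓝 0) := image_mem_map hp0
    filter_upwards [hopen h5] with y hy
    obtain ⟨x, hx, hxy⟩ := hy
    exact ⟨x, hx, hxy⟩
  have h6 := tendsto_inv₀_cobounded.eventually himg
  filter_upwards [h6, Bornology.eventually_ne_cobounded (0 : ℂ)] with w hw hw0
  obtain ⟨x, hx, hxw⟩ := hw
  have hx0 : x ≠ 0 := by
    rintro rfl
    rw [h00] at hxw
    exact inv_ne_zero hw0 hxw.symm
  refine ⟨x⁻¹, hx.resolve_left hx0, ?_⟩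
  rw [hφne x hx0] at hxw
  exact inv_injective hxw

/-- An injective analytic function has no critical values obstructing the analyticity of its
inverse: the inverse is continuous by the open mapping theorem, and the critical points are
isolated, so they give removable singularities. -/
lemma analyticAt_inverse {U : Set ℂ} (hU : IsOpen U) {Φ Ψ : ℂ → ℂ}
    (han : AnalyticOnNhd ℂ Φ U) (hinj : Set.InjOn Φ U)
    (hl : ∀ z ∈ U, Ψ (Φ z) = z) {z₀ : ℂ} (hz₀ : z₀ ∈ U) :
    AnalyticAt ℂ Ψ (Φ z₀) := by
  have hnc : ∀ z ∈ U, ¬ ∀ᶠ y in 𝓝 z, Φ y = Φ z := by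
    intro z hz hc
    have h2 := ((hc.and (hU.mem_nhds hz)).filter_mono (nhdsWithin_le_nhds (s := {z}ᶜ))).and
      self_mem_nhdsWithin
    obtain ⟨y, ⟨hy1, hy2⟩, hy3⟩ := h2.exists
    exact hy3 (hinj hy2 hz hy1)
  have hopen : ∀ z ∈ U, 𝓝 (Φ z) ≤ map Φ (𝓝 z) := fun z hz =>
    (han z hz).eventually_constant_or_nhds_le_map_nhds.resolve_left (hnc z hz)
  have hcont : ∀ z ∈ U, ContinuousAt Ψ (Φ z) := by
    intro z hz
    rw [ContinuousAt, hl z hz]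
    intro V hV
    have h1 : Φ '' (V ∩ U) ∈ map Φ (𝓝 z) := image_mem_map (inter_mem hV (hU.mem_nhds hz))
    refine mem_map.mpr (mem_of_superset (hopen z hz h1) ?_)
    rintro w ⟨y, hy, rfl⟩
    rw [Set.mem_preimage, hl y hy.2]
    exact hy.1
  have hright : ∀ z ∈ U, ∀ᶠ w in 𝓝 (Φ z), Φ (Ψ w) = w ∧ Ψ w ∈ U := by
    intro z hz
    have h1 : Φ '' U ∈ map Φ (𝓝 z) := image_mem_map (hU.mem_nhds hz)
    filter_upwards [hopen z hz h1] with w hw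
    obtain ⟨y, hy, rfl⟩ := hw
    rw [hl y hy]
    exact ⟨rfl, hy⟩
  have hcrit : ∀ᶠ z in 𝓝[≠] z₀, deriv Φ z ≠ 0 := by
    rcases (han z₀ hz₀).deriv.eventually_eq_zero_or_eventually_ne_zero with h0 | h0
    · exfalso
      apply hnc z₀ hz₀
      obtain ⟨r, hr, hrU⟩ := Metric.eventually_nhds_iff_ball.mp (h0.and (hU.mem_nhds hz₀))
      have : ∀ y ∈ Metric.ball z₀ r, Φ y = Φ z₀ := by
        intro y hy
        exact Metric.isOpen_ball.is_const_of_deriv_eq_zero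
          (convex_ball z₀ r).isPreconnected
          (fun x hx => (han x (hrU x hx).2).differentiableAt.differentiableWithinAt)
          (fun x hx => (hrU x hx).1) hy (Metric.mem_ball_self hr)
      filter_upwards [Metric.ball_mem_nhds z₀ hr] with y hy using this y hy
    · exact h0
  refine Complex.analyticAt_of_differentiable_on_punctured_nhds_of_continuousAt ?_ (hcont z₀ hz₀)
  have hT : Tendsto Ψ (𝓝[≠] (Φ z₀)) (𝓝[≠] z₀) := by
    refine tendsto_nhdsWithin_iff.mpr ⟨?_, ?_⟩
    · have := (hcont z₀ hz₀).tendsto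
      rw [hl z₀ hz₀] at this
      exact this.mono_left nhdsWithin_le_nhds
    · filter_upwards [(hright z₀ hz₀).filter_mono nhdsWithin_le_nhds, self_mem_nhdsWithin]
        with w hw hw0
      intro h
      apply hw0
      rw [← hw.1, Set.mem_singleton_iff.mp h]
      rfl
  filter_upwards [hT.eventually hcrit, (hright z₀ hz₀).filter_mono nhdsWithin_le_nhds]
    with w hw hw2
  have h3 := hright (Ψ w) hw2.2
  have h4 := hcont (Ψ w) hw2.2
  rw [hw2.1] at h3 h4
  exact (HasDerivAt.of_local_left_inverse h4
    (han _ hw2.2).differentiableAt.hasDerivAt hw (h3.mono fun y hy => hy.1)).differentiableAt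

theorem IsExteriorMap.exists_pair {E : Set ℂ} {Φ : ℂ → ℂ} (hE : IsCompact E)
    (hE' : IsConnected E) (hΦ : IsExteriorMap E Φ) :
    ∃ Ψ, ExteriorPair E Φ Ψ := by
  obtain ⟨b, hb, hslope⟩ := hΦ.at_infinity
  have hb' : (b : ℂ) ≠ 0 := by exact_mod_cast hb.ne'
  have hl : ∀ z ∉ E, Function.invFunOn Φ Eᶜ (Φ z) = z := fun z hz =>
    hΦ.injective.leftInvOn_invFunOn hz
  have hsurj : ∀ w : ℂ, 1 < ‖w‖ → ∃ z ∈ Eᶜ, Φ z = w := by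
    intro w hw
    have : w ∈ Φ '' Eᶜ := by rw [hΦ.image]; exact hw
    exact this
  have hnear : ∀ᶠ z in Bornology.cobounded ℂ, z ∉ E := by
    exact hE.isBounded
  refine ⟨Function.invFunOn Φ Eᶜ, hE, hE', hΦ.analytic, ?_, ?_, ?_, ?_, hl, ⟨b, hb', hslope⟩, ?_⟩
  · intro z hz
    have : Φ z ∈ Φ '' Eᶜ := ⟨z, hz, rfl⟩
    rw [hΦ.image] at this
    exact this
  · intro w hw
    obtain ⟨z, hz, rfl⟩ := hsurj w hw
    exact analyticAt_inverse hE.isClosed.isOpen_compl hΦ.analytic hΦ.injective hl hz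
  · intro w hw
    exact Function.invFunOn_mem (hsurj w hw)
  · intro w hw
    exact Function.invFunOn_eq (hsurj w hw)
  · intro s hs
    have h1 := exists_preimage_near_infinity hb' (hnear.mono fun z hz => hΦ.analytic z hz)
      hslope (hnear.and hs)
    refine mem_map.mpr (mem_of_superset h1 ?_)
    rintro w ⟨z, ⟨hz1, hz2⟩, rfl⟩
    rw [Set.mem_preimage, hl z hz1]
    exact hz2

namespace ExteriorPair

variable {E : Set ℂ} {Φ Ψ : ℂ → ℂ}

lemma tendsto_map (h : ExteriorPair E Φ Ψ) :
    Tendsto Φ (Bornology.cobounded ℂ) (Bornology.cobounded ℂ) := by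
  obtain ⟨b, hb, hs⟩ := h.slope
  exact tendsto_cobounded_of_slope hb hs

lemma isOpen_compl (h : ExteriorPair E Φ Ψ) : IsOpen Eᶜ := h.compact.isClosed.isOpen_compl

lemma deriv_mul_deriv (h : ExteriorPair E Φ Ψ) {w : ℂ} (hw : 1 < ‖w‖) :
    deriv Φ (Ψ w) * deriv Ψ w = 1 := by
  have h1 : HasDerivAt (Φ ∘ Ψ) (deriv Φ (Ψ w) * deriv Ψ w) w :=
    (h.analytic _ (h.inv_notMem w hw)).differentiableAt.hasDerivAt.comp w
      (h.analytic_inv w hw).differentiableAt.hasDerivAt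
  have h2 : HasDerivAt (Φ ∘ Ψ) 1 w := by
    refine (hasDerivAt_id w).congr_of_eventuallyEq ?_
    filter_upwards [(isOpen_lt continuous_const continuous_norm).mem_nhds hw] with y hy
    exact h.right_inv y hy
  exact h1.unique h2

lemma deriv_inv_ne_zero (h : ExteriorPair E Φ Ψ) {w : ℂ} (hw : 1 < ‖w‖) : deriv Ψ w ≠ 0 :=
  right_ne_zero_of_mul_eq_one (h.deriv_mul_deriv hw)

lemma inv_injOn (h : ExteriorPair E Φ Ψ) {w v : ℂ} (hw : 1 < ‖w‖) (hv : 1 < ‖v‖)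
    (hwv : Ψ w = Ψ v) : w = v := by
  rw [← h.right_inv w hw, ← h.right_inv v hv, hwv]

/-- `Ψ` has linear growth. -/
lemma exists_norm_inv_le (h : ExteriorPair E Φ Ψ) :
    ∃ C R : ℝ, 0 < C ∧ 1 < R ∧ ∀ w : ℂ, R ≤ ‖w‖ → ‖Ψ w‖ ≤ C * ‖w‖ ∧ ‖w‖ ≤ C * ‖Ψ w‖ := by
  obtain ⟨b, hb, hs⟩ := h.slope
  have hb0 := norm_pos_iff.mpr hb
  have h1 := (hs.comp h.tendsto_inv).norm
  have h2 : ∀ᶠ w in Bornology.cobounded ℂ, ‖b‖ / 2 < ‖Φ (Ψ w) / Ψ w‖ ∧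
      ‖Φ (Ψ w) / Ψ w‖ < 2 * ‖b‖ :=
    (h1.eventually_const_lt (by linarith)).and (h1.eventually_lt_const (by linarith))
  have h3 := (h2.and (h.tendsto_inv.eventually (Bornology.eventually_ne_cobounded 0)))
  rw [(hasBasis_cobounded_norm (E := ℂ)).eventually_iff] at h3
  obtain ⟨R, -, hR⟩ := h3
  refine ⟨2 / ‖b‖ + 2 * ‖b‖, max R 2, by positivity, by norm_num, fun w hw => ?_⟩
  have hw1 : 1 < ‖w‖ := by linarith [le_max_right R 2]
  obtain ⟨⟨h4, h5⟩, h6⟩ := hR (show R ≤ ‖w‖ from le_trans (le_max_left _ _) hw)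
  rw [h.right_inv w hw1, norm_div] at h4 h5
  have h7 := norm_pos_iff.mpr h6
  rw [lt_div_iff₀ h7] at h4
  rw [div_lt_iff₀ h7] at h5
  constructor
  · have : ‖Ψ w‖ ≤ 2 / ‖b‖ * ‖w‖ := by
      rw [div_mul_eq_mul_div, le_div_iff₀ hb0]; linarith
    have : 0 ≤ 2 * ‖b‖ * ‖w‖ := by positivity
    nlinarith
  · have : 0 ≤ 2 / ‖b‖ * ‖Ψ w‖ := by positivity
    nlinarith

/-- `Ψ'` is bounded near infinity. -/
lemma exists_norm_deriv_inv_le (h : ExteriorPair E Φ Ψ) :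
    ∃ C R : ℝ, 0 < C ∧ 1 < R ∧ ∀ w : ℂ, R ≤ ‖w‖ → ‖deriv Ψ w‖ ≤ C := by
  obtain ⟨C, R, hC, hR, hCR⟩ := h.exists_norm_inv_le
  refine ⟨3 * C, 2 * R, by positivity, by linarith, fun w hw => ?_⟩
  have hw0 : 0 < ‖w‖ / 2 := by linarith
  have hnorm : ∀ v ∈ Metric.closedBall w (‖w‖ / 2), R ≤ ‖v‖ ∧ ‖v‖ ≤ 3 / 2 * ‖w‖ := by
    intro v hv
    rw [Metric.mem_closedBall, dist_eq_norm] at hv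
    constructor
    · have := norm_sub_norm_le w v
      rw [norm_sub_rev] at this
      linarith
    · have := norm_sub_norm_le v w
      linarith
  have := Complex.norm_deriv_le_of_forall_mem_sphere_norm_le (f := Ψ) (c := w)
    (C := C * (3 / 2 * ‖w‖)) hw0 (DifferentiableOn.diffContOnCl (fun v hv => by
      rw [closure_ball _ hw0.ne'] at hv
      exact (h.analytic_inv v (by linarith [(hnorm v hv).1])).differentiableAt.differentiableWithinAt))
    (fun v hv => by
      obtain ⟨h1, h2⟩ := hnorm v (Metric.sphere_subset_closedBall hv)
      exact (hCR v h1).1.trans (by gcongr))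
  refine this.trans (le_of_eq ?_)
  have : ‖w‖ ≠ 0 := by linarith
  field_simp

end ExteriorPair

/-! ### Canonical domains -/

lemma mem_canonicalDomain {E : Set ℂ} {Φ : ℂ → ℂ} {ρ : ℝ} {z : ℂ} :
    z ∈ canonicalDomain E Φ ρ ↔ (z ∉ E → ‖Φ z‖ < ρ) := by
  simp only [canonicalDomain, Set.mem_union, Set.mem_ofPred_eq]
  tauto

lemma canonicalDomain_mono {E : Set ℂ} {Φ : ℂ → ℂ} {ρ ρ' : ℝ} (h : ρ ≤ ρ') :
    canonicalDomain E Φ ρ ⊆ canonicalDomain E Φ ρ' := fun _ hz =>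
  mem_canonicalDomain.mpr fun h' => (mem_canonicalDomain.mp hz h').trans_le h

lemma subset_canonicalDomain {E : Set ℂ} {Φ : ℂ → ℂ} {ρ : ℝ} : E ⊆ canonicalDomain E Φ ρ :=
  Set.subset_union_left

namespace ExteriorPair

variable {E : Set ℂ} {Φ Ψ : ℂ → ℂ}

lemma isClosed_exterior (h : ExteriorPair E Φ Ψ) {ρ : ℝ} (hρ : 1 < ρ) :
    IsClosed {z | z ∉ E ∧ ρ ≤ ‖Φ z‖} := by
  refine isClosed_of_closure_subset fun z hz => ?_
  obtain ⟨x, hx, hxz⟩ := mem_closure_iff_seq_limit.mp hz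
  have hbdd : ∃ M : ℝ, ∀ n, ‖Φ (x n)‖ ≤ M := by
    obtain ⟨B, hB⟩ := (Metric.isBounded_range_of_tendsto x hxz).exists_norm_le
    have h1 := (tendsto_norm_cobounded_atTop.comp h.tendsto_inv).eventually_gt_atTop B
    rw [(hasBasis_cobounded_norm (E := ℂ)).eventually_iff] at h1
    obtain ⟨R, -, hR⟩ := h1
    refine ⟨R, fun n => ?_⟩
    by_contra! hn
    have h2 := hR (show R ≤ ‖Φ (x n)‖ from hn.le)
    rw [Function.comp_apply, h.left_inv _ (hx n).1] at h2
    exact absurd (hB (x n) ⟨n, rfl⟩) (not_le.mpr h2)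
  obtain ⟨M, hM⟩ := hbdd
  have hK : IsCompact {w : ℂ | ρ ≤ ‖w‖ ∧ ‖w‖ ≤ M} := by
    refine Metric.isCompact_of_isClosed_isBounded ?_ ?_
    · exact (isClosed_le continuous_const continuous_norm).inter
        (isClosed_le continuous_norm continuous_const)
    · exact Metric.isBounded_closedBall.subset
        (t := Metric.closedBall 0 M) fun w hw => by simpa using hw.2
  obtain ⟨w, hw, φ, hφ, hlim⟩ := hK.tendsto_subseq (x := fun n => Φ (x n))
    fun n => ⟨(hx n).2, hM n⟩
  have hw1 : 1 < ‖w‖ := hρ.trans_le hw.1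
  have h1 : Tendsto (fun n => Ψ (Φ (x (φ n)))) atTop (𝓝 (Ψ w)) :=
    (h.analytic_inv w hw1).continuousAt.tendsto.comp hlim
  have h2 : Tendsto (fun n => Ψ (Φ (x (φ n)))) atTop (𝓝 z) := by
    simp_rw [fun n => h.left_inv _ (hx (φ n)).1]
    exact hxz.comp hφ.tendsto_atTop
  have h3 := tendsto_nhds_unique h2 h1
  subst h3
  exact ⟨h.inv_notMem w hw1, by rw [h.right_inv w hw1]; exact hw.1⟩

lemma isOpen_canonicalDomain (h : ExteriorPair E Φ Ψ) {ρ : ℝ} (hρ : 1 < ρ) :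
    IsOpen (canonicalDomain E Φ ρ) := by
  have : canonicalDomain E Φ ρ = {z | z ∉ E ∧ ρ ≤ ‖Φ z‖}ᶜ := by
    ext z
    rw [mem_canonicalDomain]
    simp
  rw [this]
  exact (h.isClosed_exterior hρ).isOpen_compl

lemma isOpen_exterior (h : ExteriorPair E Φ Ψ) (ρ : ℝ) : IsOpen {z | z ∉ E ∧ ρ < ‖Φ z‖} := by
  have hc : ContinuousOn (fun z => ‖Φ z‖) Eᶜ := fun z hz =>
    (h.analytic z hz).continuousAt.norm.continuousWithinAt
  exact hc.isOpen_inter_preimage h.isOpen_compl (isOpen_Ioi (a := ρ))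

lemma closure_canonicalDomain (h : ExteriorPair E Φ Ψ) (ρ : ℝ) :
    closure (canonicalDomain E Φ ρ) = {z | z ∉ E → ‖Φ z‖ ≤ ρ} := by
  apply Set.Subset.antisymm
  · have hcl : IsClosed {z | z ∉ E → ‖Φ z‖ ≤ ρ} := by
      have : {z | z ∉ E → ‖Φ z‖ ≤ ρ} = {z | z ∉ E ∧ ρ < ‖Φ z‖}ᶜ := by
        ext z; simp
      rw [this]
      exact (h.isOpen_exterior ρ).isClosed_compl
    exact closure_minimal (fun z hz => fun h' => (mem_canonicalDomain.mp hz h').le) hcl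
  · intro z hz
    by_cases hzE : z ∈ E
    · exact subset_closure (subset_canonicalDomain hzE)
    have hz1 := h.one_lt z hzE
    have hlim : Tendsto (fun t : ℝ => Ψ ((t : ℂ) * Φ z)) (𝓝[<] 1) (𝓝 z) := by
      have h1 : ContinuousAt Ψ (Φ z) := (h.analytic_inv _ hz1).continuousAt
      have h2 : Tendsto (fun t : ℝ => (t : ℂ) * Φ z) (𝓝[<] 1) (𝓝 (Φ z)) := by
        have : Continuous (fun t : ℝ => (t : ℂ) * Φ z) := by fun_prop
        have := this.tendsto 1
        simp only [Complex.ofReal_one, one_mul] at this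
        exact this.mono_left nhdsWithin_le_nhds
      have := h1.tendsto.comp h2
      rwa [h.left_inv z hzE] at this
    refine mem_closure_of_tendsto hlim ?_
    have h3 : ∀ᶠ t : ℝ in 𝓝[<] 1, ‖Φ z‖⁻¹ < t :=
      (eventually_gt_nhds (inv_lt_one_of_one_lt₀ hz1)).filter_mono nhdsWithin_le_nhds
    filter_upwards [h3, self_mem_nhdsWithin] with t ht ht1
    have ht0 : 0 < t := lt_trans (by positivity) ht
    have hn : ‖(t : ℂ) * Φ z‖ = t * ‖Φ z‖ := by
      rw [norm_mul, Complex.norm_real, Real.norm_of_nonneg ht0.le]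
    have h4 : 1 < ‖(t : ℂ) * Φ z‖ := by
      rw [hn]
      rwa [inv_lt_iff_one_lt_mul₀ (by linarith)] at ht
    rw [mem_canonicalDomain]
    intro _
    rw [h.right_inv _ h4, hn]
    have := hz hzE
    have ht1' : t < 1 := ht1
    nlinarith

/-- The canonical domains form a neighbourhood basis of each compact sublevel set of `‖Φ‖`, and of
`E` (the case `ρ = 1`). -/
lemma exists_canonicalDomain_subset (h : ExteriorPair E Φ Ψ) {U : Set ℂ} (hU : IsOpen U) {ρ : ℝ}
    (hUρ : ∀ z, (z ∉ E → ‖Φ z‖ ≤ ρ) → z ∈ U) :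
    ∃ ρ' > ρ, canonicalDomain E Φ ρ' ⊆ U := by
  have hinf := (tendsto_norm_cobounded_atTop.comp h.tendsto_map).eventually_ge_atTop (ρ + 1)
  rw [(hasBasis_cobounded_norm (E := ℂ)).eventually_iff] at hinf
  obtain ⟨R, -, hR⟩ := hinf
  have hK : IsCompact (Uᶜ ∩ Metric.closedBall 0 R) :=
    (isCompact_closedBall (0 : ℂ) R).inter_left hU.isClosed_compl
  have hKE : ∀ z ∈ Uᶜ, z ∉ E ∧ ρ < ‖Φ z‖ := by
    intro z hz
    by_contra hcon
    apply hz
    apply hUρ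
    intro hzE
    by_contra! hlt
    exact hcon ⟨hzE, hlt⟩
  have hcont : ContinuousOn (fun z => ‖Φ z‖) (Uᶜ ∩ Metric.closedBall 0 R) := fun z hz =>
    (h.analytic z (hKE z hz.1).1).continuousAt.norm.continuousWithinAt
  have hmin : ∃ ρ' > ρ, ∀ z ∈ Uᶜ ∩ Metric.closedBall 0 R, ρ' ≤ ‖Φ z‖ := by
    rcases (Uᶜ ∩ Metric.closedBall 0 R).eq_empty_or_nonempty with h0 | h0
    · exact ⟨ρ + 1, by linarith, by simp [h0]⟩
    · obtain ⟨z, hz, hzmin⟩ := hK.exists_isMinOn h0 hcont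
      exact ⟨‖Φ z‖, (hKE z hz.1).2, fun y hy => hzmin hy⟩
  obtain ⟨ρ', hρ', hmin⟩ := hmin
  refine ⟨min ρ' (ρ + 1), lt_min hρ' (by linarith), fun z hz => ?_⟩
  by_contra hzU
  have h1 := mem_canonicalDomain.mp hz (hKE z hzU).1
  rw [lt_min_iff] at h1
  by_cases hzR : ‖z‖ ≤ R
  · exact absurd (hmin z ⟨hzU, by simpa using hzR⟩) (not_le.mpr h1.1)
  · exact absurd (hR (show R ≤ ‖z‖ by linarith)) (not_le.mpr h1.2)

/-- A property that holds near `E` holds on some canonical domain. -/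
lemma exists_canonicalDomain_of_eventually (h : ExteriorPair E Φ Ψ) {p : ℂ → Prop}
    (hp : ∀ᶠ z in 𝓝ˢ E, p z) : ∃ ρ > 1, ∀ z ∈ canonicalDomain E Φ ρ, p z := by
  obtain ⟨U, hU, hEU, hUp⟩ := eventually_nhdsSet_iff_exists.mp hp
  obtain ⟨ρ, hρ, hsub⟩ := h.exists_canonicalDomain_subset hU (ρ := 1) fun z hz => by
    apply hEU
    by_contra hzE
    exact absurd (hz hzE) (not_le.mpr (h.one_lt z hzE))
  exact ⟨ρ, hρ, fun z hz => hUp z (hsub hz)⟩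

lemma eventually_of_canonicalDomain (h : ExteriorPair E Φ Ψ) {p : ℂ → Prop} {ρ : ℝ} (hρ : 1 < ρ)
    (hp : ∀ z ∈ canonicalDomain E Φ ρ, p z) : ∀ᶠ z in 𝓝ˢ E, p z :=
  eventually_nhdsSet_iff_exists.mpr
    ⟨_, h.isOpen_canonicalDomain hρ, subset_canonicalDomain, hp⟩

lemma isPreconnected_annulus {ρ : ℝ} :
    IsPreconnected {w : ℂ | 1 < ‖w‖ ∧ ‖w‖ < ρ} := by
  have : {w : ℂ | 1 < ‖w‖ ∧ ‖w‖ < ρ} =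
      (fun p : ℝ × ℝ => (p.1 : ℂ) * Complex.exp (p.2 * Complex.I)) ''
        (Set.Ioo 1 ρ ×ˢ Set.univ) := by
    ext w
    constructor
    · intro hw
      exact ⟨(‖w‖, w.arg), ⟨hw, trivial⟩, by simp⟩
    · rintro ⟨⟨r, t⟩, ⟨hr, -⟩, rfl⟩
      have h0 : 0 < r := by linarith [hr.1]
      simpa [Complex.norm_exp_ofReal_mul_I, abs_of_pos h0] using hr
  rw [this]
  refine (isPreconnected_Ioo.prod isPreconnected_univ).image _ ?_
  fun_prop

lemma isPreconnected_canonicalDomain (h : ExteriorPair E Φ Ψ) {ρ : ℝ} (hρ : 1 < ρ) :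
    IsPreconnected (canonicalDomain E Φ ρ) := by
  have hopen := h.isOpen_canonicalDomain hρ
  set A : Set ℂ := {z | z ∉ E ∧ ‖Φ z‖ < ρ} with hA
  have hAimg : A = Ψ '' {w : ℂ | 1 < ‖w‖ ∧ ‖w‖ < ρ} := by
    ext z
    constructor
    · rintro ⟨hz, hzρ⟩
      exact ⟨Φ z, ⟨h.one_lt z hz, hzρ⟩, h.left_inv z hz⟩
    · rintro ⟨w, ⟨hw, hwρ⟩, rfl⟩
      exact ⟨h.inv_notMem w hw, by rwa [h.right_inv w hw]⟩
  have hApre : IsPreconnected A := by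
    rw [hAimg]
    exact isPreconnected_annulus.image _ fun w hw =>
      (h.analytic_inv w hw.1).continuousAt.continuousWithinAt
  -- `E` meets the closure of the annular part, as otherwise `E` would be open and closed.
  have hmeet : (E ∩ closure A).Nonempty := by
    by_contra hcon
    rw [Set.not_nonempty_iff_eq_empty] at hcon
    have hEopen : IsOpen E := by
      have : E = canonicalDomain E Φ ρ ∩ (closure A)ᶜ := by
        ext z
        constructor
        · intro hz
          refine ⟨subset_canonicalDomain hz, fun hz' => ?_⟩
          have : z ∈ E ∩ closure A := ⟨hz, hz'⟩
          rw [hcon] at this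
          exact this
        · rintro ⟨hz1, hz2⟩
          by_contra hzE
          exact hz2 (subset_closure ⟨hzE, mem_canonicalDomain.mp hz1 hzE⟩)
      rw [this]
      exact hopen.inter isClosed_closure.isOpen_compl
    have hclopen : IsClopen E := ⟨h.compact.isClosed, hEopen⟩
    rcases isClopen_iff.mp hclopen with h0 | h0
    · exact h.connected.nonempty.ne_empty h0
    · exact h.inv_notMem 2 (by norm_num) (h0 ▸ trivial)
  obtain ⟨e, heE, heA⟩ := hmeet
  have hins : IsPreconnected (insert e A) := by
    refine hApre.subset_closure (Set.subset_insert e A) ?_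
    exact Set.insert_subset heA subset_closure
  have hD : canonicalDomain E Φ ρ = E ∪ insert e A := by
    ext z
    simp only [canonicalDomain, Set.mem_union, Set.mem_insert_iff, hA]
    constructor
    · rintro (h | h)
      · exact Or.inl h
      · exact Or.inr (Or.inr h)
    · rintro (h | h | h)
      · exact Or.inl h
      · exact Or.inl (h ▸ heE)
      · exact Or.inr h
  rw [hD]
  exact IsPreconnected.union e heE (Set.mem_insert e A) h.connected.isPreconnected hins

lemma eqOn_of_eventuallyEq (h : ExteriorPair E Φ Ψ) {ρ : ℝ} (hρ : 1 < ρ) {F G : ℂ → ℂ}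
    (hF : AnalyticOnNhd ℂ F (canonicalDomain E Φ ρ))
    (hG : AnalyticOnNhd ℂ G (canonicalDomain E Φ ρ)) (hFG : F =ᶠ[𝓝ˢ E] G) :
    Set.EqOn F G (canonicalDomain E Φ ρ) := by
  obtain ⟨e, he⟩ := h.connected.nonempty
  exact hF.eqOn_of_preconnected_of_eventuallyEq hG (h.isPreconnected_canonicalDomain hρ)
    (subset_canonicalDomain he) (hFG.filter_mono (nhds_le_nhdsSet he))

end ExteriorPair

/-! ### Circle integrals -/

lemma AnalyticAt.dslope_of {f : ℂ → ℂ} {a z : ℂ} (ha : AnalyticAt ℂ f a) (hz : AnalyticAt ℂ f z) :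
    AnalyticAt ℂ (dslope f a) z := by
  by_cases hza : z = a
  · subst hza
    obtain ⟨p, hp⟩ := ha
    exact hp.has_fpower_series_dslope_fslope.analyticAt
  · have h1 : AnalyticAt ℂ (fun y => (y - a)⁻¹ * (f y - f a)) z :=
      ((analyticAt_id.sub analyticAt_const).inv (sub_ne_zero.mpr hza)).mul
        (hz.sub analyticAt_const)
    refine h1.congr ?_
    filter_upwards [isOpen_ne.mem_nhds hza] with y hy
    rw [dslope_of_ne _ hy, slope_def_field, div_eq_inv_mul]

lemma circleIntegral_eq_of_analytic_annulus {f : ℂ → ℂ} {r₁ r₂ : ℝ} (h0 : 0 < r₁) (h12 : r₁ ≤ r₂)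
    (hf : ∀ w : ℂ, r₁ ≤ ‖w‖ → ‖w‖ ≤ r₂ → AnalyticAt ℂ f w) :
    (∮ w in C(0, r₂), f w) = ∮ w in C(0, r₁), f w := by
  refine Complex.circleIntegral_eq_of_differentiable_on_annulus_off_countable h0 h12
    Set.countable_empty ?_ ?_
  · intro w hw
    simp only [Set.mem_sdiff, Metric.mem_closedBall, dist_zero_right, Metric.mem_ball,
      not_lt] at hw
    exact (hf w hw.2 hw.1).continuousAt.continuousWithinAt
  · intro w hw
    simp only [Set.mem_sdiff, Metric.mem_closedBall, dist_zero_right, Metric.mem_ball,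
      not_le, Set.mem_empty_iff_false, not_false_eq_true, and_true] at hw
    exact (hf w hw.2.le hw.1.le).differentiableAt

/-- Cauchy's integral formula for an annulus. -/
lemma cauchy_annulus {f : ℂ → ℂ} {r₁ r₂ : ℝ} (h0 : 0 < r₁)
    (hf : ∀ w : ℂ, r₁ ≤ ‖w‖ → ‖w‖ ≤ r₂ → AnalyticAt ℂ f w) {v : ℂ} (hv1 : r₁ < ‖v‖)
    (hv2 : ‖v‖ < r₂) :
    (∮ w in C(0, r₂), f w / (w - v)) - (∮ w in C(0, r₁), f w / (w - v)) =
      2 * Real.pi * Complex.I * f v := by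
  have hfv := hf v hv1.le hv2.le
  have hds := circleIntegral_eq_of_analytic_annulus (f := dslope f v) h0 (hv1.trans hv2).le
    fun w h1 h2 => AnalyticAt.dslope_of hfv (hf w h1 h2)
  have hsplit : ∀ r : ℝ, r₁ ≤ r → r ≤ r₂ → r ≠ ‖v‖ →
      (∮ w in C(0, r), f w / (w - v)) =
        (∮ w in C(0, r), dslope f v w) + f v * ∮ w in C(0, r), (w - v)⁻¹ := by
    intro r h1 h2 hrv
    have hr0 : 0 ≤ r := h0.le.trans h1
    have hne : ∀ w ∈ Metric.sphere (0 : ℂ) r, w ≠ v := by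
      rintro w hw rfl
      exact hrv (by simpa using hw.symm)
    rw [← circleIntegral.integral_const_mul, ← circleIntegral.integral_add]
    · refine circleIntegral.integral_congr hr0 fun w hw => ?_
      rw [dslope_of_ne _ (hne w hw), slope_def_field]
      have := sub_ne_zero.mpr (hne w hw)
      field_simp
      ring
    · refine ContinuousOn.circleIntegrable hr0 fun w hw => ?_
      have hw' : ‖w‖ = r := by simpa using hw
      exact (AnalyticAt.dslope_of hfv
        (hf w (hw' ▸ h1) (hw' ▸ h2))).continuousAt.continuousWithinAt
    · refine ContinuousOn.circleIntegrable hr0 ?_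
      refine continuousOn_const.mul (ContinuousOn.inv₀ (by fun_prop) fun w hw =>
        sub_ne_zero.mpr (hne w hw))
  rw [hsplit r₂ (hv1.trans hv2).le le_rfl hv2.ne', hsplit r₁ le_rfl (hv1.trans hv2).le hv1.ne,
    hds, circleIntegral.integral_sub_inv_of_mem_ball (by simpa using hv2)]
  have hz : (∮ w in C(0, r₁), (w - v)⁻¹) = 0 := by
    refine Complex.circleIntegral_eq_zero_of_differentiable_on_off_countable h0.le
      Set.countable_empty ?_ ?_
    · refine ContinuousOn.inv₀ (by fun_prop) fun w hw => sub_ne_zero.mpr ?_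
      rintro rfl
      simp only [Metric.mem_closedBall, dist_zero_right] at hw
      linarith
    · intro w hw
      have : w - v ≠ 0 := by
        refine sub_ne_zero.mpr ?_
        rintro rfl
        simp only [Metric.mem_ball, dist_zero_right, Set.mem_sdiff] at hw
        linarith [hw.1]
      exact (differentiableAt_id.sub_const v).inv this
  rw [hz]
  ring

/-- A Cauchy-type integral along a closed curve is differentiable off the curve. -/
lemma differentiableAt_cauchyTransform {φ ψ : ℂ → ℂ} {r : ℝ} (hr : 0 ≤ r)
    (hφ : ContinuousOn φ (Metric.sphere 0 r)) (hψ : ContinuousOn ψ (Metric.sphere 0 r)) {z₀ : ℂ}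
    (hz₀ : ∀ w ∈ Metric.sphere (0 : ℂ) r, ψ w ≠ z₀) :
    DifferentiableAt ℂ (fun z => ∮ w in C(0, r), φ w / (ψ w - z)) z₀ := by
  have hK := (isCompact_sphere (0 : ℂ) r)
  have hcl : IsClosed (ψ '' Metric.sphere 0 r) := (hK.image_of_continuousOn hψ).isClosed
  have hmem : z₀ ∈ (ψ '' Metric.sphere 0 r)ᶜ := by
    rintro ⟨w, hw, hwz⟩
    exact hz₀ w hw hwz
  obtain ⟨δ, hδ, hball⟩ := Metric.isOpen_iff.mp hcl.isOpen_compl z₀ hmem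
  obtain ⟨A, hA⟩ := hK.exists_bound_of_continuousOn hφ
  have hA0 : ∀ t, ‖φ (circleMap 0 r t)‖ ≤ A := fun t => hA _ (circleMap_mem_sphere 0 hr t)
  have hdist : ∀ z ∈ Metric.ball z₀ (δ / 2), ∀ t, δ / 2 ≤ ‖ψ (circleMap 0 r t) - z‖ := by
    intro z hz t
    by_contra! hlt
    have h1 : ψ (circleMap 0 r t) ∈ Metric.ball z₀ δ := by
      rw [Metric.mem_ball, dist_eq_norm] at hz ⊢
      calc _ = ‖(ψ (circleMap 0 r t) - z) + (z - z₀)‖ := by ring_nf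
        _ ≤ _ := norm_add_le _ _
        _ < δ := by linarith
    exact hball h1 ⟨_, circleMap_mem_sphere 0 hr t, rfl⟩
  have hne : ∀ z ∈ Metric.ball z₀ (δ / 2), ∀ t, ψ (circleMap 0 r t) - z ≠ 0 := by
    intro z hz t h0
    have := hdist z hz t
    rw [h0, norm_zero] at this
    linarith
  have hφc : Continuous fun t => φ (circleMap 0 r t) :=
    hφ.comp_continuous (continuous_circleMap 0 r) fun t => circleMap_mem_sphere 0 hr t
  have hψc : Continuous fun t => ψ (circleMap 0 r t) :=
    hψ.comp_continuous (continuous_circleMap 0 r) fun t => circleMap_mem_sphere 0 hr t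
  have hdc : Continuous fun t => deriv (circleMap 0 r) t := by
    simp only [deriv_circleMap]
    fun_prop
  have key := intervalIntegral.hasDerivAt_integral_of_dominated_loc_of_deriv_le
    (μ := MeasureTheory.volume) (a := 0) (b := 2 * Real.pi) (x₀ := z₀)
    (F := fun z t => deriv (circleMap 0 r) t • (φ (circleMap 0 r t) / (ψ (circleMap 0 r t) - z)))
    (F' := fun z t => deriv (circleMap 0 r) t •
      (φ (circleMap 0 r t) / (ψ (circleMap 0 r t) - z) ^ 2))
    (bound := fun _ => r * (A / (δ / 2) ^ 2))
    (Metric.ball_mem_nhds z₀ (half_pos hδ)) ?_ ?_ ?_ ?_ ?_ ?_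
  · exact key.2.differentiableAt
  · filter_upwards [Metric.ball_mem_nhds z₀ (half_pos hδ)] with z hz
    exact (hdc.smul (hφc.div (hψc.sub continuous_const) (hne z hz))).aestronglyMeasurable
  · exact (hdc.smul (hφc.div (hψc.sub continuous_const)
      (hne z₀ (Metric.mem_ball_self (half_pos hδ))))).intervalIntegrable _ _
  · exact (hdc.smul (hφc.div ((hψc.sub continuous_const).pow 2)
      fun t => pow_ne_zero 2 (hne z₀ (Metric.mem_ball_self (half_pos hδ)) t))).aestronglyMeasurable
  · refine Eventually.of_forall fun t _ z hz => ?_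
    rw [norm_smul, norm_div, norm_pow, deriv_circleMap, norm_mul, norm_circleMap_zero,
      Complex.norm_I, mul_one, abs_of_nonneg hr]
    have h1 := hdist z hz t
    have h2 := hA0 t
    have h3 : 0 ≤ A := (norm_nonneg _).trans h2
    gcongr
  · exact intervalIntegrable_const
  · refine Eventually.of_forall fun t _ z hz => ?_
    have h1 : HasDerivAt (fun z => ψ (circleMap 0 r t) - z) (-1) z :=
      (hasDerivAt_id z).const_sub _
    have h2 := ((h1.inv (hne z hz t)).const_mul (φ (circleMap 0 r t))).const_mul
      (deriv (circleMap 0 r) t)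
    refine (h2.congr_deriv ?_).congr_of_eventuallyEq (Eventually.of_forall fun y => ?_)
    · simp [div_eq_mul_inv]
    · simp [div_eq_mul_inv]

/-! ### Integrals along level curves -/

/-- The integral `∮ F dz` along the level curve `{|Φ| = r}`, parametrised by `Ψ = Φ⁻¹`. -/
noncomputable def levelIntegral (Ψ : ℂ → ℂ) (r : ℝ) (F : ℂ → ℂ) : ℂ :=
  ∮ w in C(0, r), F (Ψ w) * deriv Ψ w

namespace ExteriorPair

variable {E : Set ℂ} {Φ Ψ : ℂ → ℂ}

lemma continuousOn_inv_sphere (h : ExteriorPair E Φ Ψ) {r : ℝ} (hr : 1 < r) :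
    ContinuousOn Ψ (Metric.sphere 0 r) := fun w hw =>
  (h.analytic_inv w (by rw [mem_sphere_zero_iff_norm.mp hw]; exact hr)).continuousAt.continuousWithinAt

lemma continuousOn_deriv_inv_sphere (h : ExteriorPair E Φ Ψ) {r : ℝ} (hr : 1 < r) :
    ContinuousOn (deriv Ψ) (Metric.sphere 0 r) := fun w hw =>
  (h.analytic_inv w
    (by rw [mem_sphere_zero_iff_norm.mp hw]; exact hr)).deriv.continuousAt.continuousWithinAt

lemma continuousOn_comp_inv_sphere (h : ExteriorPair E Φ Ψ) {r : ℝ} (hr : 1 < r) {F : ℂ → ℂ}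
    (hF : ∀ z ∉ E, ‖Φ z‖ = r → ContinuousAt F z) :
    ContinuousOn (fun w => F (Ψ w)) (Metric.sphere 0 r) := fun w hw => by
  have hw' : ‖w‖ = r := mem_sphere_zero_iff_norm.mp hw
  have hw1 : 1 < ‖w‖ := hw' ▸ hr
  exact ((hF (Ψ w) (h.inv_notMem w hw1) (by rw [h.right_inv w hw1, hw'])).comp
    (h.analytic_inv w hw1).continuousAt).continuousWithinAt

lemma circleIntegrable (h : ExteriorPair E Φ Ψ) {r : ℝ} (hr : 1 < r) {F : ℂ → ℂ}
    (hF : ∀ z ∉ E, ‖Φ z‖ = r → ContinuousAt F z) :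
    CircleIntegrable (fun w => F (Ψ w) * deriv Ψ w) 0 r :=
  ((h.continuousOn_comp_inv_sphere hr hF).mul
    (h.continuousOn_deriv_inv_sphere hr)).circleIntegrable (by linarith)

lemma levelIntegral_congr (h : ExteriorPair E Φ Ψ) {r : ℝ} (hr : 1 < r) {F G : ℂ → ℂ}
    (hFG : ∀ z ∉ E, ‖Φ z‖ = r → F z = G z) : levelIntegral Ψ r F = levelIntegral Ψ r G := by
  refine circleIntegral.integral_congr (by linarith) fun w hw => ?_
  have hw' : ‖w‖ = r := mem_sphere_zero_iff_norm.mp hw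
  have hw1 : 1 < ‖w‖ := hw' ▸ hr
  rw [hFG (Ψ w) (h.inv_notMem w hw1) (by rw [h.right_inv w hw1, hw'])]

lemma levelIntegral_add (h : ExteriorPair E Φ Ψ) {r : ℝ} (hr : 1 < r) {F G : ℂ → ℂ}
    (hF : ∀ z ∉ E, ‖Φ z‖ = r → ContinuousAt F z) (hG : ∀ z ∉ E, ‖Φ z‖ = r → ContinuousAt G z) :
    levelIntegral Ψ r (fun z => F z + G z) = levelIntegral Ψ r F + levelIntegral Ψ r G := by
  rw [levelIntegral, levelIntegral, levelIntegral,
    ← circleIntegral.integral_add (h.circleIntegrable hr hF) (h.circleIntegrable hr hG)]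
  simp only [add_mul]

lemma levelIntegral_sub (h : ExteriorPair E Φ Ψ) {r : ℝ} (hr : 1 < r) {F G : ℂ → ℂ}
    (hF : ∀ z ∉ E, ‖Φ z‖ = r → ContinuousAt F z) (hG : ∀ z ∉ E, ‖Φ z‖ = r → ContinuousAt G z) :
    levelIntegral Ψ r (fun z => F z - G z) = levelIntegral Ψ r F - levelIntegral Ψ r G := by
  rw [levelIntegral, levelIntegral, levelIntegral,
    ← circleIntegral.integral_sub (h.circleIntegrable hr hF) (h.circleIntegrable hr hG)]
  simp only [sub_mul]

lemma levelIntegral_const_mul (r : ℝ) (a : ℂ) (F : ℂ → ℂ) :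
    levelIntegral Ψ r (fun z => a * F z) = a * levelIntegral Ψ r F := by
  rw [levelIntegral, levelIntegral, ← circleIntegral.integral_const_mul]
  simp only [mul_assoc]

lemma levelIntegral_sum (h : ExteriorPair E Φ Ψ) {r : ℝ} (hr : 1 < r) {ι : Type*} (s : Finset ι)
    {F : ι → ℂ → ℂ} (hF : ∀ i ∈ s, ∀ z ∉ E, ‖Φ z‖ = r → ContinuousAt (F i) z) :
    levelIntegral Ψ r (fun z => ∑ i ∈ s, F i z) = ∑ i ∈ s, levelIntegral Ψ r (F i) := by
  simp only [levelIntegral, Finset.sum_mul]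
  exact circleIntegral.integral_fun_sum fun i hi => h.circleIntegrable hr (hF i hi)

lemma exists_norm_levelIntegral_le (h : ExteriorPair E Φ Ψ) {r : ℝ} (hr : 1 < r) :
    ∃ C : ℝ, 0 ≤ C ∧ ∀ (F : ℂ → ℂ) (M : ℝ), (∀ z ∉ E, ‖Φ z‖ = r → ‖F z‖ ≤ M) →
      ‖levelIntegral Ψ r F‖ ≤ C * M := by
  obtain ⟨B, hB⟩ := (isCompact_sphere (0 : ℂ) r).exists_bound_of_continuousOn
    (h.continuousOn_deriv_inv_sphere hr)
  have hB0 : 0 ≤ B := (norm_nonneg _).trans (hB (r : ℂ) (by simp; linarith))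
  have hπ := Real.pi_pos
  refine ⟨2 * Real.pi * r * B, by positivity, fun F M hM => ?_⟩
  rw [mul_assoc]
  refine circleIntegral.norm_integral_le_of_norm_le_const (by linarith) fun w hw => ?_
  have hw' : ‖w‖ = r := mem_sphere_zero_iff_norm.mp hw
  have hw1 : 1 < ‖w‖ := hw' ▸ hr
  rw [norm_mul, mul_comm]
  have h1 := hB w hw
  have h2 := hM (Ψ w) (h.inv_notMem w hw1) (by rw [h.right_inv w hw1, hw'])
  have h3 := norm_nonneg (F (Ψ w))
  gcongr

/-- A function continuous on a level curve is bounded there. -/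
lemma exists_bound_on_level (h : ExteriorPair E Φ Ψ) {r : ℝ} (hr : 1 < r) {F : ℂ → ℂ}
    (hF : ∀ z ∉ E, ‖Φ z‖ = r → ContinuousAt F z) :
    ∃ M : ℝ, 0 ≤ M ∧ ∀ z ∉ E, ‖Φ z‖ = r → ‖F z‖ ≤ M := by
  obtain ⟨M, hM⟩ := (isCompact_sphere (0 : ℂ) r).exists_bound_of_continuousOn
    (h.continuousOn_comp_inv_sphere hr hF)
  refine ⟨max M 0, le_max_right _ _, fun z hz hzr => le_trans ?_ (le_max_left _ _)⟩
  have := hM (Φ z) (by simpa using hzr)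
  rwa [h.left_inv z hz] at this

/-- The level integral does not depend on the level, as long as the integrand is analytic between
the levels. -/
lemma levelIntegral_eq (h : ExteriorPair E Φ Ψ) {r₁ r₂ : ℝ} (h1 : 1 < r₁) (h12 : r₁ ≤ r₂)
    {F : ℂ → ℂ} (hF : ∀ z ∉ E, r₁ ≤ ‖Φ z‖ → ‖Φ z‖ ≤ r₂ → AnalyticAt ℂ F z) :
    levelIntegral Ψ r₂ F = levelIntegral Ψ r₁ F := by
  refine circleIntegral_eq_of_analytic_annulus (by linarith) h12 fun w hw1 hw2 => ?_
  have hw : 1 < ‖w‖ := h1.trans_le hw1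
  have ha := hF (Ψ w) (h.inv_notMem w hw) (by rwa [h.right_inv w hw]) (by rwa [h.right_inv w hw])
  exact (ha.comp (h.analytic_inv w hw)).mul (h.analytic_inv w hw).deriv

lemma levelIntegral_eq_of_lt (h : ExteriorPair E Φ Ψ) {r₁ r₂ ρ : ℝ} (h1 : 1 < r₁) (h1ρ : r₁ < ρ)
    (h2 : 1 < r₂) (h2ρ : r₂ < ρ)
    {F : ℂ → ℂ} (hF : ∀ z ∉ E, ‖Φ z‖ < ρ → AnalyticAt ℂ F z) :
    levelIntegral Ψ r₁ F = levelIntegral Ψ r₂ F := by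
  rcases le_total r₁ r₂ with h12 | h12
  · exact (h.levelIntegral_eq h1 h12 fun z hz _ hz2 => hF z hz (hz2.trans_lt h2ρ)).symm
  · exact h.levelIntegral_eq h2 h12 fun z hz _ hz2 => hF z hz (hz2.trans_lt h1ρ)

lemma differentiableAt_levelIntegral (h : ExteriorPair E Φ Ψ) {r : ℝ} (hr : 1 < r) {F : ℂ → ℂ}
    (hF : ∀ z ∉ E, ‖Φ z‖ = r → ContinuousAt F z) {z₀ : ℂ} (hz₀ : z₀ ∉ E → ‖Φ z₀‖ ≠ r) :
    DifferentiableAt ℂ (fun z => levelIntegral Ψ r (fun ζ => F ζ / (ζ - z))) z₀ := by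
  have := differentiableAt_cauchyTransform (φ := fun w => F (Ψ w) * deriv Ψ w) (ψ := Ψ)
    (r := r) (by linarith) ((h.continuousOn_comp_inv_sphere hr hF).mul
    (h.continuousOn_deriv_inv_sphere hr)) (h.continuousOn_inv_sphere hr) (z₀ := z₀) (by
      rintro w hw rfl
      have hw' : ‖w‖ = r := mem_sphere_zero_iff_norm.mp hw
      have hw1 : 1 < ‖w‖ := hw' ▸ hr
      exact hz₀ (h.inv_notMem w hw1) (by rw [h.right_inv w hw1, hw']))
  refine this.congr_of_eventuallyEq (Eventually.of_forall fun z => ?_)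
  simp only [levelIntegral, div_mul_eq_mul_div]

lemma tendsto_levelIntegral_cauchy (h : ExteriorPair E Φ Ψ) {r : ℝ} (hr : 1 < r) {F : ℂ → ℂ}
    (hF : ∀ z ∉ E, ‖Φ z‖ = r → ContinuousAt F z) :
    Tendsto (fun z => levelIntegral Ψ r (fun ζ => F ζ / (ζ - z))) (Bornology.cobounded ℂ)
      (𝓝 0) := by
  obtain ⟨C, hC, hCM⟩ := h.exists_norm_levelIntegral_le hr
  obtain ⟨M, hM0, hM⟩ := h.exists_bound_on_level hr hF
  obtain ⟨B, -, hB⟩ := h.exists_bound_on_level hr (F := fun z => z) fun z _ _ => continuousAt_id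
  have hlim : Tendsto (fun z : ℂ => C * (M / (‖z‖ - B))) (Bornology.cobounded ℂ) (𝓝 0) := by
    have h1 : Tendsto (fun z : ℂ => ‖z‖ - B) (Bornology.cobounded ℂ) atTop :=
      tendsto_atTop_add_const_right _ (-B) tendsto_norm_cobounded_atTop
    have := (h1.const_div_atTop M).const_mul C
    simpa using this
  refine squeeze_zero_norm' ?_ hlim
  filter_upwards [tendsto_norm_cobounded_atTop.eventually_gt_atTop B] with z hz
  refine hCM _ _ fun ζ hζ hζr => ?_
  rw [norm_div]
  have h1 := hM ζ hζ hζr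
  have h2 : ‖z‖ - B ≤ ‖ζ - z‖ := by
    have := norm_sub_norm_le z ζ
    rw [norm_sub_rev] at this
    linarith [hB ζ hζ hζr]
  have : 0 < ‖z‖ - B := by linarith
  gcongr

/-- The annulus formula, transported by `Ψ`. -/
lemma cauchy_between_levels (h : ExteriorPair E Φ Ψ) {r₁ r₂ : ℝ} (h1 : 1 < r₁) {F : ℂ → ℂ}
    (hF : ∀ z ∉ E, r₁ ≤ ‖Φ z‖ → ‖Φ z‖ ≤ r₂ → AnalyticAt ℂ F z) {z : ℂ} (hz : z ∉ E)
    (hz1 : r₁ < ‖Φ z‖) (hz2 : ‖Φ z‖ < r₂) :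
    levelIntegral Ψ r₂ (fun ζ => F ζ / (ζ - z)) - levelIntegral Ψ r₁ (fun ζ => F ζ / (ζ - z)) =
      2 * Real.pi * Complex.I * F z := by
  have hv1 : 1 < ‖Φ z‖ := h1.trans hz1
  have hΨz := h.left_inv z hz
  have hne : ∀ w : ℂ, 1 < ‖w‖ → dslope Ψ (Φ z) w ≠ 0 := by
    intro w hw
    by_cases hwv : w = Φ z
    · subst hwv
      rw [dslope_same]
      exact h.deriv_inv_ne_zero hw
    · rw [dslope_of_ne _ hwv, slope_def_field]
      refine div_ne_zero (sub_ne_zero.mpr fun h' => hwv (h.inv_injOn hw hv1 h')) (sub_ne_zero.mpr hwv)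
  have key := cauchy_annulus (f := fun w => F (Ψ w) * deriv Ψ w / dslope Ψ (Φ z) w)
    (r₁ := r₁) (r₂ := r₂) (by linarith) (fun w hw1 hw2 => by
      have hw : 1 < ‖w‖ := h1.trans_le hw1
      have ha := hF (Ψ w) (h.inv_notMem w hw) (by rwa [h.right_inv w hw])
        (by rwa [h.right_inv w hw])
      exact ((ha.comp (h.analytic_inv w hw)).mul (h.analytic_inv w hw).deriv).div
        (AnalyticAt.dslope_of (h.analytic_inv _ hv1) (h.analytic_inv w hw)) (hne w hw)) hz1 hz2
  have hint : ∀ r : ℝ, 1 < r → r ≠ ‖Φ z‖ → levelIntegral Ψ r (fun ζ => F ζ / (ζ - z)) =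
      ∮ w in C(0, r), (F (Ψ w) * deriv Ψ w / dslope Ψ (Φ z) w) / (w - Φ z) := by
    intro r hr hrz
    refine circleIntegral.integral_congr (by linarith) fun w hw => ?_
    have hw' : ‖w‖ = r := mem_sphere_zero_iff_norm.mp hw
    have hwv : w ≠ Φ z := fun h' => hrz (by rw [← hw', h'])
    have h2 : Ψ w - z ≠ 0 := by
      rw [← hΨz]
      exact sub_ne_zero.mpr fun h' => hwv (h.inv_injOn (hw' ▸ hr) hv1 h')
    have h3 := sub_ne_zero.mpr hwv
    simp only
    rw [dslope_of_ne _ hwv, slope_def_field, hΨz]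
    field_simp
  rw [hint r₂ ((hv1.trans hz2)) hz2.ne', hint r₁ h1 hz1.ne, key]
  simp only [dslope_same, hΨz]
  rw [mul_div_assoc, div_self (h.deriv_inv_ne_zero hv1), mul_one]

/-- Cauchy's integral formula for a canonical domain.  The function splits between two levels
into a part analytic inside and a part analytic outside; the latter extends to an entire function
vanishing at infinity, so Liouville's theorem applies. -/
theorem cauchy_formula (h : ExteriorPair E Φ Ψ) {r ρ : ℝ} (hr : 1 < r) (hrρ : r < ρ) {F : ℂ → ℂ}
    (hF : AnalyticOnNhd ℂ F (canonicalDomain E Φ ρ)) {z : ℂ} (hz : z ∈ canonicalDomain E Φ r) :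
    levelIntegral Ψ r (fun ζ => F ζ / (ζ - z)) = 2 * Real.pi * Complex.I * F z := by
  classical
  obtain ⟨r₁, h1, h1r⟩ := exists_between hr
  have hF' : ∀ z ∉ E, ‖Φ z‖ < ρ → AnalyticAt ℂ F z := fun z _ hz =>
    hF z (mem_canonicalDomain.mpr fun _ => hz)
  have hFc : ∀ s < ρ, ∀ z ∉ E, ‖Φ z‖ = s → ContinuousAt F z := fun s hs z hz hzs =>
    (hF' z hz (hzs ▸ hs)).continuousAt
  set J : ℝ → ℂ → ℂ := fun s z => levelIntegral Ψ s (fun ζ => F ζ / (ζ - z)) with hJ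
  set W : ℂ → ℂ := fun z => if z ∈ canonicalDomain E Φ r then
    J r z - 2 * Real.pi * Complex.I * F z else J r₁ z with hW
  have hopen := h.isOpen_canonicalDomain hr
  have hWin : ∀ z ∈ canonicalDomain E Φ r, W z = J r z - 2 * Real.pi * Complex.I * F z :=
    fun z hz => if_pos hz
  have hWout : ∀ z ∉ E, r₁ < ‖Φ z‖ → W z = J r₁ z := by
    intro z hz hz1
    by_cases hzr : z ∈ canonicalDomain E Φ r
    · rw [hWin z hzr]
      have := h.cauchy_between_levels h1 (F := F) (r₂ := r)
        (fun z hz _ hz2 => hF' z hz (hz2.trans_lt hrρ)) hz hz1 (mem_canonicalDomain.mp hzr hz)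
      rw [← this]
      simp only [hJ]
      ring
    · exact if_neg hzr
  have hWdiff : Differentiable ℂ W := by
    intro z
    by_cases hzr : z ∈ canonicalDomain E Φ r
    · have hd : DifferentiableAt ℂ (fun z => J r z - 2 * Real.pi * Complex.I * F z) z :=
        (h.differentiableAt_levelIntegral hr (hFc r hrρ)
          fun hzE => (mem_canonicalDomain.mp hzr hzE).ne).sub
        ((hF z (canonicalDomain_mono hrρ.le hzr)).differentiableAt.const_mul _)
      refine hd.congr_of_eventuallyEq ?_
      filter_upwards [hopen.mem_nhds hzr] with y hy using hWin y hy
    · have hz' : z ∉ E ∧ r ≤ ‖Φ z‖ := by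
        rw [mem_canonicalDomain] at hzr
        push Not at hzr
        exact hzr
      have hz1 : z ∈ {z | z ∉ E ∧ r₁ < ‖Φ z‖} := ⟨hz'.1, h1r.trans_le hz'.2⟩
      have hd : DifferentiableAt ℂ (J r₁) z :=
        h.differentiableAt_levelIntegral h1 (hFc r₁ (h1r.trans hrρ)) fun _ => hz1.2.ne'
      refine hd.congr_of_eventuallyEq ?_
      filter_upwards [(h.isOpen_exterior r₁).mem_nhds hz1] with y hy using hWout y hy.1 hy.2
  have hWlim : Tendsto W (Filter.cocompact ℂ) (𝓝 0) := by
    rw [← Metric.cobounded_eq_cocompact]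
    refine (h.tendsto_levelIntegral_cauchy h1 (hFc r₁ (h1r.trans hrρ))).congr' ?_
    have h2 := (tendsto_norm_cobounded_atTop.comp h.tendsto_map).eventually_gt_atTop r₁
    have h3 : ∀ᶠ z in Bornology.cobounded ℂ, z ∉ E := h.compact.isBounded
    filter_upwards [h2, h3] with y hy hyE using (hWout y hyE hy).symm
  have h0 := hWdiff.apply_eq_of_tendsto_cocompact z hWlim
  rw [hWin z hz] at h0
  exact sub_eq_zero.mp h0

/-- Cauchy's theorem for a canonical domain. -/
theorem levelIntegral_eq_zero (h : ExteriorPair E Φ Ψ) {r ρ : ℝ} (hr : 1 < r) (hrρ : r < ρ)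
    {F : ℂ → ℂ} (hF : AnalyticOnNhd ℂ F (canonicalDomain E Φ ρ)) :
    levelIntegral Ψ r F = 0 := by
  obtain ⟨e, he⟩ := h.connected.nonempty
  have h1 := h.cauchy_formula hr hrρ (F := fun z => F z * (z - e)) (z := e)
    (fun z hz => (hF z hz).mul (analyticAt_id.sub analyticAt_const)) (subset_canonicalDomain he)
  rw [sub_self, mul_zero, mul_zero] at h1
  rw [← h1]
  refine h.levelIntegral_congr hr fun z hz _ => ?_
  have : z - e ≠ 0 := sub_ne_zero.mpr fun h' => hz (h' ▸ he)
  field_simp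

/-- A function analytic outside `E` with a double zero at infinity has vanishing level
integrals. -/
theorem levelIntegral_eq_zero_of_isBigO (h : ExteriorPair E Φ Ψ) {r : ℝ} (hr : 1 < r)
    {F : ℂ → ℂ} (hF : ∀ z ∉ E, AnalyticAt ℂ F z)
    (hO : F =O[Bornology.cobounded ℂ] fun z => (z ^ 2)⁻¹) :
    levelIntegral Ψ r F = 0 := by
  obtain ⟨C₁, R₁, hC₁, hR₁, hΨ⟩ := h.exists_norm_inv_le
  obtain ⟨C₂, R₂, hC₂, hR₂, hΨ'⟩ := h.exists_norm_deriv_inv_le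
  obtain ⟨C₃, hC₃, hO'⟩ := hO.exists_pos
  have h3 := h.tendsto_inv.eventually hO'.bound
  rw [(hasBasis_cobounded_norm (E := ℂ)).eventually_iff] at h3
  obtain ⟨R₃, -, hR₃⟩ := h3
  set R := max (max R₁ R₂) (max R₃ r) with hR
  have hπ := Real.pi_pos
  have hbound : ∀ s ≥ R, ‖levelIntegral Ψ r F‖ ≤ 2 * Real.pi * (C₃ * C₁ ^ 2 * C₂) / s := by
    intro s hs
    simp only [hR, ge_iff_le, max_le_iff] at hs
    obtain ⟨⟨hs1, hs2⟩, hs3, hs4⟩ := hs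
    have hs0 : 0 < s := by linarith
    rw [← h.levelIntegral_eq hr hs4 fun z hz _ _ => hF z hz]
    have := circleIntegral.norm_integral_le_of_norm_le_const (c := 0) (R := s)
      (f := fun w => F (Ψ w) * deriv Ψ w) (C := C₃ * (C₁ ^ 2 / s ^ 2) * C₂) hs0.le ?_
    · refine this.trans (le_of_eq ?_)
      field_simp
    · intro w hw
      have hw' : ‖w‖ = s := mem_sphere_zero_iff_norm.mp hw
      have h4 := hΨ' w (hw'.symm ▸ hs2)
      have h5 := (hΨ w (hw'.symm ▸ hs1)).2
      have h6 : ‖F (Ψ w)‖ ≤ C₃ * ‖((Ψ w) ^ 2)⁻¹‖ := hR₃ (show R₃ ≤ ‖w‖ from hw'.symm ▸ hs3)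
      rw [hw'] at h5
      have h7 : 0 < ‖Ψ w‖ := by
        by_contra! h8
        have : C₁ * ‖Ψ w‖ ≤ 0 := mul_nonpos_of_nonneg_of_nonpos hC₁.le h8
        linarith
      have h8 : ‖((Ψ w) ^ 2)⁻¹‖ ≤ C₁ ^ 2 / s ^ 2 := by
        rw [norm_inv, norm_pow, inv_eq_one_div, div_le_div_iff₀ (by positivity) (by positivity),
          one_mul, ← mul_pow]
        gcongr
      rw [norm_mul]
      gcongr
      exact h6.trans (by gcongr)
  have hlim : Tendsto (fun s : ℝ => 2 * Real.pi * (C₃ * C₁ ^ 2 * C₂) / s) atTop (𝓝 0) :=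
    tendsto_id.const_div_atTop _
  have h0 : ‖levelIntegral Ψ r F‖ ≤ 0 :=
    ge_of_tendsto hlim ((eventually_ge_atTop R).mono hbound)
  exact norm_le_zero_iff.mp h0

lemma analyticOnNhd_inv_sub_pow (ξ : ℂ) (hξ : ξ ∉ E) (k : ℕ) :
    AnalyticOnNhd ℂ (fun z => ((z - ξ) ^ k)⁻¹) (canonicalDomain E Φ ‖Φ ξ‖) := by
  intro z hz
  have hne : z ≠ ξ := by
    rintro rfl
    exact lt_irrefl _ (mem_canonicalDomain.mp hz hξ)
  exact ((analyticAt_id.sub analyticAt_const).pow k).inv (pow_ne_zero k (sub_ne_zero.mpr hne))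

/-- Cauchy's integral formula for the exterior of a level curve. -/
theorem cauchy_formula_exterior (h : ExteriorPair E Φ Ψ) {r : ℝ} (hr : 1 < r) {ξ : ℂ} (hξ : ξ ∉ E)
    (hrξ : r < ‖Φ ξ‖) {A : ℂ → ℂ} (hA : ∀ z ∉ E, AnalyticAt ℂ A z)
    (hO : A =O[Bornology.cobounded ℂ] fun z => z⁻¹) :
    levelIntegral Ψ r (fun ζ => A ζ / (ζ - ξ)) = -(2 * Real.pi * Complex.I * A ξ) := by
  obtain ⟨e, he⟩ := h.connected.nonempty
  have hcont : ∀ z ∉ E, ContinuousAt (fun ζ => A ξ * (ζ - e)⁻¹) z := fun z hz =>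
    (continuousAt_const.mul ((continuousAt_id.sub continuousAt_const).inv₀
      (sub_ne_zero.mpr fun h' => hz ((show z = e from h') ▸ he))))
  -- The first summand has a double zero at infinity, the second is analytic inside.
  have hne : ∀ z ∉ E, ‖Φ z‖ = r → z - ξ ≠ 0 := by
    intro z hz hzr h0
    rw [sub_eq_zero.mp h0] at hzr
    exact hrξ.ne' hzr
  have hsplit : levelIntegral Ψ r (fun ζ => A ζ / (ζ - ξ)) =
      levelIntegral Ψ r (fun ζ => (dslope A ξ ζ + A ξ * (ζ - e)⁻¹)) +
        A ξ * (levelIntegral Ψ r (fun ζ => ((ζ - ξ) ^ 1)⁻¹) -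
          levelIntegral Ψ r (fun ζ => 1 / (ζ - e))) := by
    have hc1 : ∀ z ∉ E, ‖Φ z‖ = r → ContinuousAt (fun ζ => ((ζ - ξ) ^ 1)⁻¹) z := fun z hz hzr =>
      ((continuousAt_id.sub continuousAt_const).pow 1).inv₀ (pow_ne_zero 1 (hne z hz hzr))
    have hc2 : ∀ z ∉ E, ‖Φ z‖ = r → ContinuousAt (fun ζ => 1 / (ζ - e)) z := fun z hz _ =>
      continuousAt_const.div (continuousAt_id.sub continuousAt_const)
        (sub_ne_zero.mpr fun h' => hz (h' ▸ he))
    rw [← h.levelIntegral_sub hr hc1 hc2, ← levelIntegral_const_mul, ← h.levelIntegral_add hr]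
    · refine h.levelIntegral_congr hr fun z hz hzr => ?_
      have h1 := hne z hz hzr
      have h2 : z - e ≠ 0 := sub_ne_zero.mpr fun h' => hz (h' ▸ he)
      rw [dslope_of_ne _ (sub_ne_zero.mp h1), slope_def_field]
      field_simp
      ring
    · exact fun z hz _ => ((AnalyticAt.dslope_of (hA ξ hξ) (hA z hz)).continuousAt).add (hcont z hz)
    · exact fun z hz hzr => continuousAt_const.mul ((hc1 z hz hzr).sub (hc2 z hz hzr))
  have h1 : levelIntegral Ψ r (fun ζ => ((ζ - ξ) ^ 1)⁻¹) = 0 :=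
    h.levelIntegral_eq_zero hr hrξ (analyticOnNhd_inv_sub_pow ξ hξ 1)
  have h2 : levelIntegral Ψ r (fun ζ => 1 / (ζ - e)) = 2 * Real.pi * Complex.I := by
    have := h.cauchy_formula hr (lt_add_one r) (F := fun _ => 1) (fun _ _ => analyticAt_const)
      (subset_canonicalDomain he)
    rw [this, mul_one]
  have h3 : levelIntegral Ψ r (fun ζ => (dslope A ξ ζ + A ξ * (ζ - e)⁻¹)) = 0 := by
    refine h.levelIntegral_eq_zero_of_isBigO hr (fun z hz => ?_) ?_
    · exact (AnalyticAt.dslope_of (hA ξ hξ) (hA z hz)).add (analyticAt_const.mul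
        ((analyticAt_id.sub analyticAt_const).inv (sub_ne_zero.mpr fun h' => hz ((show z = e from h') ▸ he))))
    · have hinv : ∀ a : ℂ, (fun z : ℂ => (z - a)⁻¹) =O[Bornology.cobounded ℂ] fun z => z⁻¹ := by
        intro a
        refine Asymptotics.IsBigO.of_bound 2 ?_
        filter_upwards [tendsto_norm_cobounded_atTop.eventually_gt_atTop (2 * ‖a‖)] with z hz
        have hz0 : 0 < ‖z‖ := lt_of_le_of_lt (by positivity) hz
        have h4 : ‖z‖ / 2 ≤ ‖z - a‖ := by
          have := norm_sub_norm_le z a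
          linarith
        rw [norm_inv, norm_inv, ← div_eq_mul_inv, inv_eq_one_div, div_le_div_iff₀ (by linarith) hz0]
        linarith
      have h5 : (fun z : ℂ => A z * (z - ξ)⁻¹ + A ξ * (ξ - e) * (-((z - ξ)⁻¹ * (z - e)⁻¹)))
          =O[Bornology.cobounded ℂ] fun z => (z ^ 2)⁻¹ := by
        have hsq : (fun z : ℂ => (z ^ 2)⁻¹) = fun z => z⁻¹ * z⁻¹ := by
          ext z; rw [sq, mul_inv]
        rw [hsq]
        exact (hO.mul (hinv ξ)).add ((((hinv ξ).mul (hinv e)).neg_left).const_mul_left _)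
      refine h5.congr' ?_ EventuallyEq.rfl
      filter_upwards [Bornology.eventually_ne_cobounded ξ,
        Bornology.eventually_ne_cobounded e] with z hz hz'
      have h6 := sub_ne_zero.mpr hz
      have h7 := sub_ne_zero.mpr hz'
      rw [dslope_of_ne _ hz, slope_def_field]
      field_simp
      ring
  rw [hsplit, h1, h2, h3]
  ring

end ExteriorPair

/-! ### Geometric growth rates -/

/-- `x n = O(η ^ n)` for every `η > θ`; for `θ ≥ 0` this says `limsup ‖x n‖ ^ (1 / n) ≤ θ`
(see `limsup_le_iff_growthLE`). -/
def GrowthLE (x : ℕ → ℂ) (θ : ℝ) : Prop :=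
  ∀ η > θ, x =O[atTop] fun n => (η ^ n : ℝ)

namespace GrowthLE

variable {x y : ℕ → ℂ} {θ θ' : ℝ}

lemma mono (h : GrowthLE x θ) (hθ : θ ≤ θ') : GrowthLE x θ' := fun η hη => h η (hθ.trans_lt hη)

lemma of_isBigO (hθ : 0 ≤ θ) (h : x =O[atTop] fun n => (θ ^ n : ℝ)) : GrowthLE x θ := by
  intro η hη
  refine h.trans (Asymptotics.IsBigO.of_bound 1 (Eventually.of_forall fun n => ?_))
  rw [one_mul, Real.norm_of_nonneg (by positivity), Real.norm_of_nonneg (pow_nonneg (hθ.trans hη.le) n)]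
  gcongr

lemma of_isBigO_one (h : x =O[atTop] fun _ => (1 : ℝ)) : GrowthLE x 1 :=
  of_isBigO zero_le_one (by simpa using h)

lemma sub (hx : GrowthLE x θ) (hy : GrowthLE y θ) : GrowthLE (fun n => x n - y n) θ :=
  fun η hη => (hx η hη).sub (hy η hη)

lemma neg (hx : GrowthLE x θ) : GrowthLE (fun n => -x n) θ :=
  fun η hη => (hx η hη).neg_left

lemma const_mul (hx : GrowthLE x θ) (a : ℂ) : GrowthLE (fun n => a * x n) θ :=
  fun η hη => (hx η hη).const_mul_left a

lemma sum {ι : Type*} {s : Finset ι} {f : ι → ℕ → ℂ} (h : ∀ i ∈ s, GrowthLE (f i) θ) :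
    GrowthLE (fun n => ∑ i ∈ s, f i n) θ :=
  fun η hη => (Asymptotics.IsBigO.sum fun i hi => h i hi η hη).congr_left fun n => by simp

lemma congr' (hx : GrowthLE x θ) (h : x =ᶠ[atTop] y) : GrowthLE y θ :=
  fun η hη => (hx η hη).congr' h EventuallyEq.rfl

lemma mul (h0 : 0 ≤ θ) (h0' : 0 ≤ θ') (hx : GrowthLE x θ) (hy : GrowthLE y θ') :
    GrowthLE (fun n => x n * y n) (θ * θ') := by
  intro η hη
  have hlim : Tendsto (fun ε : ℝ => (θ + ε) * (θ' + ε)) (𝓝[>] 0) (𝓝 (θ * θ')) := by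
    have : Continuous fun ε : ℝ => (θ + ε) * (θ' + ε) := by fun_prop
    have := this.tendsto 0
    simp only [add_zero] at this
    exact this.mono_left nhdsWithin_le_nhds
  obtain ⟨ε, hε, hε0⟩ := ((hlim.eventually_lt_const hη).and self_mem_nhdsWithin).exists
  have hε0' : (0 : ℝ) < ε := hε0
  have h1 := (hx (θ + ε) (by linarith)).mul (hy (θ' + ε) (by linarith))
  refine h1.trans (Asymptotics.IsBigO.of_bound 1 (Eventually.of_forall fun n => ?_))
  rw [one_mul, ← mul_pow, Real.norm_of_nonneg (by positivity),
    Real.norm_of_nonneg (pow_nonneg ((mul_nonneg h0 h0').trans hη.le) n)]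
  gcongr

lemma tendsto_zero (h0 : 0 ≤ θ) (hx : GrowthLE x θ) (hθ : θ < 1) : Tendsto x atTop (𝓝 0) := by
  obtain ⟨η, h1, h2⟩ := exists_between hθ
  exact (hx η h1).trans_tendsto (tendsto_pow_atTop_nhds_zero_of_lt_one (h0.trans h1.le) h2)

end GrowthLE

lemma limsup_le_iff_growthLE {x : ℕ → ℂ} {θ : ℝ} (hθ : 0 ≤ θ) :
    limsup (fun n : ℕ => ENNReal.ofReal (‖x n‖ ^ (1 / (n : ℝ)))) atTop ≤ ENNReal.ofReal θ ↔
      GrowthLE x θ := by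
  constructor
  · intro h η hη
    have hη0 : 0 < η := hθ.trans_lt hη
    have h1 : limsup (fun n : ℕ => ENNReal.ofReal (‖x n‖ ^ (1 / (n : ℝ)))) atTop
        < ENNReal.ofReal η := h.trans_lt ((ENNReal.ofReal_lt_ofReal_iff hη0).mpr hη)
    refine Asymptotics.IsBigO.of_bound 1 ?_
    filter_upwards [eventually_lt_of_limsup_lt h1, eventually_gt_atTop 0] with n hn hn0
    rw [ENNReal.ofReal_lt_ofReal_iff hη0] at hn
    have hn0' : (n : ℝ) ≠ 0 := by exact_mod_cast hn0.ne'
    have h2 : (‖x n‖ ^ (1 / (n : ℝ))) ^ n = ‖x n‖ := by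
      rw [← Real.rpow_natCast, ← Real.rpow_mul (norm_nonneg _), one_div_mul_cancel hn0',
        Real.rpow_one]
    rw [one_mul, Real.norm_of_nonneg (by positivity), ← h2]
    exact pow_le_pow_left₀ (by positivity) hn.le n
  · intro h
    have key : ∀ η > θ, limsup (fun n : ℕ => ENNReal.ofReal (‖x n‖ ^ (1 / (n : ℝ)))) atTop ≤
        ENNReal.ofReal η := by
      intro η hη
      have hη0 : 0 < η := hθ.trans_lt hη
      obtain ⟨C, hC, hb⟩ := (h η hη).exists_pos
      have hlim : Tendsto (fun n : ℕ => ENNReal.ofReal (C ^ (1 / (n : ℝ)) * η)) atTop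
          (𝓝 (ENNReal.ofReal η)) := by
        refine (ENNReal.continuous_ofReal.tendsto _).comp ?_
        have h1 : Tendsto (fun n : ℕ => C ^ (1 / (n : ℝ))) atTop (𝓝 (C ^ (0 : ℝ))) :=
          (Real.continuousAt_const_rpow hC.ne').tendsto.comp tendsto_one_div_atTop_nhds_zero_nat
        rw [Real.rpow_zero] at h1
        simpa using h1.mul_const η
      rw [← hlim.limsup_eq]
      refine limsup_le_limsup ?_
      filter_upwards [hb.bound, eventually_gt_atTop 0] with n hn hn0
      have hn0' : (n : ℝ) ≠ 0 := by exact_mod_cast hn0.ne'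
      rw [Real.norm_of_nonneg (by positivity)] at hn
      apply ENNReal.ofReal_le_ofReal
      calc ‖x n‖ ^ (1 / (n : ℝ)) ≤ (C * η ^ n) ^ (1 / (n : ℝ)) :=
            Real.rpow_le_rpow (norm_nonneg _) hn (by positivity)
        _ = C ^ (1 / (n : ℝ)) * η := by
            rw [Real.mul_rpow hC.le (by positivity), ← Real.rpow_natCast η,
              ← Real.rpow_mul hη0.le, mul_one_div_cancel hn0', Real.rpow_one]
    have hlim : Tendsto (fun η : ℝ => ENNReal.ofReal η) (𝓝[>] θ) (𝓝 (ENNReal.ofReal θ)) :=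
      (ENNReal.continuous_ofReal.tendsto θ).mono_left nhdsWithin_le_nhds
    refine ge_of_tendsto hlim ?_
    filter_upwards [self_mem_nhdsWithin] with η hη using key η hη

/-! ### The normalised reciprocals of the nodal polynomials -/

/-- The kernel `c ^ (n + 1) / a_{n + 1}`. -/
noncomputable def nodalKernel (α : ℕ → ℕ → ℂ) (c : ℝ) (n : ℕ) (z : ℂ) : ℂ :=
  (c : ℂ) ^ (n + 1) / (nodal α (n + 1)).eval z

lemma nodal_eval (α : ℕ → ℕ → ℂ) (n : ℕ) (z : ℂ) :
    (nodal α n).eval z = ∏ k ∈ Finset.Icc 1 n, (z - α n k) := by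
  simp [nodal, eval_prod]

lemma isBigO_polynomial (p : ℂ[X]) {d : ℕ} (hp : p.natDegree ≤ d) :
    (fun z => p.eval z) =O[Bornology.cobounded ℂ] fun z => z ^ d := by
  refine Asymptotics.IsBigO.of_bound (∑ i ∈ Finset.range (p.natDegree + 1), ‖p.coeff i‖) ?_
  filter_upwards [tendsto_norm_cobounded_atTop.eventually_ge_atTop (1 : ℝ)] with z hz
  rw [eval_eq_sum_range, Finset.sum_mul]
  refine (norm_sum_le _ _).trans (Finset.sum_le_sum fun i hi => ?_)
  rw [norm_mul, norm_pow, norm_pow]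
  have : i ≤ d := by
    have := Finset.mem_range.mp hi
    omega
  gcongr

lemma isBigO_inv_nodal (α : ℕ → ℕ → ℂ) (n : ℕ) :
    (fun z => ((nodal α n).eval z)⁻¹) =O[Bornology.cobounded ℂ] fun z => (z ^ n)⁻¹ := by
  refine Asymptotics.IsBigO.of_bound (2 ^ n) ?_
  have h1 : ∀ᶠ z in Bornology.cobounded ℂ, ∀ k ∈ Finset.Icc 1 n, 2 * ‖α n k‖ < ‖z‖ :=
    (Finset.eventually_all _).mpr fun k _ => tendsto_norm_cobounded_atTop.eventually_gt_atTop _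
  filter_upwards [h1, tendsto_norm_cobounded_atTop.eventually_gt_atTop (0 : ℝ)] with z hz hz0
  rw [nodal_eval, norm_inv, norm_prod, norm_inv, norm_pow]
  have h2 : (‖z‖ / 2) ^ n ≤ ∏ k ∈ Finset.Icc 1 n, ‖z - α n k‖ := by
    have : (‖z‖ / 2) ^ n = ∏ k ∈ Finset.Icc 1 n, (‖z‖ / 2) := by
      rw [Finset.prod_const, Nat.card_Icc, Nat.add_sub_cancel]
    rw [this]
    refine Finset.prod_le_prod (fun _ _ => by positivity) fun k hk => ?_
    have := norm_sub_norm_le z (α n k)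
    linarith [hz k hk]
  calc _ ≤ ((‖z‖ / 2) ^ n)⁻¹ := inv_anti₀ (by positivity) h2
    _ = _ := by rw [div_pow, inv_div, div_eq_mul_inv]

/-- What the argument uses about the kernels `K n = c ^ (n + 1) / a_{n + 1}`. -/
structure KernelFamily (E : Set ℂ) (Φ : ℂ → ℂ) (K : ℕ → ℂ → ℂ) (G : ℂ → ℂ) : Prop where
  analytic : ∀ n, ∀ z ∉ E, AnalyticAt ℂ (K n) z
  ne_zero : ∀ n, ∀ z ∉ E, K n z ≠ 0
  decay : ∀ n, K n =O[Bornology.cobounded ℂ] fun z => (z ^ (n + 1))⁻¹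
  analytic_lim : ∀ z ∉ E, AnalyticAt ℂ G z
  ne_zero_lim : ∀ z ∉ E, G z ≠ 0
  bound : ∀ r > 1, ∃ C : ℝ, 0 < C ∧ ∀ᶠ n in atTop, ∀ z ∉ E, r ≤ ‖Φ z‖ →
    ‖K n z‖ ≤ C * (‖Φ z‖ ^ n)⁻¹
  inv_bound : ∀ z ∉ E, (fun n => (K n z)⁻¹) =O[atTop] fun n => (‖Φ z‖ ^ n : ℝ)
  uniform : ∀ r > 1, ∀ ε > 0, ∀ᶠ n in atTop, ∀ z ∉ E, r ≤ ‖Φ z‖ →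
    ‖G z * K n z * Φ z ^ (n + 1) - 1‖ ≤ ε

theorem ExteriorPair.kernelFamily {E : Set ℂ} {Φ Ψ : ℂ → ℂ} (h : ExteriorPair E Φ Ψ)
    {α : ℕ → ℕ → ℂ} (hα : ∀ n k, 1 ≤ k → k ≤ n → α n k ∈ E) {c : ℝ} (hc : 0 < c) {G : ℂ → ℂ}
    (hG : NodesAsymptotic E Φ α c G) : KernelFamily E Φ (nodalKernel α c) G := by
  have hc' : (c : ℂ) ≠ 0 := by exact_mod_cast hc.ne'
  have hnod : ∀ n, ∀ z ∉ E, (nodal α n).eval z ≠ 0 := by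
    intro n z hz
    rw [nodal_eval]
    refine Finset.prod_ne_zero_iff.mpr fun k hk => sub_ne_zero.mpr ?_
    rintro rfl
    rw [Finset.mem_Icc] at hk
    exact hz (hα n k hk.1 hk.2)
  have hΦ0 : ∀ z ∉ E, Φ z ≠ 0 := fun z hz => norm_pos_iff.mp (by linarith [h.one_lt z hz])
  have hana : ∀ p : ℂ[X], ∀ z, AnalyticAt ℂ (fun z => p.eval z) z := fun p z => by
    simpa using (analyticAt_id (𝕜 := ℂ) (z := z)).aeval_polynomial p
  set A : ℕ → ℂ → ℂ := fun n z => (nodal α n).eval z / ((c : ℂ) ^ n * Φ z ^ n) with hA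
  have hA0 : ∀ n, ∀ z ∉ E, A n z ≠ 0 := fun n z hz => div_ne_zero (hnod n z hz)
    (mul_ne_zero (pow_ne_zero _ hc') (pow_ne_zero _ (hΦ0 z hz)))
  have hKA : ∀ n, ∀ z ∉ E, nodalKernel α c n z = (A (n + 1) z * Φ z ^ (n + 1))⁻¹ := by
    intro n z hz
    have h1 := hnod (n + 1) z hz
    have h2 := hΦ0 z hz
    simp only [hA, nodalKernel]
    field_simp
  have hGana : ∀ z ∉ E, AnalyticAt ℂ G z := by
    have hd : DifferentiableOn ℂ G Eᶜ := by
      refine TendstoLocallyUniformlyOn.differentiableOn (F := A) (φ := atTop) ?_ ?_ h.isOpen_compl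
      · rw [tendstoLocallyUniformlyOn_iff_forall_isCompact h.isOpen_compl]
        intro K hKE hK
        exact hG.uniform K hK.isClosed (Set.disjoint_left.mpr fun z hz => hKE hz)
      · refine Eventually.of_forall fun n z hz => ?_
        exact ((hana _ z).div (analyticAt_const.mul ((h.analytic z hz).pow n))
          (mul_ne_zero (pow_ne_zero _ hc')
            (pow_ne_zero _ (hΦ0 z hz)))).differentiableAt.differentiableWithinAt
    exact fun z hz => (hd.analyticOnNhd h.isOpen_compl) z hz
  have hGlow : ∀ r > 1, ∃ δ > 0, ∀ z ∉ E, r ≤ ‖Φ z‖ → δ ≤ ‖G z‖ := by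
    intro r hr
    obtain ⟨L, hL, hlim⟩ := hG.ne_zero_at_infinity
    have hL' := norm_pos_iff.mpr hL
    have h1 := hlim.norm.eventually_const_lt (u := ‖L‖ / 2) (by linarith)
    rw [(hasBasis_cobounded_norm (E := ℂ)).eventually_iff] at h1
    obtain ⟨R, -, hR⟩ := h1
    have hK : IsCompact ({z | z ∉ E ∧ r ≤ ‖Φ z‖} ∩ Metric.closedBall 0 R) :=
      (isCompact_closedBall (0 : ℂ) R).inter_left (h.isClosed_exterior hr)
    have hmin : ∃ δ > 0, ∀ z ∈ {z | z ∉ E ∧ r ≤ ‖Φ z‖} ∩ Metric.closedBall 0 R, δ ≤ ‖G z‖ := by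
      rcases ({z | z ∉ E ∧ r ≤ ‖Φ z‖} ∩ Metric.closedBall 0 R).eq_empty_or_nonempty with h0 | h0
      · exact ⟨1, one_pos, by simp [h0]⟩
      · obtain ⟨z, hz, hzmin⟩ := hK.exists_isMinOn h0 (f := fun z => ‖G z‖) fun z hz =>
          (hGana z hz.1.1).continuousAt.norm.continuousWithinAt
        exact ⟨‖G z‖, norm_pos_iff.mpr (hG.ne_zero z hz.1.1), fun y hy => hzmin hy⟩
    obtain ⟨δ, hδ, hmin⟩ := hmin
    refine ⟨min δ (‖L‖ / 2), by positivity, fun z hz hzr => ?_⟩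
    by_cases hzR : ‖z‖ ≤ R
    · exact (min_le_left _ _).trans (hmin z ⟨⟨hz, hzr⟩, by simpa using hzR⟩)
    · exact (min_le_right _ _).trans (hR (show R ≤ ‖z‖ by linarith)).le
  have hunif : ∀ r > 1, ∀ ε > 0, ∀ᶠ n in atTop, ∀ z ∉ E, r ≤ ‖Φ z‖ → ‖A (n + 1) z - G z‖ < ε := by
    intro r hr ε hε
    have h1 := hG.uniform _ (h.isClosed_exterior hr) (Set.disjoint_left.mpr fun z hz => hz.1)
    have h2 := Metric.tendstoUniformlyOn_iff.mp h1 ε hε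
    filter_upwards [(tendsto_add_atTop_nat 1).eventually h2] with n hn z hz hzr
    have := hn z ⟨hz, hzr⟩
    rwa [dist_comm, dist_eq_norm] at this
  refine ⟨?_, ?_, ?_, hGana, hG.ne_zero, ?_, ?_, ?_⟩
  · exact fun n z hz => analyticAt_const.div (hana _ z) (hnod _ z hz)
  · exact fun n z hz => div_ne_zero (pow_ne_zero _ hc') (hnod _ z hz)
  · intro n
    have := (isBigO_inv_nodal α (n + 1)).const_mul_left ((c : ℂ) ^ (n + 1))
    exact this
  · intro r hr
    obtain ⟨δ, hδ, hlow⟩ := hGlow r hr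
    refine ⟨2 / δ, by positivity, ?_⟩
    filter_upwards [hunif r hr (δ / 2) (by positivity)] with n hn z hz hzr
    have h1 : δ / 2 ≤ ‖A (n + 1) z‖ := by
      have h2 := hlow z hz hzr
      have h3 := hn z hz hzr
      have h4 := norm_sub_norm_le (G z) (A (n + 1) z)
      rw [norm_sub_rev] at h4
      linarith
    have h5 := h.one_lt z hz
    rw [hKA n z hz, norm_inv, norm_mul, norm_pow, mul_inv]
    have h6 : ‖A (n + 1) z‖⁻¹ ≤ 2 / δ := by
      rw [← inv_div]
      gcongr
    gcongr
    · exact h5.le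
    · omega
  · intro z hz
    obtain ⟨r, hr1, hr2⟩ := exists_between (h.one_lt z hz)
    refine Asymptotics.IsBigO.of_bound ((‖G z‖ + 1) * ‖Φ z‖) ?_
    filter_upwards [hunif r hr1 1 one_pos] with n hn
    have h1 : ‖A (n + 1) z‖ ≤ ‖G z‖ + 1 := by
      have h3 := hn z hz hr2.le
      have h4 := norm_sub_norm_le (A (n + 1) z) (G z)
      linarith
    rw [hKA n z hz, inv_inv, norm_mul, norm_pow, norm_pow, norm_norm, pow_succ' ‖Φ z‖, ← mul_assoc]
    gcongr
  · intro r hr ε hε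
    obtain ⟨δ, hδ, hlow⟩ := hGlow r hr
    filter_upwards [hunif r hr (δ / 2) (by positivity),
      hunif r hr (ε * (δ / 2)) (by positivity)] with n hn hn' z hz hzr
    have h1 : δ / 2 ≤ ‖A (n + 1) z‖ := by
      have h2 := hlow z hz hzr
      have h3 := hn z hz hzr
      have h4 := norm_sub_norm_le (G z) (A (n + 1) z)
      rw [norm_sub_rev] at h4
      linarith
    have h5 : G z * nodalKernel α c n z * Φ z ^ (n + 1) - 1 =
        (G z - A (n + 1) z) / A (n + 1) z := by
      rw [hKA n z hz]
      have h6 := hA0 (n + 1) z hz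
      have h7 := hΦ0 z hz
      field_simp
    rw [h5, norm_div, norm_sub_rev, div_le_iff₀ (by linarith)]
    exact (hn' z hz hzr).le.trans (by gcongr)

/-! ### Growth of integrals against the kernels -/

/-- The principal part `∑_{j < s} b j / (z - ξ) ^ (j + 1)`. -/
noncomputable def polar (ξ : ℂ) (b : ℕ → ℂ) (s : ℕ) (z : ℂ) : ℂ :=
  ∑ j ∈ Finset.range s, b j * ((z - ξ) ^ (j + 1))⁻¹

lemma analyticAt_polar {ξ z : ℂ} (hz : z ≠ ξ) (b : ℕ → ℂ) (s : ℕ) :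
    AnalyticAt ℂ (polar ξ b s) z := by
  unfold polar
  refine Finset.analyticAt_fun_sum _ fun j _ => analyticAt_const.mul ?_
  exact ((analyticAt_id.sub analyticAt_const).pow _).inv (pow_ne_zero _ (sub_ne_zero.mpr hz))

lemma analyticAt_polynomial (p : ℂ[X]) (z : ℂ) : AnalyticAt ℂ (fun z => p.eval z) z := by
  simpa using (analyticAt_id (𝕜 := ℂ) (z := z)).aeval_polynomial p

lemma eval_eq_sum_taylor (q : ℂ[X]) (ξ z : ℂ) {M : ℕ} (hM : q.natDegree < M) :
    q.eval z = ∑ i ∈ Finset.range M, (taylor ξ q).coeff i * (z - ξ) ^ i := by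
  rw [← eval_eq_sum_range' (by rwa [natDegree_taylor]), taylor_eval_sub]

/-- The pairing `∮ q F K_n dz` along a level curve. -/
noncomputable def pairing (Ψ : ℂ → ℂ) (K : ℕ → ℂ → ℂ) (r : ℝ) (n : ℕ) (q : ℂ[X]) (F : ℂ → ℂ) : ℂ :=
  levelIntegral Ψ r fun z => q.eval z * F z * K n z

section

variable {E : Set ℂ} {Φ Ψ : ℂ → ℂ} {K : ℕ → ℂ → ℂ} {G : ℂ → ℂ}

lemma isBigO_levelIntegral (h : ExteriorPair E Φ Ψ) (hK : KernelFamily E Φ K G) {r : ℝ}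
    (hr : 1 < r) {F : ℂ → ℂ} (hF : ∀ z ∉ E, ‖Φ z‖ = r → ContinuousAt F z) :
    (fun n => levelIntegral Ψ r fun z => F z * K n z) =O[atTop] fun n => (r⁻¹ ^ n : ℝ) := by
  obtain ⟨C, hC, hCM⟩ := h.exists_norm_levelIntegral_le hr
  obtain ⟨M, hM0, hM⟩ := h.exists_bound_on_level hr hF
  obtain ⟨B, hB0, hB⟩ := hK.bound r hr
  refine Asymptotics.IsBigO.of_bound (C * (M * B)) ?_
  filter_upwards [hB] with n hn
  have h1 := hCM (fun z => F z * K n z) (M * (B * (r ^ n)⁻¹)) fun z hz hzr => by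
    rw [norm_mul]
    have h2 := hn z hz hzr.ge
    rw [hzr] at h2
    have h3 := hM z hz hzr
    gcongr
  rw [inv_pow, Real.norm_of_nonneg (by positivity)]
  linarith

lemma growthLE_levelIntegral (h : ExteriorPair E Φ Ψ) (hK : KernelFamily E Φ K G) {r ρ : ℝ}
    (hr : 1 < r) (hrρ : r < ρ) {F : ℂ → ℂ} (hF : AnalyticOnNhd ℂ F (canonicalDomain E Φ ρ)) :
    GrowthLE (fun n => levelIntegral Ψ r fun z => F z * K n z) ρ⁻¹ := by
  intro η hη
  have hρ0 : 0 < ρ := by linarith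
  have hη0 : 0 < η := (inv_pos.mpr hρ0).trans hη
  have hF' : ∀ z ∉ E, ‖Φ z‖ < ρ → AnalyticAt ℂ F z := fun z _ hz =>
    hF z (mem_canonicalDomain.mpr fun _ => hz)
  obtain ⟨s, hs1, hs2⟩ := exists_between (max_lt hrρ (inv_lt_of_inv_lt₀ hρ0 hη))
  rw [max_lt_iff] at hs1
  have hs : 1 < s := hr.trans hs1.1
  have heq : (fun n => levelIntegral Ψ r fun z => F z * K n z) =
      fun n => levelIntegral Ψ s fun z => F z * K n z := by
    ext n
    exact h.levelIntegral_eq_of_lt hr hrρ hs hs2 fun z hz hzρ => (hF' z hz hzρ).mul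
      (hK.analytic n z hz)
  rw [heq]
  refine (isBigO_levelIntegral h hK hs fun z hz hzs =>
    (hF' z hz (hzs ▸ hs2)).continuousAt).trans ?_
  refine Asymptotics.IsBigO.of_bound 1 (Eventually.of_forall fun n => ?_)
  have hs0 : 0 < s := by linarith
  rw [one_mul, Real.norm_of_nonneg (by positivity), Real.norm_of_nonneg (by positivity)]
  have : s⁻¹ ≤ η := inv_le_of_inv_le₀ hη0 hs1.2.le
  gcongr

lemma growthLE_pairing (h : ExteriorPair E Φ Ψ) (hK : KernelFamily E Φ K G) {r ρ δ : ℝ}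
    (hr : 1 < r) (hrρ : r < ρ) {F : ℂ → ℂ} (hF : AnalyticOnNhd ℂ F (canonicalDomain E Φ ρ))
    {q : ℕ → ℂ[X]} {N : ℕ} (hqN : ∀ n, (q n).natDegree ≤ N) (hδ : 0 ≤ δ)
    (hq : ∀ i, GrowthLE (fun n => (q n).coeff i) δ) :
    GrowthLE (fun n => pairing Ψ K r n (q n) F) (δ * ρ⁻¹) := by
  have heq : (fun n => pairing Ψ K r n (q n) F) = fun n => ∑ i ∈ Finset.range (N + 1),
      (q n).coeff i * levelIntegral Ψ r fun z => z ^ i * F z * K n z := by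
    ext n
    simp only [← ExteriorPair.levelIntegral_const_mul]
    rw [← h.levelIntegral_sum hr]
    · refine h.levelIntegral_congr hr fun z _ _ => ?_
      rw [eval_eq_sum_range' (Nat.lt_succ_of_le (hqN n)), Finset.sum_mul, Finset.sum_mul]
      exact Finset.sum_congr rfl fun i _ => by ring
    · intro i _ z hz hzr
      exact continuousAt_const.mul ((((analyticAt_id.pow i).mul
        (hF z (mem_canonicalDomain.mpr fun _ => hzr ▸ hrρ))).mul (hK.analytic n z hz)).continuousAt)
  rw [heq]
  refine GrowthLE.sum fun i _ => (hq i).mul hδ (inv_nonneg.mpr (by linarith)) ?_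
  exact growthLE_levelIntegral h hK hr hrρ fun z hz => (analyticAt_id.pow i).mul (hF z hz)

lemma levelIntegral_inv_sub_mul_kernel (h : ExteriorPair E Φ Ψ) (hK : KernelFamily E Φ K G)
    {r : ℝ} (hr : 1 < r) {ξ : ℂ} (hξ : ξ ∉ E) (hrξ : r < ‖Φ ξ‖) (n : ℕ) :
    levelIntegral Ψ r (fun z => ((z - ξ) ^ 1)⁻¹ * K n z) =
      -(2 * Real.pi * Complex.I * K n ξ) := by
  rw [← h.cauchy_formula_exterior hr hξ hrξ (hK.analytic n)]
  · exact h.levelIntegral_congr hr fun z _ _ => by rw [pow_one, inv_mul_eq_div]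
  · refine (hK.decay n).trans (Asymptotics.IsBigO.of_bound 1 ?_)
    filter_upwards [tendsto_norm_cobounded_atTop.eventually_ge_atTop (1 : ℝ)] with z hz
    rw [one_mul, norm_inv, norm_inv, norm_pow]
    exact inv_anti₀ (by linarith) (le_self_pow₀ hz (by omega))

lemma levelIntegral_polynomial_mul_kernel (h : ExteriorPair E Φ Ψ) (hK : KernelFamily E Φ K G)
    {r : ℝ} (hr : 1 < r) {n : ℕ} {p : ℂ[X]} (hp : p.natDegree + 1 ≤ n) :
    levelIntegral Ψ r (fun z => p.eval z * K n z) = 0 := by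
  refine h.levelIntegral_eq_zero_of_isBigO hr
    (fun z hz => (analyticAt_polynomial p z).mul (hK.analytic n z hz)) ?_
  refine ((isBigO_polynomial p (d := n - 1) (by omega)).mul (hK.decay n)).trans
    (Asymptotics.IsBigO.of_bound 1 ?_)
  filter_upwards [Bornology.eventually_ne_cobounded 0] with z hz
  rw [one_mul]
  have : n + 1 = (n - 1) + 2 := by omega
  rw [this, pow_add, mul_inv, ← mul_assoc, mul_inv_cancel₀ (pow_ne_zero _ hz), one_mul]

/-- The pairings with `(z - ξ)^{-(j+1)}` depend triangularly on the Taylor coefficients of the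
polynomial at `ξ`. -/
lemma pairing_inv_pow (h : ExteriorPair E Φ Ψ) (hK : KernelFamily E Φ K G)
    {r : ℝ} (hr : 1 < r) {ξ : ℂ} (hrξ : r < ‖Φ ξ‖) {n N : ℕ} {q : ℂ[X]}
    (hq : q.natDegree ≤ N) (hn : N + 1 ≤ n) (j : ℕ) :
    pairing Ψ K r n q (fun z => ((z - ξ) ^ (j + 1))⁻¹) = ∑ i ∈ Finset.range (j + 1),
      (taylor ξ q).coeff i * levelIntegral Ψ r fun z => ((z - ξ) ^ (j - i + 1))⁻¹ * K n z := by
  have hne : ∀ z ∉ E, ‖Φ z‖ = r → z - ξ ≠ 0 := by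
    intro z hz hzr h0
    rw [sub_eq_zero.mp h0] at hzr
    exact hrξ.ne' hzr
  have h1 : pairing Ψ K r n q (fun z => ((z - ξ) ^ (j + 1))⁻¹) =
      ∑ i ∈ Finset.range (N + j + 1), (taylor ξ q).coeff i *
        levelIntegral Ψ r fun z => (z - ξ) ^ i * ((z - ξ) ^ (j + 1))⁻¹ * K n z := by
    simp only [← ExteriorPair.levelIntegral_const_mul]
    rw [← h.levelIntegral_sum hr]
    · refine h.levelIntegral_congr hr fun z _ _ => ?_
      rw [eval_eq_sum_taylor q ξ z (M := N + j + 1) (by omega), Finset.sum_mul, Finset.sum_mul]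
      exact Finset.sum_congr rfl fun i _ => by ring
    · intro i _ z hz hzr
      have h2 : AnalyticAt ℂ (fun z => z - ξ) z := analyticAt_id.sub analyticAt_const
      exact continuousAt_const.mul ((((h2.pow i).mul
        ((h2.pow (j + 1)).inv (pow_ne_zero _ (hne z hz hzr)))).mul
          (hK.analytic n z hz)).continuousAt)
  rw [h1]
  symm
  rw [← Finset.sum_subset (Finset.range_mono (show j + 1 ≤ N + j + 1 by omega))]
  · refine Finset.sum_congr rfl fun i hi => ?_
    congr 1
    refine h.levelIntegral_congr hr fun z hz hzr => ?_
    have h3 := hne z hz hzr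
    have h4 : j + 1 = i + (j - i + 1) := by
      have := Finset.mem_range.mp hi
      omega
    have h5 : (z - ξ) ^ (j + 1) = (z - ξ) ^ i * (z - ξ) ^ (j - i + 1) := by
      rw [← pow_add, ← h4]
    rw [h5, mul_inv, ← mul_assoc, mul_inv_cancel₀ (pow_ne_zero _ h3), one_mul]
  · intro i hi hi'
    rw [Finset.mem_range] at hi hi'
    convert mul_zero _
    rw [← levelIntegral_polynomial_mul_kernel h hK hr (n := n) (p := (X - C ξ) ^ (i - (j + 1)))]
    · refine h.levelIntegral_congr hr fun z hz hzr => ?_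
      have h3 := hne z hz hzr
      have h4 : i = (i - (j + 1)) + (j + 1) := by omega
      rw [eval_pow, eval_sub, eval_X, eval_C]
      conv_lhs => rw [h4, pow_add, mul_assoc ((z - ξ) ^ (i - (j + 1))),
        mul_inv_cancel₀ (pow_ne_zero _ h3), mul_one]
    · rw [natDegree_pow, natDegree_X_sub_C]
      omega

lemma growthLE_levelIntegral_inv_pow (h : ExteriorPair E Φ Ψ) (hK : KernelFamily E Φ K G)
    {r : ℝ} (hr : 1 < r) {ξ : ℂ} (hξ : ξ ∉ E) (hrξ : r < ‖Φ ξ‖) (k : ℕ) :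
    GrowthLE (fun n => levelIntegral Ψ r fun z => ((z - ξ) ^ k)⁻¹ * K n z) ‖Φ ξ‖⁻¹ :=
  growthLE_levelIntegral h hK hr hrξ (ExteriorPair.analyticOnNhd_inv_sub_pow ξ hξ k)

lemma growthLE_pairing_of_taylor (h : ExteriorPair E Φ Ψ) (hK : KernelFamily E Φ K G)
    {r : ℝ} (hr : 1 < r) {ξ : ℂ} (hξ : ξ ∉ E) (hrξ : r < ‖Φ ξ‖) {N : ℕ} {q : ℕ → ℂ[X]}
    (hq : ∀ n, (q n).natDegree ≤ N) {θ : ℝ} (hθ : 0 ≤ θ) {j : ℕ}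
    (hc : ∀ i ≤ j, GrowthLE (fun n => (taylor ξ (q n)).coeff i) θ) :
    GrowthLE (fun n => pairing Ψ K r n (q n) (fun z => ((z - ξ) ^ (j + 1))⁻¹))
      (θ * ‖Φ ξ‖⁻¹) := by
  have h1 : GrowthLE (fun n => ∑ i ∈ Finset.range (j + 1),
      (taylor ξ (q n)).coeff i * levelIntegral Ψ r fun z => ((z - ξ) ^ (j - i + 1))⁻¹ * K n z)
      (θ * ‖Φ ξ‖⁻¹) := by
    refine GrowthLE.sum fun i hi => (hc i (by have := Finset.mem_range.mp hi; omega)).mul hθ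
      (by positivity) (growthLE_levelIntegral_inv_pow h hK hr hξ hrξ _)
  refine h1.congr' ?_
  filter_upwards [eventually_ge_atTop (N + 1)] with n hn
  exact (pairing_inv_pow h hK hr hrξ (hq n) hn j).symm

lemma growthLE_taylor_of_pairing (h : ExteriorPair E Φ Ψ) (hK : KernelFamily E Φ K G)
    {r : ℝ} (hr : 1 < r) {ξ : ℂ} (hξ : ξ ∉ E) (hrξ : r < ‖Φ ξ‖) {N : ℕ} {q : ℕ → ℂ[X]}
    (hq : ∀ n, (q n).natDegree ≤ N) {θ : ℝ} (hθ : 0 ≤ θ) {t : ℕ}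
    (hp : ∀ j < t, GrowthLE (fun n => pairing Ψ K r n (q n) (fun z => ((z - ξ) ^ (j + 1))⁻¹)) θ) :
    ∀ j < t, GrowthLE (fun n => (taylor ξ (q n)).coeff j) (θ * ‖Φ ξ‖) := by
  intro j
  induction j using Nat.strong_induction_on with
  | _ j ih =>
  intro hj
  have hΦ0 : 0 < ‖Φ ξ‖ := by linarith [h.one_lt ξ hξ]
  have hμ : GrowthLE (fun n => (-(2 * Real.pi * Complex.I * K n ξ))⁻¹) ‖Φ ξ‖ := by
    have h1 : GrowthLE (fun n => (K n ξ)⁻¹) ‖Φ ξ‖ :=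
      GrowthLE.of_isBigO hΦ0.le (hK.inv_bound ξ hξ)
    have h2 := h1.const_mul (-(2 * Real.pi * Complex.I))⁻¹
    refine h2.congr' (Eventually.of_forall fun n => ?_)
    simp only
    rw [← mul_inv, neg_mul]
  have h1 : GrowthLE (fun n => pairing Ψ K r n (q n) (fun z => ((z - ξ) ^ (j + 1))⁻¹) -
      ∑ i ∈ Finset.range j, (taylor ξ (q n)).coeff i *
        levelIntegral Ψ r fun z => ((z - ξ) ^ (j - i + 1))⁻¹ * K n z) θ := by
    refine (hp j hj).sub (GrowthLE.sum fun i hi => ?_)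
    have hi' := Finset.mem_range.mp hi
    have h2 := (ih i hi' (hi'.trans hj)).mul (by positivity) (by positivity)
      (growthLE_levelIntegral_inv_pow h hK hr hξ hrξ (j - i + 1))
    rwa [mul_assoc, mul_inv_cancel₀ hΦ0.ne', mul_one] at h2
  refine (h1.mul hθ hΦ0.le hμ).congr' ?_
  filter_upwards [eventually_ge_atTop (N + 1)] with n hn
  rw [pairing_inv_pow h hK hr hrξ (hq n) hn j, Finset.sum_range_succ, add_sub_cancel_left,
    Nat.sub_self, zero_add, levelIntegral_inv_sub_mul_kernel h hK hr hξ hrξ]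
  have h3 : -(2 * Real.pi * Complex.I * K n ξ) ≠ 0 :=
    neg_ne_zero.mpr (mul_ne_zero Complex.two_pi_I_ne_zero (hK.ne_zero n ξ hξ))
  rw [mul_assoc, mul_inv_cancel₀ h3, mul_one]

lemma pairing_polar (h : ExteriorPair E Φ Ψ) (hK : KernelFamily E Φ K G)
    {r : ℝ} (hr : 1 < r) {ξ : ℂ} (hrξ : r < ‖Φ ξ‖) (n : ℕ) (q : ℂ[X]) (b : ℕ → ℂ) (s : ℕ) :
    pairing Ψ K r n q (polar ξ b s) = ∑ j ∈ Finset.range s,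
      b j * pairing Ψ K r n q (fun z => ((z - ξ) ^ (j + 1))⁻¹) := by
  simp only [pairing, ← ExteriorPair.levelIntegral_const_mul]
  rw [← h.levelIntegral_sum hr]
  · refine h.levelIntegral_congr hr fun z _ _ => ?_
    rw [polar, Finset.mul_sum, Finset.sum_mul]
    exact Finset.sum_congr rfl fun i _ => by ring
  · intro j _ z hz hzr
    have h3 : z - ξ ≠ 0 := by
      intro h0
      rw [sub_eq_zero.mp h0] at hzr
      exact hrξ.ne' hzr
    exact (analyticAt_const.mul (((analyticAt_polynomial q z).mul
      (((analyticAt_id.sub analyticAt_const).pow (j + 1)).inv (pow_ne_zero _ h3))).mul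
        (hK.analytic n z hz))).continuousAt

end

/-! ### Analytic continuation from the decay of the integrals -/

/-- Expansion at infinity, with Cauchy's estimate for the coefficients. -/
lemma exists_expansion_at_infinity {e : ℂ → ℂ} {r r' ε : ℝ} (hr : 0 < r) (hrr' : r < r')
    (he : ∀ w : ℂ, r ≤ ‖w‖ → AnalyticAt ℂ e w) (hε : ∀ w : ℂ, r ≤ ‖w‖ → ‖e w‖ ≤ ε) :
    ∃ a : ℕ → ℂ, (∀ i, ‖a i‖ ≤ ε * r' ^ i) ∧
      ∀ w : ℂ, r' < ‖w‖ → HasSum (fun i => a i * (w ^ i)⁻¹) (e w) := by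
  have hr'0 : 0 < r' := hr.trans hrr'
  set f : ℂ → ℂ := fun x => e x⁻¹ with hf
  have hmem : ∀ x ∈ Metric.ball (0 : ℂ) r⁻¹ \ {0}, r ≤ ‖x⁻¹‖ := by
    intro x hx
    have hx1 : ‖x‖ < r⁻¹ := by simpa using hx.1
    have hx0 : 0 < ‖x‖ := norm_pos_iff.mpr hx.2
    rw [norm_inv]
    exact (le_inv_comm₀ hr hx0).mpr hx1.le
  set g := Function.update f 0 (limUnder (𝓝[≠] 0) f) with hg
  have hgd : DifferentiableOn ℂ g (Metric.ball 0 r⁻¹) := by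
    refine Complex.differentiableOn_update_limUnder_of_bddAbove
      (Metric.ball_mem_nhds _ (inv_pos.mpr hr)) ?_ ⟨ε, ?_⟩
    · intro x hx
      exact (((he _ (hmem x hx)).differentiableAt).comp x
        (differentiableAt_inv hx.2)).differentiableWithinAt
    · rintro _ ⟨x, hx, rfl⟩
      exact hε _ (hmem x hx)
  have hgf : ∀ x ≠ 0, g x = e x⁻¹ := fun x hx => by simp [hg, hf, Function.update_of_ne hx]
  obtain ⟨R, hR⟩ : ∃ R : NNReal, (R : ℝ) = r'⁻¹ := ⟨⟨r'⁻¹, (inv_pos.mpr hr'0).le⟩, rfl⟩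
  have hR0 : 0 < R := by
    rw [← NNReal.coe_pos, hR]; exact inv_pos.mpr hr'0
  have hps := DifferentiableOn.hasFPowerSeriesOnBall (R := R) (c := 0) (f := g)
    (hgd.mono fun x hx => by
      have hx1 : ‖x‖ ≤ r'⁻¹ := by simpa [hR] using hx
      have : r'⁻¹ < r⁻¹ := inv_strictAnti₀ hr hrr'
      simpa using hx1.trans_lt this) hR0
  refine ⟨fun i => (cauchyPowerSeries g 0 R).coeff i, fun i => ?_, fun w hw => ?_⟩
  · have h1 := norm_cauchyPowerSeries_le g 0 R i
    have hRr : |(R : ℝ)|⁻¹ = r' := by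
      rw [hR, abs_of_pos (inv_pos.mpr hr'0), inv_inv]
    have h2 : ∫ θ : ℝ in 0..2 * Real.pi, ‖g (circleMap 0 R θ)‖ ≤ 2 * Real.pi * ε := by
      have h3 : ∀ θ : ℝ, ‖g (circleMap 0 R θ)‖ ≤ ε := by
        intro θ
        have h4 : circleMap 0 (R : ℝ) θ ≠ 0 := by
          simpa using (circleMap_ne_center (c := 0) (θ := θ) (R := (R : ℝ))
            (NNReal.coe_pos.mpr hR0).ne')
        rw [hgf _ h4]
        apply hε
        rw [norm_inv, norm_circleMap_zero, hRr]
        exact hrr'.le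
      have h5 := intervalIntegral.norm_integral_le_of_norm_le_const (a := 0) (b := 2 * Real.pi)
        (f := fun θ => ‖g (circleMap 0 R θ)‖) (C := ε) fun θ _ => by
          rw [norm_norm]; exact h3 θ
      have hπ := Real.pi_pos
      rw [sub_zero, abs_of_pos (by positivity)] at h5
      exact (le_abs_self _).trans (by rw [← Real.norm_eq_abs]; linarith)
    rw [← FormalMultilinearSeries.norm_apply_eq_norm_coef]
    refine h1.trans ?_
    rw [hRr]
    have hπ := Real.pi_pos
    have h6 : (2 * Real.pi)⁻¹ * ∫ θ : ℝ in 0..2 * Real.pi, ‖g (circleMap 0 R θ)‖ ≤ ε := by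
      rw [inv_mul_le_iff₀ (by positivity)]
      exact h2
    gcongr
  · have hw0 : w ≠ 0 := norm_pos_iff.mp (hr'0.trans hw)
    have hwm : w⁻¹ ∈ Metric.eball (0 : ℂ) R := by
      rw [Metric.eball_coe]
      have : ‖w‖⁻¹ < r'⁻¹ := inv_strictAnti₀ hr'0 hw
      simpa [hR] using this
    have h1 := hps.hasSum hwm
    rw [zero_add, hgf _ (inv_ne_zero hw0), inv_inv] at h1
    refine h1.congr_fun ?_
    intro i
    rw [FormalMultilinearSeries.apply_eq_pow_smul_coeff, smul_eq_mul, inv_pow, mul_comm]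

lemma hasSum_circleIntegral {r : ℝ} (hr : 0 ≤ r) {f : ℕ → ℂ → ℂ} {F : ℂ → ℂ} {b : ℕ → ℝ}
    (hf : ∀ i, ContinuousOn (f i) (Metric.sphere 0 r)) (hb : Summable b)
    (hfb : ∀ i, ∀ w ∈ Metric.sphere (0 : ℂ) r, ‖f i w‖ ≤ b i)
    (hF : ∀ w ∈ Metric.sphere (0 : ℂ) r, HasSum (fun i => f i w) (F w)) :
    HasSum (fun i => ∮ w in C(0, r), f i w) (∮ w in C(0, r), F w) := by
  have h1 : TendstoUniformlyOn (fun t : Finset ℕ => fun w => ∑ i ∈ t, f i w) F atTop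
      (Metric.sphere 0 r) :=
    (tendstoUniformlyOn_tsum hb hfb).congr_right fun w hw => (hF w hw).tsum_eq
  have h2 := h1.tendsto_circleIntegral_of_continuousOn hr
    (Eventually.of_forall fun t => continuousOn_finsetSum t fun i _ => hf i)
  refine h2.congr fun t => ?_
  exact circleIntegral.integral_fun_sum fun i _ => (hf i).circleIntegrable hr

/-- A perturbation argument in place of inverting an asymptotically triangular system: each step
halves the coefficient of the slower geometric sequence. -/
lemma le_of_perturbed_bound {v : ℕ → ℝ} (hv : ∀ n, 0 ≤ v n) {A M a b r ε : ℝ} {n₀ : ℕ}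
    (ha : 0 ≤ a) (hb : 0 ≤ b) (hr : 0 ≤ r) (hε : 0 ≤ ε) (hM : 0 ≤ M)
    (hra : r * a < 1) (hrb : r * b < 1)
    (hεa : ε * (1 - r * a)⁻¹ ≤ 1 / 2) (hεb : ε * (1 - r * b)⁻¹ ≤ 1 / 2)
    (hvA : ∀ n ≥ n₀, v n ≤ A * a ^ n)
    (hrec : ∀ n ≥ n₀, v n ≤ M * b ^ n + ε * ∑' i, r ^ i * v (n + i)) :
    ∀ n ≥ n₀, v n ≤ 2 * M * b ^ n := by
  have hA : 0 ≤ A * a ^ n₀ := (hv n₀).trans (hvA n₀ le_rfl)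
  have key : ∀ k : ℕ, ∀ n ≥ n₀, v n ≤ A / 2 ^ k * a ^ n + 2 * M * b ^ n := by
    intro k
    induction k with
    | zero =>
      intro n hn
      have := hvA n hn
      have h2 : 0 ≤ 2 * M * b ^ n := by positivity
      simpa using this.trans (by linarith)
    | succ k ih =>
      intro n hn
      have hsa : HasSum (fun i : ℕ => A / 2 ^ k * a ^ n * (r * a) ^ i)
          (A / 2 ^ k * a ^ n * (1 - r * a)⁻¹) :=
        (hasSum_geometric_of_lt_one (by positivity) hra).mul_left _
      have hsb : HasSum (fun i : ℕ => 2 * M * b ^ n * (r * b) ^ i)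
          (2 * M * b ^ n * (1 - r * b)⁻¹) :=
        (hasSum_geometric_of_lt_one (by positivity) hrb).mul_left _
      have hle : ∀ i, r ^ i * v (n + i) ≤
          A / 2 ^ k * a ^ n * (r * a) ^ i + 2 * M * b ^ n * (r * b) ^ i := by
        intro i
        calc r ^ i * v (n + i)
            ≤ r ^ i * (A / 2 ^ k * a ^ (n + i) + 2 * M * b ^ (n + i)) := by
              gcongr
              exact ih (n + i) (by omega)
          _ = _ := by ring
      have hsum : Summable fun i => r ^ i * v (n + i) :=
        Summable.of_nonneg_of_le (fun i => mul_nonneg (by positivity) (hv _)) hle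
          (hsa.add hsb).summable
      have h2 : ∑' i, r ^ i * v (n + i) ≤
          A / 2 ^ k * a ^ n * (1 - r * a)⁻¹ + 2 * M * b ^ n * (1 - r * b)⁻¹ :=
        hasSum_le hle hsum.hasSum (hsa.add hsb)
      have h3 := hrec n hn
      have hAa : 0 ≤ A / 2 ^ k * a ^ n := by
        have : A / 2 ^ k * a ^ n = (A * a ^ n₀) * a ^ (n - n₀) / 2 ^ k := by
          rw [mul_assoc, ← pow_add, Nat.add_sub_cancel' hn]; ring
        rw [this]
        positivity
      have h4 : 0 ≤ 2 * M * b ^ n := by positivity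
      calc v n ≤ M * b ^ n + ε * (A / 2 ^ k * a ^ n * (1 - r * a)⁻¹ +
            2 * M * b ^ n * (1 - r * b)⁻¹) := h3.trans (by gcongr)
        _ = M * b ^ n + ((A / 2 ^ k * a ^ n) * (ε * (1 - r * a)⁻¹) +
            (2 * M * b ^ n) * (ε * (1 - r * b)⁻¹)) := by ring
        _ ≤ M * b ^ n + ((A / 2 ^ k * a ^ n) * (1 / 2) + (2 * M * b ^ n) * (1 / 2)) := by gcongr
        _ = _ := by rw [pow_succ]; ring
  intro n hn
  have hlim : Tendsto (fun k : ℕ => A / 2 ^ k * a ^ n + 2 * M * b ^ n) atTop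
      (𝓝 (0 * a ^ n + 2 * M * b ^ n)) := by
    refine Tendsto.add_const _ (Tendsto.mul_const _ ?_)
    exact tendsto_const_nhds.div_atTop (tendsto_pow_atTop_atTop_of_one_lt one_lt_two)
  rw [zero_mul, zero_add] at hlim
  exact ge_of_tendsto' hlim fun k => key k n hn

section

variable {E : Set ℂ} {Φ Ψ : ℂ → ℂ} {K : ℕ → ℂ → ℂ} {G : ℂ → ℂ}

/-- The integrals against `K n` and against their leading terms `1 / (G Φ ^ (n + 1))` decay at the
same rate. -/
lemma growthLE_laurent_of_growthLE (h : ExteriorPair E Φ Ψ) (hK : KernelFamily E Φ K G)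
    {r₀ κ : ℝ} (hr₀ : 1 < r₀) (hκ : 1 < κ) {H : ℂ → ℂ}
    (hH : ∀ z ∉ E, ‖Φ z‖ = r₀ → ContinuousAt H z)
    (ht : GrowthLE (fun n => levelIntegral Ψ r₀ fun z => H z * K n z) κ⁻¹) :
    GrowthLE (fun n => ∮ w in C(0, r₀), H (Ψ w) * deriv Ψ w / G (Ψ w) * (w ^ (n + 1))⁻¹) κ⁻¹ := by
  have hr₀0 : 0 < r₀ := by linarith
  set f : ℂ → ℂ := fun w => H (Ψ w) * deriv Ψ w / G (Ψ w) with hf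
  set u : ℕ → ℂ := fun n => ∮ w in C(0, r₀), f w * (w ^ (n + 1))⁻¹ with hu
  have hsph : ∀ w ∈ Metric.sphere (0 : ℂ) r₀, 1 < ‖w‖ ∧ w ≠ 0 ∧ ‖w‖ = r₀ := fun w hw => by
    have hw' : ‖w‖ = r₀ := mem_sphere_zero_iff_norm.mp hw
    exact ⟨hw' ▸ hr₀, norm_pos_iff.mp (hw' ▸ hr₀0), hw'⟩
  have hfc : ContinuousOn f (Metric.sphere 0 r₀) := by
    refine ((h.continuousOn_comp_inv_sphere hr₀ hH).mul
      (h.continuousOn_deriv_inv_sphere hr₀)).div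
      (h.continuousOn_comp_inv_sphere hr₀ fun z hz _ => (hK.analytic_lim z hz).continuousAt)
      fun w hw => hK.ne_zero_lim _ (h.inv_notMem w (hsph w hw).1)
  have hfi : ∀ k : ℕ, ContinuousOn (fun w => f w * (w ^ k)⁻¹) (Metric.sphere 0 r₀) := fun k =>
    hfc.mul ((continuousOn_id.pow k).inv₀ fun w hw => pow_ne_zero _ (hsph w hw).2.1)
  obtain ⟨B, hB⟩ := (isCompact_sphere (0 : ℂ) r₀).exists_bound_of_continuousOn hfc
  have hB0 : 0 ≤ B := (norm_nonneg _).trans (hB (r₀ : ℂ) (by simp [hr₀0.le]))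
  have hu0 : ∀ n, ‖u n‖ ≤ 2 * Real.pi * B * r₀⁻¹ ^ n := by
    intro n
    have := circleIntegral.norm_integral_le_of_norm_le_const (c := 0) (R := r₀)
      (f := fun w => f w * (w ^ (n + 1))⁻¹) (C := B * (r₀ ^ (n + 1))⁻¹) hr₀0.le fun w hw => by
        rw [norm_mul, norm_inv, norm_pow, (hsph w hw).2.2]
        have := hB w hw
        gcongr
    refine this.trans (le_of_eq ?_)
    rw [inv_pow, pow_succ]
    field_simp
  intro η₀ hη₀
  have hκ0 : 0 < κ := by linarith
  obtain ⟨r', hr'1, hr'2⟩ := exists_between (lt_min hr₀ hκ)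
  obtain ⟨r, hr1, hr2⟩ := exists_between hr'1
  rw [lt_min_iff] at hr'2
  have hr'0 : 0 < r' := by linarith
  obtain ⟨η, hη1, hη2⟩ := exists_between (lt_min hη₀ (inv_strictAnti₀ hr'0 hr'2.2))
  rw [lt_min_iff] at hη2
  have hη0 : 0 < η := (inv_pos.mpr hκ0).trans hη1
  have hra : r' * r₀⁻¹ < 1 := by
    rw [← div_eq_mul_inv, div_lt_one hr₀0]; exact hr'2.1
  have hrb : r' * η < 1 := by
    have := mul_lt_mul_of_pos_left hη2.2 hr'0
    rwa [mul_inv_cancel₀ hr'0.ne'] at this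
  have hda : 0 < 1 - r' * r₀⁻¹ := by linarith
  have hdb : 0 < 1 - r' * η := by linarith
  set ε := min ((1 - r' * r₀⁻¹) / 2) ((1 - r' * η) / 2) with hε
  have hε0 : 0 < ε := by positivity
  obtain ⟨M, hM, hMb⟩ := (ht η hη1).exists_pos
  obtain ⟨n₀, hn₀⟩ := eventually_atTop.mp (hMb.bound.and (hK.uniform r hr1 ε hε0))
  have hmain : ∀ n ≥ n₀, ‖u n‖ ≤ 2 * M * η ^ n := by
    refine le_of_perturbed_bound (v := fun n => ‖u n‖) (A := 2 * Real.pi * B) (M := M)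
      (a := r₀⁻¹) (b := η) (r := r') (ε := ε) (n₀ := n₀)
      (fun n => norm_nonneg _) (by positivity) hη0.le hr'0.le hε0.le hM.le hra hrb ?_ ?_
      (fun n _ => hu0 n) ?_
    · rw [← div_eq_mul_inv, div_le_iff₀ hda]
      linarith [min_le_left ((1 - r' * r₀⁻¹) / 2) ((1 - r' * η) / 2)]
    · rw [← div_eq_mul_inv, div_le_iff₀ hdb]
      linarith [min_le_right ((1 - r' * r₀⁻¹) / 2) ((1 - r' * η) / 2)]
    intro n hn
    obtain ⟨h1, h2⟩ := hn₀ n hn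
    set e : ℂ → ℂ := fun w => G (Ψ w) * K n (Ψ w) * w ^ (n + 1) - 1 with he
    obtain ⟨a, ha, hsum⟩ := exists_expansion_at_infinity (e := e) (r := r) (r' := r') (ε := ε)
      (by linarith) hr2 (fun w hw => by
        have hw1 : 1 < ‖w‖ := hr1.trans_le hw
        have hΨ := h.analytic_inv w hw1
        have hmem := h.inv_notMem w hw1
        exact ((((hK.analytic_lim _ hmem).comp hΨ).mul ((hK.analytic n _ hmem).comp hΨ)).mul
          (analyticAt_id.pow (n + 1))).sub analyticAt_const) (fun w hw => by
        have hw1 : 1 < ‖w‖ := hr1.trans_le hw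
        have := h2 (Ψ w) (h.inv_notMem w hw1) (by rwa [h.right_inv w hw1])
        rwa [h.right_inv w hw1] at this)
    -- The integral over the level curve minus the Laurent coefficient, expanded termwise.
    have hseries : HasSum (fun i => a i * u (n + i))
        (levelIntegral Ψ r₀ (fun z => H z * K n z) - u n) := by
      have h3 := hasSum_circleIntegral (r := r₀) hr₀0.le
        (f := fun i w => a i * (f w * (w ^ (n + i + 1))⁻¹))
        (F := fun w => f w * (w ^ (n + 1))⁻¹ * e w)
        (b := fun i => ε * B * (r₀ ^ (n + 1))⁻¹ * (r' * r₀⁻¹) ^ i)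
        (fun i => continuousOn_const.mul (hfi _))
        ((summable_geometric_of_lt_one (by positivity) hra).mul_left _)
        (fun i w hw => by
          rw [norm_mul, norm_mul, norm_inv, norm_pow, (hsph w hw).2.2]
          calc ‖a i‖ * (‖f w‖ * (r₀ ^ (n + i + 1))⁻¹)
              ≤ (ε * r' ^ i) * (B * (r₀ ^ (n + i + 1))⁻¹) := by
                have := ha i
                have := hB w hw
                gcongr
            _ = _ := by
                rw [mul_pow, inv_pow, show n + i + 1 = (n + 1) + i by ring, pow_add _ (n + 1)]
                field_simp)
        (fun w hw => by
          have h4 := (hsum w (by rw [(hsph w hw).2.2]; exact hr'2.1)).mul_left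
            (f w * (w ^ (n + 1))⁻¹)
          refine h4.congr_fun fun i => ?_
          have := (hsph w hw).2.1
          rw [show n + i + 1 = (n + 1) + i by ring, pow_add _ (n + 1), mul_inv]
          ring)
      simp only [circleIntegral.integral_const_mul] at h3
      have h5 : (∮ w in C(0, r₀), f w * (w ^ (n + 1))⁻¹ * e w) =
          levelIntegral Ψ r₀ (fun z => H z * K n z) - u n := by
        rw [levelIntegral, hu, ← circleIntegral.integral_sub]
        · refine circleIntegral.integral_congr hr₀0.le fun w hw => ?_
          have h6 := (hsph w hw).2.1
          have h7 := hK.ne_zero_lim _ (h.inv_notMem w (hsph w hw).1)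
          simp only [hf, he]
          field_simp
        · exact h.circleIntegrable hr₀ fun z hz hzr =>
            (hH z hz hzr).mul (hK.analytic n z hz).continuousAt
        · exact (hfi (n + 1)).circleIntegrable hr₀0.le
      rw [← h5]
      exact h3
    have hnorm : ∀ i, ‖a i * u (n + i)‖ ≤ ε * (r' ^ i * ‖u (n + i)‖) := by
      intro i
      rw [norm_mul, ← mul_assoc]
      gcongr
      exact ha i
    have hsummable : Summable fun i => r' ^ i * ‖u (n + i)‖ := by
      refine Summable.of_nonneg_of_le (fun i => by positivity) (fun i => ?_)
        ((summable_geometric_of_lt_one (by positivity) hra).mul_left (2 * Real.pi * B * r₀⁻¹ ^ n))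
      calc r' ^ i * ‖u (n + i)‖ ≤ r' ^ i * (2 * Real.pi * B * r₀⁻¹ ^ (n + i)) := by
            gcongr
            exact hu0 _
        _ = _ := by rw [mul_pow, pow_add]; ring
    have h8 : ‖levelIntegral Ψ r₀ (fun z => H z * K n z) - u n‖ ≤
        ε * ∑' i, r' ^ i * ‖u (n + i)‖ := by
      rw [← hseries.tsum_eq, ← tsum_mul_left]
      exact tsum_of_norm_bounded (hsummable.mul_left ε).hasSum hnorm
    rw [Real.norm_of_nonneg (by positivity)] at h1
    calc ‖u n‖ ≤ ‖levelIntegral Ψ r₀ (fun z => H z * K n z)‖ +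
          ‖levelIntegral Ψ r₀ (fun z => H z * K n z) - u n‖ := by
            have := norm_sub_le (levelIntegral Ψ r₀ (fun z => H z * K n z))
              (levelIntegral Ψ r₀ (fun z => H z * K n z) - u n)
            rwa [sub_sub_cancel] at this
      _ ≤ _ := add_le_add h1 h8
  refine Asymptotics.IsBigO.of_bound (2 * M) ?_
  filter_upwards [eventually_ge_atTop n₀] with n hn
  refine (hmain n hn).trans ?_
  rw [Real.norm_of_nonneg (pow_nonneg (hη0.trans hη2.1).le n)]
  have := hη2.1.le
  gcongr

lemma analyticAt_powerSeries {u : ℕ → ℂ} {κ : ℝ} (hκ : 0 < κ) (hu : GrowthLE u κ⁻¹) {w : ℂ}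
    (hw : ‖w‖ < κ) : AnalyticAt ℂ (fun w => ∑' n, w ^ n * u n) w := by
  obtain ⟨s, hs1, hs2⟩ := exists_between hw
  have hs0 : 0 < s := (norm_nonneg w).trans_lt hs1
  obtain ⟨η, hη1, hη2⟩ := exists_between (inv_strictAnti₀ hs0 hs2)
  have hη0 : 0 < η := (inv_pos.mpr hκ).trans hη1
  have hsη : s * η < 1 := by
    have := mul_lt_mul_of_pos_left hη2 hs0
    rwa [mul_inv_cancel₀ hs0.ne'] at this
  have hsum : Summable fun n => s ^ n * ‖u n‖ := by
    have hO : (fun n => s ^ n * ‖u n‖) =O[atTop] fun n => (s * η) ^ n := by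
      simp only [mul_pow]
      exact (Asymptotics.isBigO_refl (fun n => s ^ n) atTop).mul (hu η hη1).norm_left
    exact summable_of_isBigO_nat (summable_geometric_of_lt_one (by positivity) hsη) hO
  have hd := Complex.differentiableOn_tsum_of_summable_norm (F := fun n w => w ^ n * u n)
    (U := Metric.ball (0 : ℂ) s) hsum
    (fun n => by fun_prop) Metric.isOpen_ball (fun n v hv => by
      rw [norm_mul, norm_pow]
      have : ‖v‖ ≤ s := by
        have : ‖v‖ < s := by simpa using hv
        exact this.le
      gcongr)
  exact (hd.analyticOnNhd Metric.isOpen_ball) w (by simpa using hs1)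

/-- The converse to the decay of the integrals `∮ H K_n`: if they decay at the rate `1 / κ`, then
`H` extends analytically to the canonical domain of index `κ`. -/
theorem exists_extension_of_growthLE (h : ExteriorPair E Φ Ψ) (hK : KernelFamily E Φ K G)
    {r₀ ρ₀ κ : ℝ} (hr₀ : 1 < r₀) (hrρ : r₀ < ρ₀) (hκ : 1 < κ) {H : ℂ → ℂ}
    (hH : AnalyticOnNhd ℂ H (canonicalDomain E Φ ρ₀))
    (ht : GrowthLE (fun n => levelIntegral Ψ r₀ fun z => H z * K n z) κ⁻¹) :
    ∃ H' : ℂ → ℂ, AnalyticOnNhd ℂ H' (canonicalDomain E Φ κ) ∧ H' =ᶠ[𝓝ˢ E] H := by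
  classical
  have hr₀0 : 0 < r₀ := by linarith
  have hH' : ∀ z ∉ E, ‖Φ z‖ < ρ₀ → AnalyticAt ℂ H z := fun z _ hz =>
    hH z (mem_canonicalDomain.mpr fun _ => hz)
  have hu := growthLE_laurent_of_growthLE h hK hr₀ hκ
    (fun z hz hzr => (hH' z hz (hzr ▸ hrρ)).continuousAt) ht
  set f : ℂ → ℂ := fun w => H (Ψ w) * deriv Ψ w / G (Ψ w) with hf
  set u : ℕ → ℂ := fun n => ∮ w in C(0, r₀), f w * (w ^ (n + 1))⁻¹ with hudef
  have hfa : ∀ w : ℂ, 1 < ‖w‖ → ‖w‖ < ρ₀ → AnalyticAt ℂ f w := by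
    intro w hw hwρ
    have hmem := h.inv_notMem w hw
    have hΨ := h.analytic_inv w hw
    exact (((hH' _ hmem (by rwa [h.right_inv w hw])).comp hΨ).mul hΨ.deriv).div
      ((hK.analytic_lim _ hmem).comp hΨ) (hK.ne_zero_lim _ hmem)
  obtain ⟨r, hr1, hr2⟩ := exists_between hr₀
  obtain ⟨r₁, hr₁1, hr₁2⟩ := exists_between hr1
  have hr₁0 : 0 < r₁ := by linarith
  have hfcont : ∀ s : ℝ, 1 < s → s < ρ₀ → ContinuousOn f (Metric.sphere 0 s) := by
    intro s hs hsρ w hw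
    have hw' : ‖w‖ = s := mem_sphere_zero_iff_norm.mp hw
    exact (hfa w (hw' ▸ hs) (hw' ▸ hsρ)).continuousAt.continuousWithinAt
  set U : ℂ → ℂ := fun w => ∑' n, w ^ n * u n with hU
  set V : ℂ → ℂ := fun w => ∮ v in C(0, r₁), f v / (v - w) with hV
  have hVd : ∀ w : ℂ, ‖w‖ ≠ r₁ → DifferentiableAt ℂ V w := fun w hw =>
    differentiableAt_cauchyTransform (ψ := fun v => v) hr₁0.le (hfcont r₁ hr₁1 (by linarith))
      continuousOn_id fun v hv hvw => hw (by
        rw [← hvw]; exact mem_sphere_zero_iff_norm.mp hv)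
  have hUV : ∀ w : ℂ, r₁ < ‖w‖ → ‖w‖ < r₀ → U w - V w = 2 * Real.pi * Complex.I * f w := by
    intro w hw1 hw2
    rw [← cauchy_annulus (f := f) hr₁0 (fun v hv1 hv2 => hfa v (hr₁1.trans_le hv1)
      (hv2.trans_lt hrρ)) hw1 hw2]
    congr 1
    have h1 := hasSum_two_pi_I_cauchyPowerSeries_integral (c := 0) (w := w)
      ((hfcont r₀ hr₀ hrρ).circleIntegrable hr₀0.le) hw2
    have h2 : ∀ n : ℕ, (∮ z in C(0, r₀), (w / (z - 0)) ^ n • (z - 0)⁻¹ • f z) = w ^ n * u n := by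
      intro n
      rw [hudef, ← circleIntegral.integral_const_mul]
      refine circleIntegral.integral_congr hr₀0.le fun z _ => ?_
      simp only [sub_zero, smul_eq_mul, div_pow, pow_succ, mul_inv]
      ring
    simp only [h2] at h1
    rw [hU]
    simp only
    rw [h1.tsum_eq]
    refine circleIntegral.integral_congr hr₀0.le fun z _ => ?_
    simp only [zero_add, smul_eq_mul]
    rw [inv_mul_eq_div]
  set W : ℂ → ℂ := fun z =>
    (2 * Real.pi * Complex.I)⁻¹ * (U (Φ z) - V (Φ z)) * G z * deriv Φ z with hW
  have hWH : ∀ z ∉ E, r₁ < ‖Φ z‖ → ‖Φ z‖ < r₀ → W z = H z := by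
    intro z hz hz1 hz2
    have h3 := h.deriv_mul_deriv (h.one_lt z hz)
    rw [h.left_inv z hz] at h3
    have h4 := hK.ne_zero_lim z hz
    have h5 := Complex.two_pi_I_ne_zero
    simp only [hW]
    rw [hUV _ hz1 hz2, inv_mul_cancel_left₀ h5]
    simp only [hf, h.left_inv z hz]
    rw [div_mul_cancel₀ _ h4, mul_assoc, mul_comm (deriv Ψ _), h3, mul_one]
  have hWd : ∀ z ∉ E, r₁ < ‖Φ z‖ → ‖Φ z‖ < κ → DifferentiableAt ℂ W z := by
    intro z hz hz1 hz2
    have hΦ := (h.analytic z hz)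
    have h6 : DifferentiableAt ℂ (fun z => U (Φ z)) z :=
      (analyticAt_powerSeries (by linarith) hu hz2).differentiableAt.comp z hΦ.differentiableAt
    have h7 : DifferentiableAt ℂ (fun z => V (Φ z)) z :=
      (hVd _ hz1.ne').comp z hΦ.differentiableAt
    exact (((h6.sub h7).const_mul _).mul (hK.analytic_lim z hz).differentiableAt).mul
      hΦ.deriv.differentiableAt
  refine ⟨fun z => if z ∈ canonicalDomain E Φ r then H z else W z, ?_, ?_⟩
  · refine DifferentiableOn.analyticOnNhd (fun z hz => ?_) (h.isOpen_canonicalDomain hκ)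
    apply DifferentiableAt.differentiableWithinAt
    by_cases hzr : z ∈ canonicalDomain E Φ r
    · refine (hH z (canonicalDomain_mono (by linarith) hzr)).differentiableAt.congr_of_eventuallyEq ?_
      filter_upwards [(h.isOpen_canonicalDomain hr1).mem_nhds hzr] with y hy using if_pos hy
    · have hz' : z ∉ E ∧ r ≤ ‖Φ z‖ := by
        rw [mem_canonicalDomain] at hzr
        push Not at hzr
        exact hzr
      have hz1 : z ∈ {z | z ∉ E ∧ r₁ < ‖Φ z‖} := ⟨hz'.1, hr₁2.trans_le hz'.2⟩
      refine (hWd z hz'.1 hz1.2 (mem_canonicalDomain.mp hz hz'.1)).congr_of_eventuallyEq ?_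
      filter_upwards [(h.isOpen_exterior r₁).mem_nhds hz1] with y hy
      split_ifs with hyr
      · exact (hWH y hy.1 hy.2 ((mem_canonicalDomain.mp hyr hy.1).trans hr2)).symm
      · rfl
  · exact h.eventually_of_canonicalDomain hr1 fun z hz => if_pos hz

end

/-! ### Principal parts -/

/-- Division by a power of `z - ξ` splits off a principal part; the remainder is analytic wherever
the numerator is. -/
lemma exists_principal_part {A : ℂ → ℂ} {ξ : ℂ} (hA : AnalyticAt ℂ A ξ) (k : ℕ) :
    ∃ (b : ℕ → ℂ) (B : ℂ → ℂ), (∀ z, AnalyticAt ℂ A z → AnalyticAt ℂ B z) ∧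
      (∀ z, z ≠ ξ → A z * ((z - ξ) ^ k)⁻¹ = B z + polar ξ b k z) ∧ (1 ≤ k → b (k - 1) = A ξ) := by
  induction k with
  | zero => exact ⟨0, A, fun z hz => hz, fun z _ => by simp [polar], by simp⟩
  | succ k ih =>
    obtain ⟨b, B, hB, hBb, hb⟩ := ih
    refine ⟨fun j => if j = 0 then B ξ else b (j - 1), dslope B ξ,
      fun z hz => AnalyticAt.dslope_of (hB ξ hA) (hB z hz), fun z hz => ?_, fun _ => ?_⟩
    · have hz' := sub_ne_zero.mpr hz
      have h1 : A z * ((z - ξ) ^ (k + 1))⁻¹ = (A z * ((z - ξ) ^ k)⁻¹) * (z - ξ)⁻¹ := by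
        rw [pow_succ, mul_inv, mul_assoc]
      rw [h1, hBb z hz, dslope_of_ne _ hz, slope_def_field, polar, polar, Finset.sum_range_succ']
      simp only [Nat.add_eq_zero_iff, one_ne_zero, and_false, if_false, if_true,
        Nat.add_sub_cancel, zero_add, pow_one]
      rw [add_mul, Finset.sum_mul]
      have h2 : ∀ j ∈ Finset.range k, b j * ((z - ξ) ^ (j + 1))⁻¹ * (z - ξ)⁻¹ =
          b j * ((z - ξ) ^ (j + 1 + 1))⁻¹ := fun j _ => by
        rw [mul_assoc, ← mul_inv, ← pow_succ]
      rw [Finset.sum_congr rfl h2]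
      ring
    · rcases Nat.eq_zero_or_pos k with rfl | hk
      · have h4 : A =ᶠ[𝓝[≠] ξ] B := by
          filter_upwards [self_mem_nhdsWithin] with z hz
          simpa [polar] using hBb z hz
        have h5 := (hA.continuousAt.eventuallyEq_nhds_iff_eventuallyEq_nhdsNE
          (hB ξ hA).continuousAt).mp h4
        simpa using h5.self_of_nhds.symm
      · have : k ≠ 0 := hk.ne'
        simp [this, hb hk]

/-- Near `E`, the function `g` is the sum of a function analytic in the canonical domain of index
`ρ` and the principal part `polar ξ b s`. -/
def SplitsOn (E : Set ℂ) (Φ : ℂ → ℂ) (ρ : ℝ) (ξ : ℂ) (b : ℕ → ℂ) (s : ℕ) (g : ℂ → ℂ) : Prop :=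
  ∃ F : ℂ → ℂ, AnalyticOnNhd ℂ F (canonicalDomain E Φ ρ) ∧
    g =ᶠ[𝓝ˢ E] fun z => F z + polar ξ b s z

section

variable {E : Set ℂ} {Φ Ψ : ℂ → ℂ}

lemma SplitsOn.mono {ρ ρ' : ℝ} (hρ : ρ' ≤ ρ) {ξ : ℂ} {b : ℕ → ℂ} {s : ℕ} {g : ℂ → ℂ}
    (h : SplitsOn E Φ ρ ξ b s g) : SplitsOn E Φ ρ' ξ b s g := by
  obtain ⟨F, hF, hg⟩ := h
  exact ⟨F, fun z hz => hF z (canonicalDomain_mono hρ hz), hg⟩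

lemma polar_eq_zpow_mul {ξ z : ℂ} (hz : z ≠ ξ) (b : ℕ → ℂ) {s : ℕ} :
    polar ξ b s z = (z - ξ) ^ (-(s : ℤ)) *
      ∑ j ∈ Finset.range s, b j * (z - ξ) ^ (s - 1 - j) := by
  have hz' := sub_ne_zero.mpr hz
  rw [polar, Finset.mul_sum]
  refine Finset.sum_congr rfl fun j hj => ?_
  have hj' := Finset.mem_range.mp hj
  have h1 : (z - ξ) ^ s = (z - ξ) ^ (s - 1 - j) * (z - ξ) ^ (j + 1) := by
    rw [← pow_add]; congr 1; omega
  rw [zpow_neg, zpow_natCast, h1]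
  field_simp

/-- The sum of an analytic function and a principal part has a pole of the expected order. -/
lemma meromorphicOrderAt_add_polar {F : ℂ → ℂ} {ξ : ℂ} (hF : AnalyticAt ℂ F ξ) {b : ℕ → ℂ} {s : ℕ}
    (hs : 1 ≤ s) (hb : b (s - 1) ≠ 0) :
    MeromorphicAt (fun z => F z + polar ξ b s z) ξ ∧
      meromorphicOrderAt (fun z => F z + polar ξ b s z) ξ = ((-(s : ℤ) : ℤ) : WithTop ℤ) := by
  have hlin : AnalyticAt ℂ (fun z => z - ξ) ξ := analyticAt_id.sub analyticAt_const
  have hmer : MeromorphicAt (fun z => F z + polar ξ b s z) ξ := by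
    refine hF.meromorphicAt.add ?_
    unfold polar
    refine MeromorphicAt.fun_sum fun j _ => (MeromorphicAt.const _ _).mul ?_
    exact (hlin.meromorphicAt.pow (j + 1)).inv
  refine ⟨hmer, (meromorphicOrderAt_eq_int_iff hmer).mpr
    ⟨fun z => F z * (z - ξ) ^ s + ∑ j ∈ Finset.range s, b j * (z - ξ) ^ (s - 1 - j), ?_, ?_, ?_⟩⟩
  · exact (hF.mul (hlin.pow s)).add (Finset.analyticAt_fun_sum _ fun j _ =>
      analyticAt_const.mul (hlin.pow _))
  · obtain ⟨t, rfl⟩ : ∃ t, s = t + 1 := ⟨s - 1, by omega⟩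
    have : ∑ j ∈ Finset.range (t + 1), b j * (ξ - ξ) ^ (t + 1 - 1 - j) = b t := by
      rw [Finset.sum_range_succ, Finset.sum_eq_zero]
      · simp
      · intro j hj
        have := Finset.mem_range.mp hj
        rw [sub_self, zero_pow (by omega), mul_zero]
    simp only [this]
    simpa using hb
  · filter_upwards [self_mem_nhdsWithin] with z hz
    have hz' := sub_ne_zero.mpr (show z ≠ ξ from hz)
    rw [polar_eq_zpow_mul hz, smul_eq_mul, mul_add]
    congr 1
    rw [zpow_neg, zpow_natCast]
    field_simp

/-- Analyticity on the closure of a canonical domain extends to a slightly larger one, by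
compactness. -/
lemma HasOnlyPole.exists_splitsOn (h : ExteriorPair E Φ Ψ) {ξ : ℂ} {s : ℕ} (hs : 1 ≤ s)
    {g : ℂ → ℂ} (hg : HasOnlyPole E Φ ξ s g) :
    ∃ ρ > ‖Φ ξ‖, ∃ b : ℕ → ℂ, b (s - 1) ≠ 0 ∧ SplitsOn E Φ ρ ξ b s g := by
  classical
  obtain ⟨hξ, F, hFg, hFan, hFm, hord⟩ := hg
  obtain ⟨A, hA, hA0, hFA⟩ := (meromorphicOrderAt_eq_int_iff hFm).mp hord
  obtain ⟨b, B, hB, hBb, hbs⟩ := exists_principal_part hA s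
  have hξ1 := h.one_lt ξ hξ
  set F₀ : ℂ → ℂ := fun z => if z = ξ then B ξ else F z - polar ξ b s z with hF₀
  have hF₀an : ∀ z ∈ closure (canonicalDomain E Φ ‖Φ ξ‖), AnalyticAt ℂ F₀ z := by
    intro z hz
    by_cases hzξ : z = ξ
    · subst hzξ
      refine (hB z hA).congr ?_
      have h1 := eventually_nhdsWithin_iff.mp hFA
      filter_upwards [h1] with y hy
      by_cases hyz : y = z
      · simp [hF₀, hyz]
      · have h2 := hBb y hyz
        simp only [hF₀, if_neg hyz]
        rw [hy hyz, smul_eq_mul, zpow_neg, zpow_natCast, mul_comm, h2]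
        ring
    · refine ((hFan z hz hzξ).sub (analyticAt_polar hzξ b s)).congr ?_
      filter_upwards [isOpen_ne.mem_nhds hzξ] with y hy
      simp only [hF₀, if_neg hy]
      rfl
  obtain ⟨ρ, hρ, hsub⟩ := h.exists_canonicalDomain_subset (isOpen_analyticAt ℂ F₀) (ρ := ‖Φ ξ‖)
    fun z hz => hF₀an z (by rw [h.closure_canonicalDomain]; exact hz)
  refine ⟨ρ, hρ, b, by rwa [hbs hs], F₀, fun z hz => hsub hz, ?_⟩
  have h3 : ∀ᶠ z in 𝓝ˢ E, z ≠ ξ := h.eventually_of_canonicalDomain hξ1 fun z hz hzξ => by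
    subst hzξ
    exact lt_irrefl _ (mem_canonicalDomain.mp hz hξ)
  filter_upwards [hFg, h3] with z hz hzξ
  simp only [hF₀, if_neg hzξ, ← hz]
  ring

lemma SplitsOn.hasOnlyPole (h : ExteriorPair E Φ Ψ) {ξ : ℂ} (hξ : ξ ∉ E) {s : ℕ} (hs : 1 ≤ s)
    {b : ℕ → ℂ} (hb : b (s - 1) ≠ 0) {ρ : ℝ} (hρ : ‖Φ ξ‖ < ρ) {g : ℂ → ℂ}
    (hg : SplitsOn E Φ ρ ξ b s g) : HasOnlyPole E Φ ξ s g := by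
  obtain ⟨F, hF, hgF⟩ := hg
  have hmem : ξ ∈ canonicalDomain E Φ ρ := mem_canonicalDomain.mpr fun _ => hρ
  obtain ⟨h1, h2⟩ := meromorphicOrderAt_add_polar (hF ξ hmem) hs hb
  refine ⟨hξ, _, hgF.symm, fun z hz hzξ => (hF z ?_).add (analyticAt_polar hzξ b s), h1, h2⟩
  rw [h.closure_canonicalDomain] at hz
  exact mem_canonicalDomain.mpr fun hzE => (hz hzE).trans_lt hρ

lemma SplitsOn.extendsWithPoles {ξ : ℂ} {s : ℕ} (hs : 1 ≤ s)
    {b : ℕ → ℂ} (hb : b (s - 1) ≠ 0) {ρ : ℝ} (hρ : ‖Φ ξ‖ < ρ) {g : ℂ → ℂ}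
    (hg : SplitsOn E Φ ρ ξ b s g) : ExtendsWithPoles E Φ g s ρ := by
  obtain ⟨F, hF, hgF⟩ := hg
  have hmem : ξ ∈ canonicalDomain E Φ ρ := mem_canonicalDomain.mpr fun _ => hρ
  obtain ⟨h1, h2⟩ := meromorphicOrderAt_add_polar (hF ξ hmem) hs hb
  have han : ∀ z ∈ canonicalDomain E Φ ρ, z ≠ ξ →
      AnalyticAt ℂ (fun z => F z + polar ξ b s z) z := fun z hz hzξ =>
    (hF z hz).add (analyticAt_polar hzξ b s)
  refine ⟨_, {ξ}, hgF.symm, fun z hz => ?_, by simpa using hmem, fun z hz hzξ =>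
    han z hz (by simpa using hzξ), ?_⟩
  · by_cases hzξ : z = ξ
    · rw [hzξ]; exact h1
    · exact (han z hz hzξ).meromorphicAt
  · rw [Finset.sum_singleton, poleOrder, h2]
    simp

/-- If `g` has a pole at `ξ` of exact order `s`, then this pole exhausts the `s` poles allowed in a
meromorphic continuation, so the continuation has no other singularity. -/
lemma ExtendsWithPoles.splitsOn (h : ExteriorPair E Φ Ψ) {ξ : ℂ} (hξ : ξ ∉ E) {s : ℕ} (hs : 1 ≤ s)
    {b : ℕ → ℂ} (hb : b (s - 1) ≠ 0) {ρ₀ ρ : ℝ} (hρ₀ : ‖Φ ξ‖ < ρ₀) {g : ℂ → ℂ}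
    (hg : SplitsOn E Φ ρ₀ ξ b s g) (hext : ExtendsWithPoles E Φ g s ρ) :
    SplitsOn E Φ ρ ξ b s g := by
  classical
  rcases le_total ρ ρ₀ with hle | hle
  · exact hg.mono hle
  obtain ⟨F, hF, hgF⟩ := hg
  obtain ⟨F₁, S, hF₁g, hmer, hSsub, hSan, hSsum⟩ := hext
  have hξ1 := h.one_lt ξ hξ
  have hρ₀1 : 1 < ρ₀ := hξ1.trans hρ₀
  have hξmem₀ : ξ ∈ canonicalDomain E Φ ρ₀ := mem_canonicalDomain.mpr fun _ => hρ₀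
  have hξmem : ξ ∈ canonicalDomain E Φ ρ := canonicalDomain_mono hle hξmem₀
  obtain ⟨hm, ho⟩ := meromorphicOrderAt_add_polar (hF ξ hξmem₀) hs hb
  set F₂ : ℂ → ℂ := fun z => F z + polar ξ b s z with hF₂
  have hpolm : ∀ z, MeromorphicAt (polar ξ b s) z := by
    intro z
    unfold polar
    refine MeromorphicAt.fun_sum fun j _ => (MeromorphicAt.const _ _).mul ?_
    exact (((analyticAt_id.sub analyticAt_const :
      AnalyticAt ℂ (fun z => z - ξ) z).meromorphicAt).pow (j + 1)).inv
  have hF₂m : ∀ z ∈ canonicalDomain E Φ ρ₀, MeromorphicAt F₂ z := fun z hz =>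
    (hF z hz).meromorphicAt.add (hpolm z)
  -- The two continuations of `g` agree by the identity theorem for meromorphic functions.
  have hagree : ∀ z ∈ canonicalDomain E Φ ρ₀, F₁ =ᶠ[𝓝[≠] z] F₂ := by
    intro z hz
    obtain ⟨e, he⟩ := h.connected.nonempty
    have hmero : MeromorphicOn (fun z => F₁ z - F₂ z) (canonicalDomain E Φ ρ₀) := fun y hy =>
      (hmer y (canonicalDomain_mono hle hy)).sub (hF₂m y hy)
    have htop : meromorphicOrderAt (fun z => F₁ z - F₂ z) e = ⊤ := by
      rw [meromorphicOrderAt_eq_top_iff]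
      have h1 : ∀ᶠ y in 𝓝ˢ E, F₁ y - F₂ y = 0 := by
        filter_upwards [hF₁g, hgF] with y hy1 hy2
        rw [hy1, hy2, sub_self]
      exact (h1.filter_mono (nhds_le_nhdsSet he)).filter_mono nhdsWithin_le_nhds
    have htop' : meromorphicOrderAt (fun z => F₁ z - F₂ z) z = ⊤ := by
      by_contra hne
      exact hmero.meromorphicOrderAt_ne_top_of_isPreconnected
        (h.isPreconnected_canonicalDomain hρ₀1) hz (subset_canonicalDomain he) hne htop
    rw [meromorphicOrderAt_eq_top_iff] at htop'
    filter_upwards [htop'] with y hy using sub_eq_zero.mp hy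
  have hordξ : meromorphicOrderAt F₁ ξ = ((-(s : ℤ) : ℤ) : WithTop ℤ) := by
    rw [meromorphicOrderAt_congr (hagree ξ hξmem₀), ho]
  have hpoξ : poleOrder F₁ ξ = s := by
    rw [poleOrder, hordξ]
    simp
  have hξS : ξ ∈ S := by
    by_contra hξS
    have h1 := (hSan ξ hξmem hξS).meromorphicOrderAt_nonneg
    rw [hordξ] at h1
    have h2 : (0 : ℤ) ≤ -(s : ℤ) := by exact_mod_cast h1
    omega
  have hothers : ∀ z ∈ S, z ≠ ξ → poleOrder F₁ z = 0 := by
    intro z hz hzξ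
    have h1 : poleOrder F₁ ξ + poleOrder F₁ z ≤ ∑ z ∈ S, poleOrder F₁ z := by
      rw [← Finset.sum_pair hzξ.symm]
      exact Finset.sum_le_sum_of_subset (by
        intro y hy
        simp only [Finset.mem_insert, Finset.mem_singleton] at hy
        rcases hy with rfl | rfl
        · exact hξS
        · exact hz)
    omega
  have hnonneg : ∀ z ∈ canonicalDomain E Φ ρ, z ≠ ξ → 0 ≤ meromorphicOrderAt F₁ z := by
    intro z hz hzξ
    by_cases hzS : z ∈ S
    · have h1 := hothers z hzS hzξ
      rw [poleOrder] at h1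
      cases ho : meromorphicOrderAt F₁ z with
      | top => exact le_top
      | coe k =>
        rw [ho] at h1
        simp only [WithTop.untop₀_coe] at h1
        have : (0 : ℤ) ≤ k := by omega
        exact_mod_cast this
    · exact (hSan z hz hzS).meromorphicOrderAt_nonneg
  set M : ℂ → ℂ := fun z => F₁ z - polar ξ b s z with hM
  have hMm : MeromorphicOn M (canonicalDomain E Φ ρ) := fun z hz => (hmer z hz).sub (hpolm z)
  have hMF : ∀ z ∈ canonicalDomain E Φ ρ₀, M =ᶠ[𝓝[≠] z] F := by
    intro z hz
    filter_upwards [hagree z hz] with y hy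
    simp only [hM, hy, hF₂]
    ring
  have hMnonneg : ∀ z ∈ canonicalDomain E Φ ρ, 0 ≤ meromorphicOrderAt M z := by
    intro z hz
    rw [(hMm z hz).meromorphicOrderAt_nonneg_iff]
    by_cases hzξ : z = ξ
    · exact ⟨F, hF z (hzξ ▸ hξmem₀), hMF z (hzξ ▸ hξmem₀)⟩
    · obtain ⟨g₁, hg₁, hg₁'⟩ :=
        ((hmer z hz).meromorphicOrderAt_nonneg_iff).mp (hnonneg z hz hzξ)
      refine ⟨fun y => g₁ y - polar ξ b s y, hg₁.sub (analyticAt_polar hzξ b s), ?_⟩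
      filter_upwards [hg₁'] with y hy
      simp only [hM, hy]
  set N := toMeromorphicNFOn M (canonicalDomain E Φ ρ) with hN
  have hNM : ∀ z ∈ canonicalDomain E Φ ρ, M =ᶠ[𝓝[≠] z] N := fun z hz =>
    (hMm.toMeromorphicNFOn_eq_self_on_nhdsNE hz).symm
  have hNan : AnalyticOnNhd ℂ N (canonicalDomain E Φ ρ) := by
    intro z hz
    have hnf : MeromorphicNFAt N z := meromorphicNFOn_toMeromorphicNFOn M _ hz
    rw [← hnf.meromorphicOrderAt_nonneg_iff_analyticAt, ← meromorphicOrderAt_congr (hNM z hz)]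
    exact hMnonneg z hz
  refine ⟨N, hNan, ?_⟩
  have hNF : ∀ z ∈ canonicalDomain E Φ ρ₀, N z = F z := by
    intro z hz
    have h1 : N =ᶠ[𝓝[≠] z] F := (hNM z (canonicalDomain_mono hle hz)).symm.trans (hMF z hz)
    have h2 := ((hNan z (canonicalDomain_mono hle hz)).continuousAt.eventuallyEq_nhds_iff_eventuallyEq_nhdsNE
      (hF z hz).continuousAt).mp h1
    exact h2.self_of_nhds
  filter_upwards [hgF, h.eventually_of_canonicalDomain hρ₀1 hNF] with z hz hz'
  rw [hz, hz']

end

/-! ### Orthogonality of the denominators -/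

/-- The polynomial `q` is orthogonal to all combinations with respect to the kernel `K n`. -/
def IsOrthogonal (Ψ : ℂ → ℂ) (K : ℕ → ℂ → ℂ) {d : ℕ} (f : Fin d → ℂ → ℂ) (m : Fin d → ℕ)
    (n : ℕ) (q : ℂ[X]) : Prop :=
  ∀ g, IsCombination f m g → ∃ ρ > 1, ∀ r, 1 < r → r < ρ → pairing Ψ K r n q g = 0

section

variable {E : Set ℂ} {Φ Ψ : ℂ → ℂ} {K : ℕ → ℂ → ℂ} {G : ℂ → ℂ} {d : ℕ} {f : Fin d → ℂ → ℂ}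
  {m : Fin d → ℕ}

lemma IsOrthogonal.C_mul {n : ℕ} {q : ℂ[X]} (hq : IsOrthogonal Ψ K f m n q) (a : ℂ) :
    IsOrthogonal Ψ K f m n (C a * q) := by
  intro g hg
  obtain ⟨ρ, hρ, h0⟩ := hq g hg
  refine ⟨ρ, hρ, fun r hr hrρ => ?_⟩
  have h1 := h0 r hr hrρ
  rw [pairing] at h1 ⊢
  rw [← mul_zero a, ← h1, ← ExteriorPair.levelIntegral_const_mul]
  simp only [eval_mul, eval_C, mul_assoc]

/-- The denominators of the approximants are orthogonal: near `E`, the product of `Q` and a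
combination is the sum of a multiple of `a_{n + 1}` and a polynomial of degree less than `n`. -/
theorem IsApproximant.isOrthogonal (h : ExteriorPair E Φ Ψ) {α : ℕ → ℕ → ℂ} {c : ℝ}
    (hα : ∀ n k, 1 ≤ k → k ≤ n → α n k ∈ E)
    (hK : KernelFamily E Φ (nodalKernel α c) G) {n : ℕ} (hn : 1 ≤ n) {Q : ℂ[X]} {P : Fin d → ℂ[X]}
    (hQ : IsApproximant E α f m n Q P) : IsOrthogonal Ψ (nodalKernel α c) f m n Q := by
  rintro g ⟨p, hp, rfl⟩
  choose H hH hHeq using hQ.interpolates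
  have hnear : ∀ᶠ z in 𝓝ˢ E, ∀ k, AnalyticAt ℂ (H k) z ∧
      Q.eval z * f k z - (P k).eval z = (nodal α (n + 1)).eval z * H k z := by
    rw [eventually_all]
    intro k
    refine Eventually.and ?_ (hHeq k)
    exact (isOpen_analyticAt ℂ (H k)).mem_nhdsSet.mpr fun z hz => hH k z hz
  obtain ⟨ρ, hρ, hρp⟩ := h.exists_canonicalDomain_of_eventually hnear
  refine ⟨ρ, hρ, fun r hr hrρ => ?_⟩
  set A : ℂ[X] := ∑ k, p k * P k with hA
  have hAdeg : A.natDegree + 1 ≤ n := by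
    have h1 : A.degree < (n : WithBot ℕ) := by
      refine (degree_sum_le _ _).trans_lt ((Finset.sup_lt_iff (WithBot.bot_lt_coe n)).mpr
        fun k _ => ?_)
      rw [degree_mul]
      have h2 := hp k
      have h3 := hQ.degree_num k
      by_cases hP : P k = 0
      · simp [hP]
      by_cases hpk : p k = 0
      · simp [hpk]
      rw [degree_eq_natDegree hP] at h3 ⊢
      rw [degree_eq_natDegree hpk] at h2 ⊢
      have h2' : (p k).natDegree < m k := by exact_mod_cast h2
      have h3' : (P k).natDegree + m k ≤ n := by exact_mod_cast h3
      have : (p k).natDegree + (P k).natDegree < n := by omega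
      calc ((p k).natDegree : WithBot ℕ) + ((P k).natDegree : WithBot ℕ)
          = (((p k).natDegree + (P k).natDegree : ℕ) : WithBot ℕ) := (Nat.cast_add _ _).symm
        _ < n := Nat.cast_lt.mpr this
    by_cases hA0 : A = 0
    · rw [hA0, natDegree_zero]; omega
    · rw [degree_eq_natDegree hA0] at h1
      have : A.natDegree < n := by exact_mod_cast h1
      omega
  set B : ℂ → ℂ := fun z => ∑ k, (p k).eval z * H k z with hB
  have hBan : AnalyticOnNhd ℂ B (canonicalDomain E Φ ρ) := fun z hz =>
    Finset.analyticAt_fun_sum _ fun k _ => (analyticAt_polynomial (p k) z).mul (hρp z hz k).1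
  have hmem : ∀ z, ‖Φ z‖ = r → z ∈ canonicalDomain E Φ ρ := fun z hzr =>
    mem_canonicalDomain.mpr fun _ => hzr ▸ hrρ
  have hcongr : pairing Ψ (nodalKernel α c) r n Q (fun z => ∑ k, (p k).eval z * f k z) =
      levelIntegral Ψ r (fun z => A.eval z * nodalKernel α c n z + (c : ℂ) ^ (n + 1) * B z) := by
    refine h.levelIntegral_congr hr fun z hz hzr => ?_
    have h4 : (nodal α (n + 1)).eval z ≠ 0 := by
      rw [nodal_eval]
      refine Finset.prod_ne_zero_iff.mpr fun k hk => sub_ne_zero.mpr ?_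
      rintro rfl
      rw [Finset.mem_Icc] at hk
      exact hz (hα _ k hk.1 hk.2)
    have h5 : Q.eval z * ∑ k, (p k).eval z * f k z =
        A.eval z + (nodal α (n + 1)).eval z * B z := by
      rw [hA, hB, eval_finsetSum, Finset.mul_sum, Finset.mul_sum, ← Finset.sum_add_distrib]
      refine Finset.sum_congr rfl fun k _ => ?_
      have h6 := (hρp z (hmem z hzr) k).2
      rw [eval_mul]
      linear_combination (p k).eval z * h6
    rw [h5, nodalKernel]
    field_simp
  rw [hcongr, h.levelIntegral_add hr, levelIntegral_polynomial_mul_kernel h hK hr hAdeg,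
    ExteriorPair.levelIntegral_const_mul, h.levelIntegral_eq_zero hr hrρ hBan, mul_zero, add_zero]
  · exact fun z hz _ => ((analyticAt_polynomial A z).mul (hK.analytic n z hz)).continuousAt
  · exact fun z _ hzr => continuousAt_const.mul (hBan z (hmem z hzr)).continuousAt

/-- The residue theorem in the form used here. -/
lemma IsOrthogonal.pairing_eq (h : ExteriorPair E Φ Ψ) (hK : KernelFamily E Φ K G) {n : ℕ}
    {q : ℂ[X]} (hq : IsOrthogonal Ψ K f m n q) {g F : ℂ → ℂ} (hg : IsCombination f m g)
    {ξ : ℂ} (hξ : ξ ∉ E) {b : ℕ → ℂ} {s : ℕ} {ρ r r' : ℝ}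
    (hF : AnalyticOnNhd ℂ F (canonicalDomain E Φ ρ))
    (hgF : g =ᶠ[𝓝ˢ E] fun z => F z + polar ξ b s z) (hr : 1 < r) (hrρ : r < ρ) (hr' : 1 < r')
    (hr'ξ : r' < ‖Φ ξ‖) :
    pairing Ψ K r n q F = -∑ j ∈ Finset.range s,
      b j * pairing Ψ K r' n q (fun z => ((z - ξ) ^ (j + 1))⁻¹) := by
  obtain ⟨ρ₁, hρ₁, h0⟩ := hq g hg
  obtain ⟨ρ₂, hρ₂, h2⟩ := h.exists_canonicalDomain_of_eventually hgF
  obtain ⟨t, ht1, ht2⟩ := exists_between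
    (lt_min (lt_min hρ₁ hρ₂) (lt_min (hr.trans hrρ) (hr'.trans hr'ξ)))
  simp only [lt_min_iff] at ht2
  obtain ⟨⟨ht3, ht4⟩, ht5, ht6⟩ := ht2
  have hFa : ∀ z ∉ E, ‖Φ z‖ < ρ → AnalyticAt ℂ (fun z => q.eval z * F z * K n z) z :=
    fun z hz hzρ => ((analyticAt_polynomial q z).mul
      (hF z (mem_canonicalDomain.mpr fun _ => hzρ))).mul (hK.analytic n z hz)
  have hpa : ∀ z ∉ E, ‖Φ z‖ < ‖Φ ξ‖ →
      AnalyticAt ℂ (fun z => q.eval z * polar ξ b s z * K n z) z := by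
    intro z hz hzξ
    refine ((analyticAt_polynomial q z).mul (analyticAt_polar ?_ b s)).mul (hK.analytic n z hz)
    rintro rfl
    exact lt_irrefl _ hzξ
  rw [← pairing_polar h hK hr' hr'ξ]
  have h3 : pairing Ψ K r n q F = pairing Ψ K t n q F :=
    h.levelIntegral_eq_of_lt hr hrρ ht1 ht5 hFa
  have h4 : pairing Ψ K r' n q (polar ξ b s) = pairing Ψ K t n q (polar ξ b s) :=
    h.levelIntegral_eq_of_lt hr' hr'ξ ht1 ht6 hpa
  rw [h3, h4, eq_neg_iff_add_eq_zero, ← h0 t ht1 ht3, pairing, pairing, pairing,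
    ← h.levelIntegral_add ht1]
  · refine h.levelIntegral_congr ht1 fun z _ hzt => ?_
    rw [h2 z (mem_canonicalDomain.mpr fun _ => hzt ▸ ht4)]
    ring
  · exact fun z hz hzt => (hFa z hz (hzt ▸ ht5)).continuousAt
  · exact fun z hz hzt => (hpa z hz (hzt ▸ ht6)).continuousAt

/-- Decay of the Taylor coefficients at a pole, from combinations that have no other
singularity in the canonical domain of index `ρ`. -/
theorem growthLE_taylor_of_splitsOn (h : ExteriorPair E Φ Ψ) (hK : KernelFamily E Φ K G)
    {q : ℕ → ℂ[X]} {N : ℕ} (hqN : ∀ n, (q n).natDegree ≤ N)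
    (hq1 : ∀ i, GrowthLE (fun n => (q n).coeff i) 1)
    (hq : ∀ᶠ n in atTop, IsOrthogonal Ψ K f m n (q n)) {ξ : ℂ} (hξ : ξ ∉ E) {ρ : ℝ} (hρ : 1 < ρ)
    {t : ℕ} (ht : ∀ s, 1 ≤ s → s ≤ t → ∃ g, IsCombination f m g ∧ ∃ b : ℕ → ℂ, b (s - 1) ≠ 0 ∧
      SplitsOn E Φ ρ ξ b s g) :
    ∀ j < t, GrowthLE (fun n => (taylor ξ (q n)).coeff j) (ρ⁻¹ * ‖Φ ξ‖) := by
  obtain ⟨r', hr', hr'ξ⟩ := exists_between (h.one_lt ξ hξ)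
  obtain ⟨r, hr, hrρ⟩ := exists_between hρ
  refine growthLE_taylor_of_pairing h hK hr' hξ hr'ξ hqN (inv_nonneg.mpr (by linarith)) ?_
  intro j
  induction j using Nat.strong_induction_on with
  | _ j ih =>
  intro hj
  obtain ⟨g, hg, b, hb, F, hF, hgF⟩ := ht (j + 1) (by omega) hj
  rw [Nat.add_sub_cancel] at hb
  have h1 : GrowthLE (fun n => pairing Ψ K r n (q n) F) ρ⁻¹ := by
    simpa using growthLE_pairing h hK hr hrρ hF hqN zero_le_one hq1
  have h2 : GrowthLE (fun n => ∑ i ∈ Finset.range j,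
      b i * pairing Ψ K r' n (q n) (fun z => ((z - ξ) ^ (i + 1))⁻¹)) ρ⁻¹ :=
    GrowthLE.sum fun i hi => by
      have hi' := Finset.mem_range.mp hi
      exact (ih i hi' (hi'.trans hj)).const_mul _
  refine ((h1.neg.sub h2).const_mul (b j)⁻¹).congr' ?_
  filter_upwards [hq] with n hn
  rw [hn.pairing_eq h hK hg hξ hF hgF hr hrρ hr' hr'ξ, Finset.sum_range_succ]
  field_simp
  ring

end

/-! ### Polynomials determined by their Taylor coefficients at several points -/

/-- The monic polynomial with zeros of order `ord ξ` at the points `ξ ∈ S`. -/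
noncomputable def zeroPoly (S : Finset ℂ) (ord : ℂ → ℕ) : ℂ[X] :=
  ∏ ξ ∈ S, (X - C ξ) ^ ord ξ

lemma zeroPoly_monic (S : Finset ℂ) (ord : ℂ → ℕ) : (zeroPoly S ord).Monic :=
  monic_prod_of_monic _ _ fun ξ _ => (monic_X_sub_C ξ).pow _

lemma natDegree_zeroPoly (S : Finset ℂ) (ord : ℂ → ℕ) :
    (zeroPoly S ord).natDegree = ∑ ξ ∈ S, ord ξ := by
  rw [zeroPoly, natDegree_prod_of_monic _ _ fun ξ _ => (monic_X_sub_C ξ).pow _]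
  simp

lemma zeroPoly_eval_ne_zero {S : Finset ℂ} {ord : ℂ → ℕ} {z : ℂ} (hz : z ∉ S) :
    (zeroPoly S ord).eval z ≠ 0 := by
  rw [zeroPoly, eval_prod]
  refine Finset.prod_ne_zero_iff.mpr fun ξ hξ => ?_
  rw [eval_pow, eval_sub, eval_X, eval_C]
  refine pow_ne_zero _ (sub_ne_zero.mpr ?_)
  rintro rfl
  exact hz hξ

lemma pow_dvd_iff_taylor_coeff (q : ℂ[X]) (ξ : ℂ) (k : ℕ) :
    (X - C ξ) ^ k ∣ q ↔ ∀ j < k, (taylor ξ q).coeff j = 0 := by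
  rw [← X_pow_dvd_iff]
  constructor
  · rintro ⟨u, rfl⟩
    refine ⟨taylor ξ u, ?_⟩
    rw [taylor_mul]
    congr 1
    simp [taylor_apply]
  · rintro ⟨u, hu⟩
    refine ⟨taylor (-ξ) u, ?_⟩
    have h1 : q = taylor (-ξ) (taylor ξ q) := by
      rw [taylor_taylor]; simp
    rw [h1, hu, taylor_mul]
    congr 1
    simp [taylor_apply, sub_eq_add_neg]

/-- Hermite interpolation: the coefficients of a polynomial of degree less than `N` are linear
functions of `N` of its Taylor coefficients. -/
lemma exists_coeff_eq_sum_taylor (S : Finset ℂ) (ord : ℂ → ℕ) {N : ℕ} (hN : ∑ ξ ∈ S, ord ξ = N) :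
    ∃ t : ℕ → (Σ ξ : S, Fin (ord ξ)) → ℂ, ∀ q : ℂ[X], q.degree < N → ∀ i,
      q.coeff i = ∑ x : (Σ ξ : S, Fin (ord ξ)), (taylor (x.1 : ℂ) q).coeff x.2 * t i x := by
  classical
  set T : degreeLT ℂ N →ₗ[ℂ] ((Σ ξ : S, Fin (ord ξ)) → ℂ) :=
    LinearMap.pi fun x => (lcoeff ℂ (x.2 : ℕ)).comp
      ((taylor (x.1 : ℂ)).comp (degreeLT ℂ N).subtype) with hT
  have hTapply : ∀ (q : degreeLT ℂ N) (x : Σ ξ : S, Fin (ord ξ)),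
      T q x = (taylor (x.1 : ℂ) (q : ℂ[X])).coeff x.2 := fun q x => rfl
  have hinj : LinearMap.ker T = ⊥ := by
    rw [LinearMap.ker_eq_bot']
    intro q hq
    have hdvd : zeroPoly S ord ∣ (q : ℂ[X]) := by
      refine Finset.prod_dvd_of_coprime ?_ fun ξ hξ => ?_
      · intro ξ _ η _ hne
        exact (isCoprime_X_sub_C_of_isUnit_sub (sub_ne_zero.mpr hne).isUnit).pow
      · rw [pow_dvd_iff_taylor_coeff]
        intro j hj
        rw [← hTapply q ⟨⟨ξ, hξ⟩, ⟨j, hj⟩⟩, hq]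
        rfl
    have hdeg := mem_degreeLT.mp q.2
    by_contra hq0
    have hq0' : (q : ℂ[X]) ≠ 0 := fun h0 => hq0 (Subtype.ext h0)
    have h1 := degree_le_of_dvd hdvd hq0'
    rw [degree_eq_natDegree (zeroPoly_monic S ord).ne_zero, natDegree_zeroPoly, hN] at h1
    exact absurd hdeg (not_lt.mpr h1)
  obtain ⟨L, hL⟩ := T.exists_leftInverse_of_injective hinj
  refine ⟨fun i x => ((L fun y => if x = y then 1 else 0 : degreeLT ℂ N) : ℂ[X]).coeff i,
    fun q hq i => ?_⟩
  have h1 : L (T ⟨q, mem_degreeLT.mpr hq⟩) = ⟨q, mem_degreeLT.mpr hq⟩ := by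
    rw [← LinearMap.comp_apply, hL, LinearMap.id_apply]
  rw [LinearMap.pi_apply_eq_sum_univ] at h1
  have h2 := congrArg (fun p : degreeLT ℂ N => (p : ℂ[X]).coeff i) h1
  simp only [Submodule.coe_sum, Submodule.coe_smul, finsetSum_coeff, coeff_smul, smul_eq_mul] at h2
  rw [← h2]
  rfl

/-- If the Taylor coefficients at the prescribed zeros decay, then the polynomials approach
multiples of the polynomial with these zeros. -/
lemma growthLE_coeff_sub (S : Finset ℂ) (ord : ℂ → ℕ) {N : ℕ} (hN : ∑ ξ ∈ S, ord ξ = N)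
    {q : ℕ → ℂ[X]} (hqN : ∀ n, (q n).natDegree ≤ N) {θ : ℝ}
    (hq : ∀ ξ ∈ S, ∀ j < ord ξ, GrowthLE (fun n => (taylor ξ (q n)).coeff j) θ) (i : ℕ) :
    GrowthLE (fun n => (q n - C ((q n).coeff N) * zeroPoly S ord).coeff i) θ := by
  obtain ⟨t, ht⟩ := exists_coeff_eq_sum_taylor S ord hN
  have hdeg : ∀ n, (q n - C ((q n).coeff N) * zeroPoly S ord).degree < N := by
    intro n
    rw [degree_lt_iff_coeff_zero]
    intro k hk
    have hz : (zeroPoly S ord).natDegree = N := by rw [natDegree_zeroPoly, hN]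
    rw [coeff_sub, coeff_C_mul]
    rcases hk.eq_or_lt with rfl | hk
    · have h1 : (zeroPoly S ord).coeff N = 1 := by
        have := (zeroPoly_monic S ord).coeff_natDegree
        rwa [hz] at this
      rw [h1, mul_one, sub_self]
    · have h1 : (zeroPoly S ord).coeff k = 0 := coeff_eq_zero_of_natDegree_lt (hz.trans_lt hk)
      rw [h1, coeff_eq_zero_of_natDegree_lt ((hqN n).trans_lt hk), mul_zero, sub_zero]
  have h1 : GrowthLE (fun n => ∑ x : (Σ ξ : S, Fin (ord ξ)),
      (t i x) * (taylor (x.1 : ℂ) (q n)).coeff x.2) θ :=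
    GrowthLE.sum fun x _ => (hq x.1 x.1.2 x.2 x.2.2).const_mul _
  refine h1.congr' (Eventually.of_forall fun n => ?_)
  simp only
  rw [ht _ (hdeg n) i]
  refine Finset.sum_congr rfl fun x _ => ?_
  have h2 : (taylor (x.1 : ℂ) (zeroPoly S ord)).coeff x.2 = 0 :=
    (pow_dvd_iff_taylor_coeff _ _ _).mp (Finset.dvd_prod_of_mem (fun ξ => (X - C ξ) ^ ord ξ) x.1.2) x.2 x.2.2
  rw [map_sub, coeff_sub, taylor_mul, taylor_C, coeff_C_mul, h2, mul_zero, sub_zero, mul_comm]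

/-! ### Convergence of the denominators -/

/-- At every point `ξ ∈ S` and for every order `s` up to `ord ξ` there is a combination whose only
singularity in the canonical domain of index `σ * ‖Φ ξ‖` is a pole at `ξ` of exact order `s`. The
factor `σ > 1` is the same for all points and orders. -/
structure PoleSystem (E : Set ℂ) (Φ : ℂ → ℂ) {d : ℕ} (f : Fin d → ℂ → ℂ) (m : Fin d → ℕ)
    (S : Finset ℂ) (ord : ℂ → ℕ) (σ : ℝ) : Prop where
  one_lt : 1 < σ
  notMem : ∀ ξ ∈ S, ξ ∉ E
  exists_splitsOn : ∀ ξ ∈ S, ∀ s, 1 ≤ s → s ≤ ord ξ → ∃ g, IsCombination f m g ∧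
    ∃ b : ℕ → ℂ, b (s - 1) ≠ 0 ∧ SplitsOn E Φ (σ * ‖Φ ξ‖) ξ b s g

section

variable {E : Set ℂ} {Φ Ψ : ℂ → ℂ} {K : ℕ → ℂ → ℂ} {G : ℂ → ℂ} {d : ℕ} {f : Fin d → ℂ → ℂ}
  {m : Fin d → ℕ} {S : Finset ℂ} {ord : ℂ → ℕ} {σ : ℝ}

lemma exists_poleSystem (h : ExteriorPair E Φ Ψ)
    (hS : ∀ ξ ∈ S, IsSystemPole E Φ f m ξ (ord ξ)) : ∃ σ, PoleSystem E Φ f m S ord σ := by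
  have hnot : ∀ ξ ∈ S, ξ ∉ E := fun ξ hξ => by
    obtain ⟨_, _, hg⟩ := (hS ξ hξ).1.2 1 le_rfl (hS ξ hξ).1.1
    exact hg.1
  have hev : ∀ᶠ σ : ℝ in 𝓝[>] 1, ∀ ξ ∈ S, ∀ s ∈ Finset.Icc 1 (ord ξ),
      ∃ g, IsCombination f m g ∧ ∃ b : ℕ → ℂ, b (s - 1) ≠ 0 ∧
        SplitsOn E Φ (σ * ‖Φ ξ‖) ξ b s g := by
    refine (Finset.eventually_all S).mpr fun ξ hξ => (Finset.eventually_all _).mpr fun s hs => ?_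
    rw [Finset.mem_Icc] at hs
    obtain ⟨g, hg, hgp⟩ := (hS ξ hξ).1.2 s hs.1 hs.2
    obtain ⟨ρ, hρ, b, hb, hsp⟩ := hgp.exists_splitsOn h hs.1
    have hξ0 : 0 < ‖Φ ξ‖ := by linarith [h.one_lt ξ (hnot ξ hξ)]
    have h1 : ∀ᶠ σ : ℝ in 𝓝[>] 1, σ < ρ / ‖Φ ξ‖ :=
      nhdsWithin_le_nhds (eventually_lt_nhds ((one_lt_div hξ0).mpr hρ))
    filter_upwards [h1] with σ hσ
    exact ⟨g, hg, b, hb, hsp.mono ((lt_div_iff₀ hξ0).mp hσ).le⟩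
  obtain ⟨σ, hσ, hσ1⟩ := (hev.and self_mem_nhdsWithin).exists
  exact ⟨σ, hσ1, hnot, fun ξ hξ s h1 h2 => hσ ξ hξ s (Finset.mem_Icc.mpr ⟨h1, h2⟩)⟩

lemma PoleSystem.growthLE_coeff_sub (hS : PoleSystem E Φ f m S ord σ) (h : ExteriorPair E Φ Ψ)
    (hK : KernelFamily E Φ K G) {N : ℕ} (hN : ∑ ξ ∈ S, ord ξ = N)
    {q : ℕ → ℂ[X]} (hqN : ∀ n, (q n).natDegree ≤ N)
    (hq1 : ∀ i, GrowthLE (fun n => (q n).coeff i) 1)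
    (hq : ∀ᶠ n in atTop, IsOrthogonal Ψ K f m n (q n)) (i : ℕ) :
    GrowthLE (fun n => (q n - C ((q n).coeff N) * zeroPoly S ord).coeff i) σ⁻¹ := by
  refine HermitePade.growthLE_coeff_sub S ord hN hqN (fun ξ hξ j hj => ?_) i
  have h1 := h.one_lt ξ (hS.notMem ξ hξ)
  have h2 := growthLE_taylor_of_splitsOn h hK hqN hq1 hq (hS.notMem ξ hξ)
    (one_lt_mul_of_lt_of_le hS.one_lt h1.le) (hS.exists_splitsOn ξ hξ) j hj
  have h3 : ‖Φ ξ‖ ≠ 0 := by linarith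
  rwa [mul_inv, inv_mul_cancel_right₀ h3] at h2

/-- Monic orthogonal polynomials stay bounded and have full degree eventually: normalizing them by
the sum of the moduli of the coefficients, the limit points are nonzero multiples of the polynomial
whose zeros are the system poles. -/
lemma PoleSystem.eventually_bound (hS : PoleSystem E Φ f m S ord σ) (h : ExteriorPair E Φ Ψ)
    (hK : KernelFamily E Φ K G) {N : ℕ} (hN : ∑ ξ ∈ S, ord ξ = N)
    {q : ℕ → ℂ[X]} (hqN : ∀ n, (q n).natDegree ≤ N) (hmonic : ∀ᶠ n in atTop, (q n).Monic)
    (hq : ∀ᶠ n in atTop, IsOrthogonal Ψ K f m n (q n)) :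
    ∃ B : ℝ, ∀ᶠ n in atTop, (q n).coeff N = 1 ∧ ∀ i, ‖(q n).coeff i‖ ≤ B := by
  set Z := zeroPoly S ord with hZ
  set w : ℕ → ℝ := fun n => ∑ i ∈ Finset.range (N + 1), ‖(q n).coeff i‖ with hw
  set W : ℝ := ∑ i ∈ Finset.range (N + 1), ‖Z.coeff i‖ with hW
  have hw0 : ∀ n, 0 ≤ w n := fun n => Finset.sum_nonneg fun i _ => norm_nonneg _
  have hW0 : 0 ≤ W := Finset.sum_nonneg fun i _ => norm_nonneg _
  have hcoeff : ∀ n i, ‖(q n).coeff i‖ ≤ w n := by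
    intro n i
    rcases lt_or_ge N i with hi | hi
    · rw [coeff_eq_zero_of_natDegree_lt ((hqN n).trans_lt hi), norm_zero]
      exact hw0 n
    · exact Finset.single_le_sum (f := fun i => ‖(q n).coeff i‖) (fun i _ => norm_nonneg _)
        (Finset.mem_range.mpr (by omega))
  have hlim : ∀ i, Tendsto (fun n => ((w n : ℂ))⁻¹ * ((q n).coeff i - (q n).coeff N * Z.coeff i))
      atTop (𝓝 0) := by
    intro i
    have h1 := hS.growthLE_coeff_sub h hK hN (q := fun n => C ((w n : ℂ))⁻¹ * q n)
      (fun n => (natDegree_C_mul_le _ _).trans (hqN n)) (fun i => GrowthLE.of_isBigO_one ?_)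
      (hq.mono fun n hn => hn.C_mul _) i
    · refine (h1.tendsto_zero (inv_nonneg.mpr (by linarith [hS.one_lt]))
        (inv_lt_one_of_one_lt₀ hS.one_lt)).congr fun n => ?_
      rw [coeff_sub, coeff_C_mul, coeff_C_mul, coeff_C_mul]
      ring
    · refine Asymptotics.IsBigO.of_bound 1 (Eventually.of_forall fun n => ?_)
      rw [coeff_C_mul, norm_mul, norm_inv, Complex.norm_real, Real.norm_of_nonneg (hw0 n), norm_one,
        mul_one, inv_mul_eq_div]
      exact div_le_one_of_le₀ (hcoeff n i) (hw0 n)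
  have hsum : Tendsto (fun n => ∑ i ∈ Finset.range (N + 1),
      ‖((w n : ℂ))⁻¹ * ((q n).coeff i - (q n).coeff N * Z.coeff i)‖) atTop (𝓝 0) := by
    simpa using tendsto_finsetSum (Finset.range (N + 1)) fun i _ => (hlim i).norm
  refine ⟨2 * W, ?_⟩
  filter_upwards [hsum.eventually_lt_const (show (0 : ℝ) < 1 / 2 by norm_num), hmonic]
    with n hn hmon
  have hwpos : 0 < w n := by
    have h1 := hcoeff n (q n).natDegree
    rw [hmon.coeff_natDegree, norm_one] at h1
    linarith
  have h1 : w n ≤ (∑ i ∈ Finset.range (N + 1), ‖(q n).coeff i - (q n).coeff N * Z.coeff i‖) +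
      ‖(q n).coeff N‖ * W := by
    rw [hw, hW, Finset.mul_sum, ← Finset.sum_add_distrib]
    refine Finset.sum_le_sum fun i _ => ?_
    rw [← norm_mul]
    simpa using norm_add_le ((q n).coeff i - (q n).coeff N * Z.coeff i) ((q n).coeff N * Z.coeff i)
  have h2 : (∑ i ∈ Finset.range (N + 1), ‖(q n).coeff i - (q n).coeff N * Z.coeff i‖) <
      w n / 2 := by
    simp only [norm_mul, norm_inv, Complex.norm_real, Real.norm_of_nonneg (hw0 n)] at hn
    rw [← Finset.mul_sum, inv_mul_lt_iff₀ hwpos] at hn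
    linarith
  have h3 : w n / 2 < ‖(q n).coeff N‖ * W := by linarith
  have h4 : (q n).coeff N ≠ 0 := by
    intro h0
    rw [h0, norm_zero, zero_mul] at h3
    linarith
  have h5 : (q n).natDegree = N := le_antisymm (hqN n) (le_natDegree_of_ne_zero h4)
  have h6 : (q n).coeff N = 1 := by rw [← h5]; exact hmon
  refine ⟨h6, fun i => (hcoeff n i).trans ?_⟩
  rw [h6, norm_one, one_mul] at h3
  linarith

/-- The denominators converge geometrically to the polynomial whose zeros are the system poles. -/
theorem PoleSystem.growthLE_coeff_sub_zeroPoly (hS : PoleSystem E Φ f m S ord σ)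
    (h : ExteriorPair E Φ Ψ) (hK : KernelFamily E Φ K G) {N : ℕ} (hN : ∑ ξ ∈ S, ord ξ = N)
    {q : ℕ → ℂ[X]} (hqN : ∀ n, (q n).natDegree ≤ N) (hmonic : ∀ᶠ n in atTop, (q n).Monic)
    (hq : ∀ᶠ n in atTop, IsOrthogonal Ψ K f m n (q n)) :
    (∀ i, GrowthLE (fun n => (q n).coeff i) 1) ∧
      ∀ i, GrowthLE (fun n => (q n - zeroPoly S ord).coeff i) σ⁻¹ := by
  obtain ⟨B, hB⟩ := hS.eventually_bound h hK hN hqN hmonic hq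
  have h1 : ∀ i, GrowthLE (fun n => (q n).coeff i) 1 := fun i =>
    GrowthLE.of_isBigO_one (Asymptotics.IsBigO.of_bound B (hB.mono fun n hn => by
      rw [norm_one, mul_one]; exact hn.2 i))
  refine ⟨h1, fun i => (hS.growthLE_coeff_sub h hK hN hqN h1 hq i).congr' ?_⟩
  filter_upwards [hB] with n hn
  rw [hn.1, map_one, one_mul]

end

/-! ### Combinations with prescribed principal parts -/

lemma zeroPoly_insert [DecidableEq ℂ] {T : Finset ℂ} {a : ℂ} (ha : a ∉ T) (ord : ℂ → ℕ) :
    zeroPoly (insert a T) ord = (X - C a) ^ ord a * zeroPoly T ord :=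
  Finset.prod_insert ha

/-- Division by a polynomial splits off principal parts at its zeros; the remainder is analytic
wherever the numerator is. -/
lemma exists_principal_parts (T : Finset ℂ) (ord : ℂ → ℕ) (A : ℂ → ℂ)
    (hA : ∀ ξ ∈ T, AnalyticAt ℂ A ξ) :
    ∃ (β : ℂ → ℕ → ℂ) (B : ℂ → ℂ), (∀ z, AnalyticAt ℂ A z → AnalyticAt ℂ B z) ∧
      ∀ z ∉ T, A z * ((zeroPoly T ord).eval z)⁻¹ =
        B z + ∑ ξ ∈ T, polar ξ (β ξ) (ord ξ) z := by
  classical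
  induction T using Finset.induction_on generalizing A with
  | empty => exact ⟨0, A, fun z hz => hz, fun z _ => by simp [zeroPoly]⟩
  | insert a T ha ih =>
    have hcop : IsCoprime ((X - C a) ^ ord a) (zeroPoly T ord) :=
      IsCoprime.prod_right fun ξ hξ => (isCoprime_X_sub_C_of_isUnit_sub
        (sub_ne_zero.mpr (fun h0 : a = ξ => ha (h0 ▸ hξ))).isUnit).pow
    -- With `u (X - a)^k + v Z = 1`, the quotient splits as `A u / Z + A v / (z - a)^k`.
    obtain ⟨u, v, huv⟩ := hcop
    obtain ⟨β, B₁, hB₁, hβ⟩ := ih (fun z => A z * u.eval z) fun ξ hξ =>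
      (hA ξ (Finset.mem_insert_of_mem hξ)).mul (analyticAt_polynomial u ξ)
    obtain ⟨b, B₂, hB₂, hb, -⟩ := exists_principal_part
      ((hA a (Finset.mem_insert_self a T)).mul (analyticAt_polynomial v a)) (ord a)
    refine ⟨Function.update β a b, fun z => B₁ z + B₂ z, fun z hz =>
      (hB₁ z (hz.mul (analyticAt_polynomial u z))).add
        (hB₂ z (hz.mul (analyticAt_polynomial v z))), fun z hz => ?_⟩
    rw [Finset.mem_insert, not_or] at hz
    have h1 := hβ z hz.2
    have h2 := hb z hz.1
    simp only [Pi.mul_apply] at h2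
    have h3 : (z - a) ^ ord a ≠ 0 := pow_ne_zero _ (sub_ne_zero.mpr hz.1)
    have h4 : (zeroPoly T ord).eval z ≠ 0 := zeroPoly_eval_ne_zero hz.2
    have h5 : u.eval z * (z - a) ^ ord a + v.eval z * (zeroPoly T ord).eval z = 1 := by
      simpa using congrArg (eval z) huv
    have h6 : ∑ ξ ∈ T, polar ξ (Function.update β a b ξ) (ord ξ) z =
        ∑ ξ ∈ T, polar ξ (β ξ) (ord ξ) z := Finset.sum_congr rfl fun ξ hξ => by
      rw [Function.update_of_ne (fun h0 : ξ = a => ha (h0 ▸ hξ))]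
    rw [Finset.sum_insert ha, Function.update_self, h6, zeroPoly_insert ha]
    have h7 : A z * (((X - C a) ^ ord a * zeroPoly T ord).eval z)⁻¹ =
        A z * u.eval z * ((zeroPoly T ord).eval z)⁻¹ +
          A z * v.eval z * ((z - a) ^ ord a)⁻¹ := by
      rw [eval_mul, eval_pow, eval_sub, eval_X, eval_C]
      field_simp
      linear_combination (-A z) * h5
    rw [h7, h1, h2]
    ring

section

variable {d : ℕ} {f : Fin d → ℂ → ℂ} {m : Fin d → ℕ}

lemma IsCombination.zero : IsCombination f m fun _ => 0 :=
  ⟨0, fun k => by simp, by simp⟩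

lemma IsCombination.add {g₁ g₂ : ℂ → ℂ} (h₁ : IsCombination f m g₁) (h₂ : IsCombination f m g₂) :
    IsCombination f m fun z => g₁ z + g₂ z := by
  obtain ⟨p, hp, rfl⟩ := h₁
  obtain ⟨q, hq, rfl⟩ := h₂
  refine ⟨fun k => p k + q k, fun k => (degree_add_le _ _).trans_lt (max_lt (hp k) (hq k)), ?_⟩
  ext z
  simp [add_mul, Finset.sum_add_distrib]

lemma IsCombination.const_mul {g : ℂ → ℂ} (h : IsCombination f m g) (a : ℂ) :
    IsCombination f m fun z => a * g z := by
  obtain ⟨p, hp, rfl⟩ := h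
  refine ⟨fun k => C a * p k, fun k => ?_, ?_⟩
  · change (C a * p k).degree < _
    rw [← smul_eq_C_mul]
    exact (degree_smul_le a _).trans_lt (hp k)
  · ext z
    simp [Finset.mul_sum, mul_assoc]

lemma IsCombination.sum {T : Finset ℂ} {g : ℂ → ℂ → ℂ} (h : ∀ ξ ∈ T, IsCombination f m (g ξ)) :
    IsCombination f m fun z => ∑ ξ ∈ T, g ξ z := by
  classical
  induction T using Finset.induction_on with
  | empty => simpa using IsCombination.zero
  | insert a T ha ih =>
    simp only [Finset.sum_insert ha]
    exact (h a (Finset.mem_insert_self a T)).add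
      (ih fun ξ hξ => h ξ (Finset.mem_insert_of_mem hξ))

end

section

variable {E : Set ℂ} {Φ Ψ : ℂ → ℂ} {K : ℕ → ℂ → ℂ} {G : ℂ → ℂ} {d : ℕ} {f : Fin d → ℂ → ℂ}
  {m : Fin d → ℕ} {S : Finset ℂ} {ord : ℂ → ℕ} {σ : ℝ}

/-- Every principal part at a system pole, up to the order of the pole, is attained by a
combination. -/
lemma PoleSystem.exists_combination (hS : PoleSystem E Φ f m S ord σ) {ξ : ℂ} (hξ : ξ ∈ S)
    {t : ℕ} (ht : t ≤ ord ξ) (β : ℕ → ℂ) :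
    ∃ g, IsCombination f m g ∧ SplitsOn E Φ (σ * ‖Φ ξ‖) ξ β t g := by
  induction t generalizing β with
  | zero => exact ⟨_, IsCombination.zero, 0, fun z _ => analyticAt_const, by simp [polar]⟩
  | succ t ih =>
    obtain ⟨g₁, hg₁, b, hb, F₁, hF₁, hgF₁⟩ := hS.exists_splitsOn ξ hξ (t + 1) (by omega) ht
    rw [Nat.add_sub_cancel] at hb
    obtain ⟨g₂, hg₂, F₂, hF₂, hgF₂⟩ := ih (by omega) fun j => β j - β t / b t * b j
    refine ⟨_, hg₂.add (hg₁.const_mul (β t / b t)), fun z => F₂ z + β t / b t * F₁ z,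
      fun z hz => (hF₂ z hz).add (analyticAt_const.mul (hF₁ z hz)), ?_⟩
    filter_upwards [hgF₁, hgF₂] with z h1 h2
    have h3 : polar ξ (fun j => β j - β t / b t * b j) t z =
        polar ξ β t z - β t / b t * polar ξ b t z := by
      simp only [polar, Finset.mul_sum, ← Finset.sum_sub_distrib]
      exact Finset.sum_congr rfl fun j _ => by ring
    have h4 : ∀ c : ℕ → ℂ, polar ξ c (t + 1) z = polar ξ c t z + c t * ((z - ξ) ^ (t + 1))⁻¹ :=
      fun c => Finset.sum_range_succ _ _
    rw [h1, h2, h3, h4, h4]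
    field_simp
    ring

/-! ### Continuation of combinations -/

/-- If the product of `F` with the limit of the denominators continues to a larger canonical
domain, then the new poles of `F` are system poles, and combinations remove them. -/
lemma PoleSystem.exists_splitsOn_of_extension (hS : PoleSystem E Φ f m S ord σ)
    (h : ExteriorPair E Φ Ψ) {ξ : ℂ} {b : ℕ → ℂ} {s : ℕ} {ρ κ : ℝ} (hρ : 1 < ρ)
    (hκ : κ ≤ σ * ρ) {g F H : ℂ → ℂ} (hg : IsCombination f m g)
    (hF : AnalyticOnNhd ℂ F (canonicalDomain E Φ ρ))
    (hgF : g =ᶠ[𝓝ˢ E] fun z => F z + polar ξ b s z)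
    (hH : AnalyticOnNhd ℂ H (canonicalDomain E Φ κ))
    (hHF : H =ᶠ[𝓝ˢ E] fun z => (zeroPoly S ord).eval z * F z) :
    ∃ g', IsCombination f m g' ∧ SplitsOn E Φ κ ξ b s g' := by
  classical
  rcases le_or_gt κ ρ with hle | hlt
  · exact ⟨g, hg, F, fun z hz => hF z (canonicalDomain_mono hle hz), hgF⟩
  set T : Finset ℂ := S.filter fun η => ρ ≤ ‖Φ η‖ ∧ ‖Φ η‖ < κ with hT
  have hTS : T ⊆ S := Finset.filter_subset _ _
  have hTρ : ∀ η ∈ T, η ∉ canonicalDomain E Φ ρ := fun η hη hmem =>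
    absurd (mem_canonicalDomain.mp hmem (hS.notMem η (hTS hη)))
      (not_lt.mpr (Finset.mem_filter.mp hη).2.1)
  have hTκ : ∀ η ∈ T, η ∈ canonicalDomain E Φ κ := fun η hη =>
    mem_canonicalDomain.mpr fun _ => (Finset.mem_filter.mp hη).2.2
  have hcompl : ∀ z ∈ canonicalDomain E Φ κ, z ∉ canonicalDomain E Φ ρ → z ∉ S \ T := by
    intro z hzκ hzρ hz
    rw [Finset.mem_sdiff, hT, Finset.mem_filter, not_and] at hz
    have hzE := hS.notMem z hz.1
    refine hz.2 hz.1 ⟨?_, mem_canonicalDomain.mp hzκ hzE⟩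
    by_contra hlt'
    exact hzρ (mem_canonicalDomain.mpr fun _ => not_le.mp hlt')
  have hmul : ∀ z, (zeroPoly S ord).eval z =
      (zeroPoly (S \ T) ord).eval z * (zeroPoly T ord).eval z := fun z => by
    rw [← eval_mul, zeroPoly, zeroPoly, zeroPoly, Finset.prod_sdiff hTS]
  have hHF' : ∀ z ∈ canonicalDomain E Φ ρ, H z = (zeroPoly S ord).eval z * F z :=
    h.eqOn_of_eventuallyEq hρ (fun z hz => hH z (canonicalDomain_mono hlt.le hz))
      (fun z hz => (analyticAt_polynomial _ z).mul (hF z hz)) hHF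
  -- The continuation of the product of `F` with the factors vanishing at the new poles.
  set A : ℂ → ℂ := fun z => if z ∈ canonicalDomain E Φ ρ then F z * (zeroPoly T ord).eval z
    else H z / (zeroPoly (S \ T) ord).eval z with hA
  have hAan : AnalyticOnNhd ℂ A (canonicalDomain E Φ κ) := by
    intro z hz
    by_cases hzρ : z ∈ canonicalDomain E Φ ρ
    · refine ((hF z hzρ).mul (analyticAt_polynomial (zeroPoly T ord) z)).congr ?_
      filter_upwards [(h.isOpen_canonicalDomain hρ).mem_nhds hzρ] with y hy
      simp only [hA, if_pos hy, Pi.mul_apply]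
    · have hzT := hcompl z hz hzρ
      refine ((hH z hz).div (analyticAt_polynomial (zeroPoly (S \ T) ord) z)
        (zeroPoly_eval_ne_zero hzT)).congr ?_
      filter_upwards [(S \ T).finite_toSet.isClosed.isOpen_compl.mem_nhds hzT] with y hy
      simp only [hA, Pi.div_apply]
      split_ifs with hyρ
      · have h1 : (zeroPoly (S \ T) ord).eval y ≠ 0 := zeroPoly_eval_ne_zero hy
        rw [hHF' y hyρ, hmul y]
        field_simp
      · rfl
  obtain ⟨β, B, hB, hβ⟩ := exists_principal_parts T ord A fun η hη => hAan η (hTκ η hη)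
  have hcomb : ∀ η, ∃ g, η ∈ T → IsCombination f m g ∧
      SplitsOn E Φ (σ * ‖Φ η‖) η (β η) (ord η) g := by
    intro η
    by_cases hη : η ∈ T
    · obtain ⟨g, hg⟩ := hS.exists_combination (hTS hη) le_rfl (β η)
      exact ⟨g, fun _ => hg⟩
    · exact ⟨0, fun h0 => absurd h0 hη⟩
  choose γ hγ using hcomb
  have hsplit : ∀ η, ∃ F, η ∈ T → AnalyticOnNhd ℂ F (canonicalDomain E Φ κ) ∧
      γ η =ᶠ[𝓝ˢ E] fun z => F z + polar η (β η) (ord η) z := by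
    intro η
    by_cases hη : η ∈ T
    · have h1 : κ ≤ σ * ‖Φ η‖ := hκ.trans (mul_le_mul_of_nonneg_left
        (Finset.mem_filter.mp hη).2.1 (by linarith [hS.one_lt]))
      obtain ⟨F, hF⟩ := (hγ η hη).2.mono h1
      exact ⟨F, fun _ => hF⟩
    · exact ⟨0, fun h0 => absurd h0 hη⟩
  choose L hL using hsplit
  refine ⟨_, hg.add ((IsCombination.sum fun η hη => (hγ η hη).1).const_mul (-1)),
    fun z => B z - ∑ η ∈ T, L η z, fun z hz => (hB z (hAan z hz)).sub
      (Finset.analyticAt_fun_sum _ fun η hη => (hL η hη).1 z hz), ?_⟩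
  have hev : ∀ᶠ z in 𝓝ˢ E, ∀ η ∈ T, γ η z = L η z + polar η (β η) (ord η) z :=
    (Finset.eventually_all T).mpr fun η hη => (hL η hη).2
  have hρev : ∀ᶠ z in 𝓝ˢ E, z ∈ canonicalDomain E Φ ρ :=
    h.eventually_of_canonicalDomain hρ fun z hz => hz
  filter_upwards [hgF, hev, hρev] with z h1 h2 h3
  have hzT : z ∉ T := fun hz => hTρ z hz h3
  have h4 := hβ z hzT
  have h5 : (zeroPoly T ord).eval z ≠ 0 := zeroPoly_eval_ne_zero hzT
  simp only [hA, if_pos h3] at h4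
  rw [mul_inv_cancel_right₀ h5] at h4
  rw [h1, h4, Finset.sum_congr rfl h2, Finset.sum_add_distrib]
  ring

/-- If the Taylor coefficients of the denominators at the pole decay, then so do the integrals of
`Z F K_n`, where `Z` is the limit of the denominators. -/
lemma growthLE_pairing_zeroPoly (h : ExteriorPair E Φ Ψ) (hK : KernelFamily E Φ K G)
    {Z : ℂ[X]} {q : ℕ → ℂ[X]} {N : ℕ} (hZN : Z.natDegree ≤ N) (hqN : ∀ n, (q n).natDegree ≤ N)
    (hσ : 0 < σ) (hqZ : ∀ i, GrowthLE (fun n => (q n - Z).coeff i) σ⁻¹)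
    (hq : ∀ᶠ n in atTop, IsOrthogonal Ψ K f m n (q n)) {ξ : ℂ} (hξ : ξ ∉ E) {s : ℕ} {θ : ℝ}
    (hθ : 0 ≤ θ) (hθq : ∀ j < s, GrowthLE (fun n => (taylor ξ (q n)).coeff j) θ)
    {b : ℕ → ℂ} {ρ r κ : ℝ} (hr : 1 < r) (hrρ : r < ρ) (hκ : 0 < κ) (hκθ : κ * θ ≤ ‖Φ ξ‖)
    (hκρ : κ ≤ σ * ρ) {g F : ℂ → ℂ} (hg : IsCombination f m g)
    (hF : AnalyticOnNhd ℂ F (canonicalDomain E Φ ρ))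
    (hgF : g =ᶠ[𝓝ˢ E] fun z => F z + polar ξ b s z) :
    GrowthLE (fun n => pairing Ψ K r n Z F) κ⁻¹ := by
  have hξ1 := h.one_lt ξ hξ
  obtain ⟨r', hr', hr'ξ⟩ := exists_between hξ1
  have h1 : GrowthLE (fun n => -∑ j ∈ Finset.range s,
      b j * pairing Ψ K r' n (q n) (fun z => ((z - ξ) ^ (j + 1))⁻¹)) κ⁻¹ := by
    refine (GrowthLE.sum fun j hj => (GrowthLE.const_mul ?_ (b j))).neg
    refine (growthLE_pairing_of_taylor h hK hr' hξ hr'ξ hqN hθ fun i hi =>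
      hθq i (hi.trans_lt (Finset.mem_range.mp hj))).mono ?_
    rw [← div_eq_mul_inv, div_le_iff₀ (by linarith), inv_mul_eq_div, le_div_iff₀ hκ, mul_comm]
    exact hκθ
  have h2 : GrowthLE (fun n => pairing Ψ K r n (q n - Z) F) κ⁻¹ := by
    refine (growthLE_pairing h hK hr hrρ hF (fun n => natDegree_sub_le_of_le (hqN n) hZN)
      (inv_nonneg.mpr hσ.le) hqZ).mono ?_
    rw [← mul_inv]
    exact inv_anti₀ hκ hκρ
  refine (h1.sub h2).congr' ?_
  filter_upwards [hq] with n hn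
  rw [← hn.pairing_eq h hK hg hξ hF hgF hr hrρ hr' hr'ξ, pairing, pairing, pairing,
    ← h.levelIntegral_sub hr]
  · refine h.levelIntegral_congr hr fun z _ _ => ?_
    rw [eval_sub]
    ring
  all_goals
    intro z hz hzr
    exact (((analyticAt_polynomial _ z).mul (hF z (mem_canonicalDomain.mpr fun _ =>
      hzr ▸ hrρ))).mul (hK.analytic n z hz)).continuousAt

/-- Decay of the Taylor coefficients of the denominators at `ξ` yields combinations with only a
pole at `ξ` in a canonical domain whose index is governed by the rate of decay. Each continuation
step enlarges the index of the domain by the factor `σ`. -/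
theorem PoleSystem.exists_splitsOn_of_growthLE (hS : PoleSystem E Φ f m S ord σ)
    (h : ExteriorPair E Φ Ψ) (hK : KernelFamily E Φ K G) {q : ℕ → ℂ[X]} {N : ℕ}
    (hN : ∑ ξ ∈ S, ord ξ = N) (hqN : ∀ n, (q n).natDegree ≤ N)
    (hqZ : ∀ i, GrowthLE (fun n => (q n - zeroPoly S ord).coeff i) σ⁻¹)
    (hq : ∀ᶠ n in atTop, IsOrthogonal Ψ K f m n (q n)) {ξ : ℂ} (hξ : ξ ∉ E) {s : ℕ} {θ : ℝ}
    (hθ : 0 ≤ θ) (hθq : ∀ j < s, GrowthLE (fun n => (taylor ξ (q n)).coeff j) θ)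
    {b : ℕ → ℂ} {ρ₀ κ : ℝ} (hρ₀ : ‖Φ ξ‖ < ρ₀) (hκ : ‖Φ ξ‖ < κ) (hκθ : κ * θ ≤ ‖Φ ξ‖)
    {g : ℂ → ℂ} (hg : IsCombination f m g) (hsplit : SplitsOn E Φ ρ₀ ξ b s g) :
    ∃ g', IsCombination f m g' ∧ SplitsOn E Φ κ ξ b s g' := by
  have hξ1 := h.one_lt ξ hξ
  have hσ := hS.one_lt
  have hiter : ∀ k : ℕ, ∃ ρ > ‖Φ ξ‖, min κ (σ ^ k * ρ₀) ≤ ρ ∧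
      ∃ g', IsCombination f m g' ∧ SplitsOn E Φ ρ ξ b s g' := by
    intro k
    induction k with
    | zero => exact ⟨ρ₀, hρ₀, by simp, g, hg, hsplit⟩
    | succ k ih =>
      obtain ⟨ρ, hρ, hmin, g₁, hg₁, F, hF, hgF⟩ := ih
      have hρ1 : 1 < ρ := hξ1.trans hρ
      have hρσ : ρ < σ * ρ := lt_mul_of_one_lt_left (by linarith) hσ
      set κ' := min κ (σ * ρ) with hκ'
      have hκ'ξ : ‖Φ ξ‖ < κ' := lt_min hκ (hρ.trans hρσ)
      have hκ'0 : 0 < κ' := by linarith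
      obtain ⟨r, hr, hrρ⟩ := exists_between hρ1
      have ht := growthLE_pairing_zeroPoly h hK (Z := zeroPoly S ord)
        (by rw [natDegree_zeroPoly, hN]) hqN (by linarith) hqZ hq hξ hθ hθq hr hrρ hκ'0
        ((mul_le_mul_of_nonneg_right (min_le_left _ _) hθ).trans hκθ) (min_le_right _ _) hg₁ hF hgF
      obtain ⟨H, hH, hHF⟩ := exists_extension_of_growthLE h hK hr hrρ (hξ1.trans hκ'ξ)
        (H := fun z => (zeroPoly S ord).eval z * F z)
        (fun z hz => (analyticAt_polynomial _ z).mul (hF z hz)) ht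
      refine ⟨κ', hκ'ξ, ?_, hS.exists_splitsOn_of_extension h hρ1 (min_le_right _ _) hg₁ hF hgF
        hH hHF⟩
      refine le_min (min_le_left _ _) ?_
      rcases min_le_iff.mp hmin with h1 | h1
      · exact (min_le_left _ _).trans (h1.trans hρσ.le)
      · refine (min_le_right _ _).trans ?_
        rw [pow_succ', mul_assoc]
        exact mul_le_mul_of_nonneg_left h1 (by linarith)
  obtain ⟨k, hk⟩ := pow_unbounded_of_one_lt (κ / ρ₀) hσ
  obtain ⟨ρ, -, hmin, g', hg', hsp⟩ := hiter k
  rw [div_lt_iff₀ (by linarith)] at hk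
  rw [min_eq_left hk.le] at hmin
  exact ⟨g', hg', hsp.mono hmin⟩

end

/-! ### The pole indices -/

lemma eval_iterate_derivative_eq (q : ℂ[X]) (ξ : ℂ) (j : ℕ) :
    (derivative^[j] q).eval ξ = (j.factorial : ℂ) * (taylor ξ q).coeff j := by
  rw [taylor_coeff, ← factorial_smul_hasseDeriv]
  simp

lemma growthLE_iterate_derivative_iff {q : ℕ → ℂ[X]} {ξ : ℂ} {j : ℕ} {θ : ℝ} :
    GrowthLE (fun n => (derivative^[j] (q n)).eval ξ) θ ↔
      GrowthLE (fun n => (taylor ξ (q n)).coeff j) θ := by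
  have hj : (j.factorial : ℂ) ≠ 0 := by exact_mod_cast j.factorial_ne_zero
  simp only [eval_iterate_derivative_eq]
  refine ⟨fun h => ?_, fun h => h.const_mul _⟩
  simpa [inv_mul_cancel_left₀ hj] using h.const_mul (j.factorial : ℂ)⁻¹

section

variable {E : Set ℂ} {Φ Ψ : ℂ → ℂ} {d : ℕ} {f : Fin d → ℂ → ℂ} {m : Fin d → ℕ}

lemma exists_splitsOn_of_lt_systemPoleIndex (h : ExteriorPair E Φ Ψ) {ξ : ℂ} {s : ℕ} (hs : 1 ≤ s)
    {ρ : ℝ} (hρ : ENNReal.ofReal ρ < systemPoleIndex E Φ f m ξ s) :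
    ∃ g, IsCombination f m g ∧ ∃ b : ℕ → ℂ, b (s - 1) ≠ 0 ∧ SplitsOn E Φ ρ ξ b s g := by
  simp only [systemPoleIndex, poleIndex, lt_iSup_iff] at hρ
  obtain ⟨g, hg, hpole, ρ', hρ'1, hext, hlt⟩ := hρ
  obtain ⟨ρ₀, hρ₀, b, hb, hsp⟩ := hpole.exists_splitsOn h hs
  have hle : ρ ≤ ρ' := (ENNReal.ofReal_lt_ofReal_iff (by linarith)).mp hlt |>.le
  exact ⟨g, hg, b, hb, (hext.splitsOn h hpole.1 hs hb hρ₀ hsp).mono hle⟩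

lemma SplitsOn.le_systemPoleIndex (h : ExteriorPair E Φ Ψ) {ξ : ℂ} (hξ : ξ ∉ E) {s : ℕ}
    (hs : 1 ≤ s) {b : ℕ → ℂ} (hb : b (s - 1) ≠ 0) {ρ : ℝ} (hρ : ‖Φ ξ‖ < ρ) {g : ℂ → ℂ}
    (hg : IsCombination f m g) (hsp : SplitsOn E Φ ρ ξ b s g) :
    ENNReal.ofReal ρ ≤ systemPoleIndex E Φ f m ξ s := by
  refine le_iSup₂_of_le g hg (le_iSup_of_le (hsp.hasOnlyPole h hξ hs hb hρ) ?_)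
  exact le_iSup₂_of_le ρ ((h.one_lt ξ hξ).trans hρ)
    (le_iSup_of_le (hsp.extendsWithPoles hs hb hρ) le_rfl)

end

end HermitePade

theorem mainTheorem2
    (E : Set ℂ) (hE_compact : IsCompact E) (hE_connected : IsConnected E)
    (hE_compl : IsConnected Eᶜ)
    (Φ : ℂ → ℂ) (hΦ : IsExteriorMap E Φ)
    (α : ℕ → ℕ → ℂ) (hα : ∀ n k, 1 ≤ k → k ≤ n → α n k ∈ E)
    (c : ℝ) (hc : 0 < c) (G : ℂ → ℂ) (hG : NodesAsymptotic E Φ α c G)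
    {d : ℕ} (f : Fin d → ℂ → ℂ) (hf : ∀ k, AnalyticOnNhd ℂ (f k) E)
    (m : Fin d → ℕ)
    (Q : ℕ → ℂ[X]) (P : ℕ → Fin d → ℂ[X])
    (hQ : ∀ n, ∑ k, m k ≤ n → (Q n).Monic ∧ IsApproximant E α f m n (Q n) (P n))
    (hpoles : HasExactlySystemPoles E Φ f m (∑ k, m k))
    (ξ : ℂ) (τ : ℕ) (hξ : IsSystemPole E Φ f m ξ τ) (l : ℕ) (hl : l < τ) :
    (Finset.range (l + 1)).sup (fun j =>
        limsup (fun n : ℕ =>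
          ENNReal.ofReal (‖(derivative^[j] (Q n)).eval ξ‖ ^ (1 / (n : ℝ)))) atTop)
      = ENNReal.ofReal ‖Φ ξ‖ / systemPoleRadius E Φ f m ξ (l + 1) := by
  obtain ⟨Ψ, h⟩ := hΦ.exists_pair hE_compact hE_connected
  have hK := h.kernelFamily hα hc hG
  obtain ⟨S, ord, hSiff, hsum⟩ := hpoles
  set N := ∑ k, m k with hNdef
  obtain ⟨σ, hS⟩ := exists_poleSystem h (S := S) (ord := ord) fun η hη =>
    (hSiff η _).mpr ⟨hη, rfl⟩
  obtain ⟨hξS, -⟩ := (hSiff ξ τ).mp hξ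
  have hξE := hS.notMem ξ hξS
  have hξ1 := h.one_lt ξ hξE
  have hξ0 : 0 < ‖Φ ξ‖ := by linarith
  -- The finitely many denominators of index less than `|m|` are unrestricted; they are discarded.
  set q : ℕ → ℂ[X] := fun n => if N ≤ n then Q n else 0 with hq
  have hqQ : ∀ᶠ n in atTop, q n = Q n := by
    filter_upwards [eventually_ge_atTop N] with n hn
    simp only [hq, if_pos hn]
  have hqN : ∀ n, (q n).natDegree ≤ N := by
    intro n
    simp only [hq]
    split_ifs with hn
    · exact natDegree_le_of_degree_le (hQ n hn).2.degree_den
    · simp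
  have hqmonic : ∀ᶠ n in atTop, (q n).Monic := by
    filter_upwards [eventually_ge_atTop N, hqQ] with n hn hnq
    rw [hnq]
    exact (hQ n hn).1
  have hqorth : ∀ᶠ n in atTop, IsOrthogonal Ψ (nodalKernel α c) f m n (q n) := by
    filter_upwards [eventually_ge_atTop N, eventually_ge_atTop 1, hqQ] with n hn hn1 hnq
    rw [hnq]
    exact (hQ n hn).2.isOrthogonal h hα hK hn1
  obtain ⟨hq1, hqZ⟩ := hS.growthLE_coeff_sub_zeroPoly h hK hsum hqN hqmonic hqorth
  have hlimsup : ∀ (j : ℕ) (θ : ℝ), 0 ≤ θ → (limsup (fun n : ℕ =>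
      ENNReal.ofReal (‖(derivative^[j] (Q n)).eval ξ‖ ^ (1 / (n : ℝ)))) atTop ≤
        ENNReal.ofReal θ ↔ GrowthLE (fun n => (taylor ξ (q n)).coeff j) θ) := by
    intro j θ hθ
    have hev : (fun n => (derivative^[j] (Q n)).eval ξ) =ᶠ[atTop]
        fun n => (derivative^[j] (q n)).eval ξ := by
      filter_upwards [hqQ] with n hn
      rw [hn]
    rw [limsup_le_iff_growthLE hθ, ← growthLE_iterate_derivative_iff]
    exact ⟨fun hg => hg.congr' hev, fun hg => hg.congr' hev.symm⟩
  have hpole : ∀ s ∈ Finset.Icc 1 (l + 1), ∃ g, IsCombination f m g ∧ ∃ ρ > ‖Φ ξ‖,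
      ∃ b : ℕ → ℂ, b (s - 1) ≠ 0 ∧ SplitsOn E Φ ρ ξ b s g := by
    intro s hs
    rw [Finset.mem_Icc] at hs
    obtain ⟨g, hg, hgp⟩ := hξ.1.2 s hs.1 (by omega)
    exact ⟨g, hg, hgp.exists_splitsOn h hs.1⟩
  have hR : ENNReal.ofReal ‖Φ ξ‖ < systemPoleRadius E Φ f m ξ (l + 1) := by
    refine (Finset.lt_inf_iff ENNReal.ofReal_lt_top).mpr fun s hs => ?_
    obtain ⟨g, hg, ρ, hρ, b, hb, hsp⟩ := hpole s hs
    exact ((ENNReal.ofReal_lt_ofReal_iff (hξ0.trans hρ)).mpr hρ).trans_le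
      (hsp.le_systemPoleIndex h hξE (Finset.mem_Icc.mp hs).1 hb hρ hg)
  have hR0 : systemPoleRadius E Φ f m ξ (l + 1) ≠ 0 := (pos_of_gt hR).ne'
  refine le_antisymm (Finset.sup_le fun j hj => ?_) ?_
  · rw [Finset.mem_range] at hj
    -- Every `ρ` below the radius admits, for each order, a combination with only a pole at `ξ` in
    -- the domain of index `ρ`; this forces decay of the derivatives at the rate `‖Φ ξ‖ / ρ`.
    rw [ENNReal.le_div_iff_mul_le (Or.inl hR0) (Or.inr ENNReal.ofReal_ne_top)]
    refine ENNReal.mul_le_of_forall_lt fun x hx y hy => ?_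
    obtain ⟨ρ', hρ'1, hρ'2⟩ := exists_between (max_lt hy hR)
    rw [max_lt_iff] at hρ'1
    have hρ'top : ρ' ≠ ⊤ := (hρ'2.trans_le le_top).ne
    set ρ := ρ'.toReal with hρ
    have hρ'eq : ρ' = ENNReal.ofReal ρ := (ENNReal.ofReal_toReal hρ'top).symm
    rw [hρ'eq] at hρ'1 hρ'2
    have hρξ : ‖Φ ξ‖ < ρ := (ENNReal.ofReal_lt_ofReal_iff_of_nonneg hξ0.le).mp hρ'1.2
    have hρ0 : 0 < ρ := hξ0.trans hρξ
    have hθ0 : 0 ≤ ρ⁻¹ * ‖Φ ξ‖ := by positivity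
    have hgrow := growthLE_taylor_of_splitsOn h hK hqN hq1 hqorth hξE (hξ1.trans hρξ) (t := l + 1)
      (fun s hs1 hs2 => exists_splitsOn_of_lt_systemPoleIndex h hs1
        (hρ'2.trans_le (Finset.inf_le (Finset.mem_Icc.mpr ⟨hs1, hs2⟩)))) j hj
    calc x * y ≤ ENNReal.ofReal (ρ⁻¹ * ‖Φ ξ‖) * ENNReal.ofReal ρ :=
          mul_le_mul' (hx.le.trans ((hlimsup j _ hθ0).mpr hgrow)) hρ'1.1.le
      _ = ENNReal.ofReal ‖Φ ξ‖ := by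
          rw [← ENNReal.ofReal_mul hθ0]
          congr 1
          field_simp
  · -- Decay at a rate `θ < ‖Φ ξ‖ / R` would continue combinations up to the index `‖Φ ξ‖ / θ > R`.
    by_contra hlt
    rw [not_le] at hlt
    obtain ⟨θ', hθ1, hθ2⟩ := exists_between hlt
    have hquot : ENNReal.ofReal ‖Φ ξ‖ / systemPoleRadius E Φ f m ξ (l + 1) ≤ 1 :=
      ENNReal.div_le_of_le_mul (by rw [one_mul]; exact hR.le)
    have hθ'1 : θ' < 1 := hθ2.trans_le hquot
    have hθ'top : θ' ≠ ⊤ := (hθ'1.trans ENNReal.one_lt_top).ne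
    set θ := θ'.toReal with hθ
    have hθ'eq : θ' = ENNReal.ofReal θ := (ENNReal.ofReal_toReal hθ'top).symm
    have hθ0 : 0 < θ := ENNReal.toReal_pos (pos_of_gt hθ1).ne' hθ'top
    have hθlt : θ < 1 := by
      rw [hθ'eq, ← ENNReal.ofReal_one] at hθ'1
      exact (ENNReal.ofReal_lt_ofReal_iff one_pos).mp hθ'1
    set κ := ‖Φ ξ‖ / θ with hκ
    have hκξ : ‖Φ ξ‖ < κ := (lt_div_iff₀ hθ0).mpr (mul_lt_of_lt_one_right hξ0 hθlt)
    have hgrow : ∀ j < l + 1, GrowthLE (fun n => (taylor ξ (q n)).coeff j) θ := fun j hj => by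
      rw [← hlimsup j θ hθ0.le, ← hθ'eq]
      exact (Finset.le_sup (f := fun j => limsup (fun n : ℕ =>
        ENNReal.ofReal (‖(derivative^[j] (Q n)).eval ξ‖ ^ (1 / (n : ℝ)))) atTop)
        (Finset.mem_range.mpr hj)).trans hθ1.le
    have hRκ : ENNReal.ofReal κ ≤ systemPoleRadius E Φ f m ξ (l + 1) := by
      refine Finset.le_inf fun s hs => ?_
      obtain ⟨g, hg, ρ, hρ, b, hb, hsp⟩ := hpole s hs
      rw [Finset.mem_Icc] at hs
      obtain ⟨g', hg', hsp'⟩ := hS.exists_splitsOn_of_growthLE h hK hsum hqN hqZ hqorth hξE hθ0.le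
        (fun j hj => hgrow j (by omega)) hρ hκξ (div_mul_cancel₀ _ hθ0.ne').le hg hsp
      exact hsp'.le_systemPoleIndex h hξE hs.1 hb hκξ hg'
    refine absurd hθ2 (not_lt.mpr ?_)
    rw [hθ'eq]
    refine ENNReal.div_le_of_le_mul ?_
    calc ENNReal.ofReal ‖Φ ξ‖ = ENNReal.ofReal θ * ENNReal.ofReal κ := by
          rw [← ENNReal.ofReal_mul hθ0.le, hκ, mul_div_cancel₀ _ hθ0.ne']
      _ ≤ _ := by gcongr
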